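/- **Setting.** Let $r>1$ and let $c\in(0,1)$ be a Rayleigh speed: $2-c^2=2q$, where $\omega_1=i\sqrt{1-c^2}$, $\omega_2=i\sqrt{1-c^2/r}$, $\omega_3=\overline{\omega_1}$, $\omega_4=\overline{\omega_2}$ and $q>0$, $q^2=-\omega_1\omega_2$. Put $r_j=(-\omega_j,1)^T$, $R_j(n)=(-\omega_j,1,-in\omega_j^2,in\omega_j)^T$ for $j=1,3$ and $r_j=(1,\omega_j)^T$, $R_j(n)=(1,\omega_j,in\omega_j,in\omega_j^2)^T$ for $j=2,4$. Consider the two-dimensional Saint Venant–Kirchhoff stress $(1+A)(\lambda\,\mathrm{tr}E+2\mu E)$, $E=\frac12(A+A^T+A^TA)$, with $A=\nabla U$, $\mu=1$, $\lambda=r-2$; let $Q$ and $C$ be its quadratic and cubic parts in $A$, written as a bilinear and a trilinear form, with columns $Q_1,Q_2$ and $C_1,C_2$. Profiles are real, $U_k=\underline U_k(t,x,y)+U_k^*(t,x,\theta,Y)\in S$ for $k\ge2$, and $U_k=0$ for $k<2$. Here $S=\underline S\oplus S^*$, $\underline S=H^\infty([0,T]\times\mathbb R\times[0,\infty))$, and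 $S^*$ consists of the $u\in H^\infty([0,T]\times\mathbb R_x\times\mathbb T_\theta\times[0,\infty)_Y)$ all of whose derivatives satisfy $|\partial^a u(t,\cdot,\theta,Y)|_{L^2(\mathbb R_x)}\le C_ae^{-\delta Y}$ with a $\delta>0$ independent of $a$. A superscript $n$ denotes the Fourier coefficient in $u=\sum_n u^ne^{in\theta}$. *Cascade.* Substituting $U=\sum_k\varepsilon^kU_k(t,x,y,\theta,Y)$, $\theta=(x-ct)/\varepsilon$, $Y=y/\varepsilon$, into $\partial_t^2U=\nabla\cdot(\text{stress})$ for $y>0$, (second column of the stress) $=\varepsilon^2(f,g)^T(t,x,\theta)$ on $y=0$, gives at each order $L_{ff}U_k=(H_{k-1},K_{k-1})$ and $l_fU_k=(h_{k-1},k_{k-1})$ at $y=Y=0$. For $m\ge1$, with $\partial^0=(\partial_x,\partial_y)$, $\partial^1=(\partial_\theta,\partial_Y)$ and $s_i\in\{0,1\}$, $$\begin{pmatrix}H_m\\K_m\end{pmatrix}=-L_{fs}U_m-L_{ss}U_{m-1}+\sum\partial^{s_2}\!\cdot Q(\partial^{s_0}U_i,\partial^{s_1}U_j)+\sum\partial^{s_3}\!\cdot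 C(\partial^{s_0}U_i,\partial^{s_1}U_j,\partial^{s_2}U_l),$$ $$\begin{pmatrix}h_m\\k_m\end{pmatrix}=-l_sU_m-\sum Q_2(\partial^{s_0}U_i,\partial^{s_1}U_j)-\sum C_2(\partial^{s_0}U_i,\partial^{s_1}U_j,\partial^{s_2}U_l)+\mathbf 1_{m=2}\begin{pmatrix}f\\g\end{pmatrix},$$ the sums being over all $s$ and over all indices whose sum is $m-1+\sum s$ in the first line and $m+\sum s$ in the second. With $J=\begin{pmatrix}0&1\\1&0\end{pmatrix}$, $L_{fs}=-2c\,\partial_{t\theta}-\mathrm{diag}(2r,2)\partial_{x\theta}-(r-1)J(\partial_{xY}+\partial_{y\theta})-\mathrm{diag}(2,2r)\partial_{yY}$, $L_{ss}=\partial_{tt}-\mathrm{diag}(r,1)\partial_{xx}-(r-1)J\partial_{xy}-\mathrm{diag}(1,r)\partial_{yy}$, $l_s=\begin{pmatrix}0&1\\r-2&0\end{pmatrix}\partial_x+\mathrm{diag}(1,r)\partial_y$; and $l_f$ acts on the mode $n$ as $C(\beta,n)(U^n,\partial_YU^n)$, where $C(\beta,n)=\begin{pmatrix}0&in&1&0\\(r-2)in&0&0&r\end{pmatrix}$.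 The interior source is modified by Taylor expansion in $y=\varepsilon Y$ of its mixed (surface times non-decaying) parts: for $n\ne0$, $$(H'_m,K'_m)^n=\sum_{j=0\text{ or }1\le j\le m-5}\frac{Y^j}{j!}\,\partial_y^j(H_{m-j},K_{m-j})^n\big|_{y=0},$$ and $(H'_m,K'_m)^{0*}$ is given by the same formula for $n=0$ with the limit as $Y\to\infty$ subtracted from every $\partial_y^j(H_{m-j},K_{m-j})^0|_{y=0}$. *Pieces of $U_k$.* $U_k=\underline U_k+U_k^{0*}+U_{k,p}+U_{k,h}+U_{k,\alpha}$, where - $U_k^{0*}=-\int_Y^\infty\!\int_s^\infty(H'_{k-1},\tfrac1rK'_{k-1})^{0*}(t,x,z)\,dz\,ds$; - for $n\neq0$, $U_{k,p}^n=\sum_j\tau_j^nr_j$ and $\tilde U_{k,p}^n=(U_{k,p}^n,\partial_YU_{k,p}^n)=\sum_j\tau^n_jR_j(n)$, where $\tau_j^n=\int e^{in\omega_j(Y-s)}F_j^n(s)\,ds$ with $\int=\int_0^Y$ if $n>0,\ j\le2$ or $n<0,\ j\ge3$, and $\int=-\int_Y^\infty$ otherwise; $F_j^n=\frac{\omega_jH'^n_{k-1}-K'^n_{k-1}}{2i\omega_jc^2n}$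 for $j=1,3$ and $F^n_j=-\frac{H'^n_{k-1}+\omega_jK'^n_{k-1}}{2i\omega_jc^2n}$ for $j=2,4$; - for $n>0$, $U_{k,h}^n=\sigma_1e^{in\omega_1Y}r_1+\sigma_2e^{in\omega_2Y}r_2$ with $(\sigma_1,\sigma_2)=\frac1{in}\mathcal B_{Lop}^{-1}\big((h_{k-1},k_{k-1})^n-C(\beta,n)\tilde U^n_{k,p}|_{Y=0}\big)$, where $\mathcal B_{Lop}=\begin{pmatrix}2-c^2&2\omega_2\\2\omega_1&c^2-2\end{pmatrix}$ and $\mathcal B_{Lop}^{-1}$ is the inverse of $\mathcal B_{Lop}:(\ker\mathcal B_{Lop})^\perp\to\mathrm{Im}\,\mathcal B_{Lop}$, set to be $0$ off the image; for $n<0$, $U_{k,h}^n=\overline{U_{k,h}^{-n}}$; - $U_{k,\alpha}^n=\alpha_k^n(t,x)\,\hat r(n,Y)$ for $n\ne0$, where $\hat r(n,Y)=\omega_2e^{in\omega_1Y}r_1-qe^{in\omega_2Y}r_2$ for $n>0$ and $\hat r(n,Y)=\overline{\hat r(-n,Y)}$ for $n<0$. The amplitude $\alpha_k\in H^\infty([0,T]\times\mathbb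 R\times\mathbb T)$ is real with mean zero in $\theta$. The *solvability condition of level $k$* is $$\ell_n\cdot\Big((h_k,k_k)^n-C(\beta,n)\tilde U^n_{k+1,p}|_{Y=0}\Big)=0\quad\text{for all }n\ne0,\ t\in[0,T],\ x\in\mathbb R,$$ with $\ell_n=(q,\omega_2)$ for $n>0$ and $\ell_n=(q,\overline{\omega_2})$ for $n<0$. **Proposition.** There are a real constant $c_0\ne0$ and a kernel $b:\mathbb R^3\to\mathbb C$, depending only on $r$ and $c$, such that $b$ is symmetric in its arguments and (positively) homogeneous of degree two, and the following holds. Let $\mathcal H$ be the Hilbert transform in $\theta$, $\widehat{\mathcal Hf}(n)=-i\,\mathrm{sgn}(n)\hat f(n)$, and $$\widehat{\mathcal B(u,v)}(n)=-\frac1{4\pi c_0}\sum_{n'\ne0}b(-n,n-n',n')\,\hat u(n-n')\,\hat v(n');$$ these series, and the Fourier series of $\mathcal B(u,v)$, converge absolutely for smooth $u,v$ on $\mathbb T$. Let $T>0$ and let $f,g\in H^\infty([0,T]\times\mathbb R\times\mathbb T)$ be real. a) There is a real function $G_2$ depending only on $(f,g)$ such that for every amplitude $\alpha_2$ and every $U_2\in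 S$ with amplitude $\alpha_2$, the solvability condition of level $2$ holds if and only if on $[0,T]\times\mathbb R\times\mathbb T$ $$\partial_t\alpha_2+c\,\partial_x\alpha_2+\mathcal H(\mathcal B(\alpha_2,\alpha_2))=G_2 .$$ b) Let $k\ge3$. There is a real function $G_k$ depending only on $U_2,\dots,U_{k-1}$ (and, for $k=3$, on $(f,g)$) such that, whenever $U_2,\dots,U_{k-1}\in S$, $U_2$ has amplitude $\alpha_2$, and $U_k\in S$ has amplitude $\alpha_k$, the solvability condition of level $k$ holds if and only if on $[0,T]\times\mathbb R\times\mathbb T$ $$\partial_t\alpha_k+c\,\partial_x\alpha_k+2\mathcal H(\mathcal B(\alpha_2,\alpha_k))=G_k .$$ -/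

import Mathlib

open Set MeasureTheory
open scoped ContDiff Matrix ComplexConjugate

noncomputable section

namespace RayleighWave

/-! ## Partial derivatives and function spaces

Functions of finitely many real variables are functions on `Fin d → ℝ`; the variables range over a
box `∏ D i` of closed intervals.  The orders of the variables are
* `(t, x, y)` for the part of a profile that does not decay in the fast normal variable,
* `(t, x, θ, Y)` for the surface part of a profile,
* `(t, x, θ)` for functions on the boundary,
* `(t, x, y, θ, Y)` for everything in the interior. -/

/-- The partial derivative in the variable number `i`, one-sided at the ends of the interval
`D i` in which that variable ranges. -/
def pd {d : ℕ} (D : Fin d → Set ℝ) (i : Fin d) (f : (Fin d → ℝ) → ℝ) : (Fin d → ℝ) → ℝ :=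
  fun p => derivWithin (fun s => f (Function.update p i s)) (D i) (p i)

/-- The iterated partial derivative along a list of variables. -/
def iterPd {d : ℕ} (D : Fin d → Set ℝ) (l : List (Fin d)) (f : (Fin d → ℝ) → ℝ) :
    (Fin d → ℝ) → ℝ :=
  l.foldr (pd D) f

/-- `H^∞`: smooth up to the boundary of the box `∏ D i`, with all partial derivatives square
integrable over `∏ K i`.  (`K` differs from `D` only in the periodic variable, for which it is one
period.) -/
def HInf {d : ℕ} (D K : Fin d → Set ℝ) (f : (Fin d → ℝ) → ℝ) : Prop :=
  ContDiffOn ℝ ∞ f (univ.pi D) ∧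
    ∀ l : List (Fin d), MemLp (iterPd D l f) 2 (volume.restrict (univ.pi K))

/-- Range of `(t, x, y)`. -/
def domLow (T : ℝ) : Fin 3 → Set ℝ := ![Icc 0 T, univ, Ici 0]

/-- Range of `(t, x, θ, Y)`. -/
def domSurf (T : ℝ) : Fin 4 → Set ℝ := ![Icc 0 T, univ, univ, Ici 0]

/-- Range of `(t, x, θ)`. -/
def domBd (T : ℝ) : Fin 3 → Set ℝ := ![Icc 0 T, univ, univ]

/-- Range of `(t, x, y, θ, Y)`. -/
def domAll (T : ℝ) : Fin 5 → Set ℝ := ![Icc 0 T, univ, Ici 0, univ, Ici 0]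

/-- The space `H^∞([0,T] × ℝ × [0,∞))` of functions of `(t, x, y)`. -/
def InLow (T : ℝ) (a : (Fin 3 → ℝ) → ℝ) : Prop := HInf (domLow T) (domLow T) a

/-- The space of functions in `H^∞([0,T] × ℝ × 𝕋 × [0,∞))` of `(t, x, θ, Y)` all of whose
derivatives are `O(e^{-δY})` in `L²(ℝ_x)`, with `δ` independent of the derivative. -/
def InSurf (T : ℝ) (a : (Fin 4 → ℝ) → ℝ) : Prop :=
  HInf (domSurf T) ![Icc 0 T, univ, Icc 0 (2 * Real.pi), Ici 0] a ∧
  (∀ t x θ Y, a ![t, x, θ + 2 * Real.pi, Y] = a ![t, x, θ, Y]) ∧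
  ∃ δ > 0, ∀ l : List (Fin 4), ∃ C : ℝ, ∀ t ∈ Icc 0 T, ∀ θ : ℝ, ∀ Y ∈ Ici (0 : ℝ),
    eLpNorm (fun x => iterPd (domSurf T) l a ![t, x, θ, Y]) 2 volume
      ≤ ENNReal.ofReal (C * Real.exp (-δ * Y))

/-- The space `H^∞([0,T] × ℝ × 𝕋)` of functions of `(t, x, θ)`. -/
def InBd (T : ℝ) (a : (Fin 3 → ℝ) → ℝ) : Prop :=
  HInf (domBd T) ![Icc 0 T, univ, Icc 0 (2 * Real.pi)] a ∧
  ∀ t x θ, a ![t, x, θ + 2 * Real.pi] = a ![t, x, θ]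

/-- A real profile with two components, `U = U̲(t,x,y) + U^*(t,x,θ,Y)`. -/
@[ext] structure Profile where
  /-- the part `U̲(t, x, y)` -/
  low : Fin 2 → (Fin 3 → ℝ) → ℝ
  /-- the part `U^*(t, x, θ, Y)` -/
  surf : Fin 2 → (Fin 4 → ℝ) → ℝ

instance : Zero Profile := ⟨⟨0, 0⟩⟩

/-- The profile as a function of `(t, x, y, θ, Y)`. -/
def Profile.eval (U : Profile) (i : Fin 2) : (Fin 5 → ℝ) → ℝ :=
  fun p => U.low i ![p 0, p 1, p 2] + U.surf i ![p 0, p 1, p 3, p 4]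

/-- The space of profiles. -/
def InS (T : ℝ) (U : Profile) : Prop := ∀ i, InLow T (U.low i) ∧ InSurf T (U.surf i)

/-! ## Fourier series in `θ` -/

/-- The Fourier coefficient `φ^n` in `φ(θ) = ∑ φ^n e^{inθ}`. -/
def fc (n : ℤ) (φ : ℝ → ℂ) : ℂ :=
  (1 / (2 * Real.pi) : ℂ) *
    ∫ θ in (0 : ℝ)..(2 * Real.pi), φ θ * Complex.exp (-(Complex.I * n * θ))

/-- The Hilbert transform, the Fourier multiplier `-i sgn n`. -/
def hilbert (φ : ℝ → ℂ) (θ : ℝ) : ℂ :=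
  ∑' n : ℤ, -Complex.I * (n.sign : ℂ) * fc n φ * Complex.exp (Complex.I * n * θ)

/-- The terms of the sum over `n'` in the `n`-th coefficient of `𝓑(u, v)`. -/
def bilinTerm (b : ℝ → ℝ → ℝ → ℂ) (u v : ℝ → ℂ) (n n' : ℤ) : ℂ :=
  if n' = 0 then 0 else b (-n) (n - n') n' * fc (n - n') u * fc n' v

/-- The `n`-th Fourier coefficient of `𝓑(u, v)`. -/
def bilinCoeff (b : ℝ → ℝ → ℝ → ℂ) (c₀ : ℝ) (u v : ℝ → ℂ) (n : ℤ) : ℂ :=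
  -(1 / (4 * Real.pi * c₀) : ℂ) * ∑' n' : ℤ, bilinTerm b u v n n'

/-- The bilinear Fourier multiplier `𝓑(u, v)`. -/
def bilin (b : ℝ → ℝ → ℝ → ℂ) (c₀ : ℝ) (u v : ℝ → ℂ) (θ : ℝ) : ℂ :=
  ∑' n : ℤ, bilinCoeff b c₀ u v n * Complex.exp (Complex.I * n * θ)

/-- The function `θ ↦ α(t, x, θ)`. -/
def slice (α : (Fin 3 → ℝ) → ℝ) (t x : ℝ) : ℝ → ℂ := fun θ => (α ![t, x, θ] : ℂ)

/-- Amplitudes: elements of `H^∞([0,T] × ℝ × 𝕋)` with mean zero in `θ`. -/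
def IsAmplitude (T : ℝ) (α : (Fin 3 → ℝ) → ℝ) : Prop :=
  InBd T α ∧ ∀ t ∈ Icc 0 T, ∀ x, fc 0 (slice α t x) = 0

/-- The Fourier coefficient in `θ` of a function of `(t, x, y, θ, Y)`. -/
def mode (n : ℤ) (f : (Fin 5 → ℝ) → ℝ) (t x y Y : ℝ) : ℂ :=
  fc n (fun θ => (f ![t, x, y, θ, Y] : ℂ))

/-! ## The Saint Venant–Kirchhoff stress

Units are such that the shear speed is one, that is `μ = 1` and `λ = r - 2`.  With `φ = id + U` and
`A = ∇U` the strain is `E = (A + Aᵀ)/2 + AᵀA/2`, and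
`∇φ σ(∇φ) = (1 + A)(λ tr E + 2μE)` splits into a linear, a quadratic and a cubic part in `A`. -/

/-- `λ (tr M) + 2 μ M`. -/
def hooke (r : ℝ) (M : Matrix (Fin 2) (Fin 2) ℝ) : Matrix (Fin 2) (Fin 2) ℝ :=
  ((r - 2) * M.trace) • (1 : Matrix (Fin 2) (Fin 2) ℝ) + (2 : ℝ) • M

/-- Bilinear form of the quadratic part `Q` of the stress. -/
def stressQ (r : ℝ) (A B : Matrix (Fin 2) (Fin 2) ℝ) : Matrix (Fin 2) (Fin 2) ℝ :=
  hooke r ((1 / 2 : ℝ) • (Aᵀ * B)) + A * hooke r ((1 / 2 : ℝ) • (B + Bᵀ))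

/-- Trilinear form of the cubic part `C` of the stress. -/
def stressC (r : ℝ) (A B D : Matrix (Fin 2) (Fin 2) ℝ) : Matrix (Fin 2) (Fin 2) ℝ :=
  A * hooke r ((1 / 2 : ℝ) • (Bᵀ * D))

/-! ## The cascade of profile equations -/

/-- The pair of slow variables `(x, y)` for `s = 0`, of fast variables `(θ, Y)` for `s = 1`. -/
def spatial (s j : Fin 2) : Fin 5 := ![![1, 2], ![3, 4]] s j

/-- The gradient `∂_{x,y} U` for `s = 0`, `∂_{θ,Y} U` for `s = 1`. -/
def grad (T : ℝ) (s : Fin 2) (U : Profile) (p : Fin 5 → ℝ) : Matrix (Fin 2) (Fin 2) ℝ :=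
  Matrix.of fun i j => pd (domAll T) (spatial s j) (U.eval i) p

/-- The second derivative `∂_i ∂_j` of the component `a` of a profile. -/
def pd2 (T : ℝ) (i j : Fin 5) (U : Profile) (a : Fin 2) (p : Fin 5 → ℝ) : ℝ :=
  pd (domAll T) i (pd (domAll T) j (U.eval a)) p

/-- The operator `L_{fs}`. -/
def opLfs (T r c : ℝ) (U : Profile) (i : Fin 2) (p : Fin 5 → ℝ) : ℝ :=
  -2 * c * pd2 T 0 3 U i p - ![2 * r, 2] i * pd2 T 1 3 U i p
    - (r - 1) * (pd2 T 1 4 U (1 - i) p + pd2 T 2 3 U (1 - i) p)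
    - ![2, 2 * r] i * pd2 T 2 4 U i p

/-- The operator `L_{ss}`. -/
def opLss (T r : ℝ) (U : Profile) (i : Fin 2) (p : Fin 5 → ℝ) : ℝ :=
  pd2 T 0 0 U i p - ![r, 1] i * pd2 T 1 1 U i p
    - (r - 1) * pd2 T 1 2 U (1 - i) p - ![1, r] i * pd2 T 2 2 U i p

/-- The operator `l_s`. -/
def opls (T r : ℝ) (U : Profile) (i : Fin 2) (p : Fin 5 → ℝ) : ℝ :=
  ![1, r - 2] i * pd (domAll T) 1 (U.eval (1 - i)) p
    + ![1, r] i * pd (domAll T) 2 (U.eval i) p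

/-- The interior source `(H_m, K_m)`, for `m ≥ 1`.  The quadratic terms are all
`∂^{s₂} · Q(∂^{s₀}; ∂^{s₁})(U_i, U_j)` with `i + j = m - 1 +` (number of fast derivatives), and the
cubic terms all `∂^{s₃} · C(∂^{s₀}; ∂^{s₁}; ∂^{s₂})(U_i, U_j, U_k)` with
`i + j + k = m - 1 +` (number of fast derivatives). -/
def srcInt (T r c : ℝ) (U : ℕ → Profile) (m : ℕ) (i : Fin 2) (p : Fin 5 → ℝ) : ℝ :=
  -opLfs T r c (U m) i p - opLss T r (U (m - 1)) i p
  + ∑ s : Fin 3 → Fin 2, ∑ e ∈ Finset.HasAntidiagonal.antidiagonal (m - 1 + ∑ a, (s a : ℕ)), ∑ j : Fin 2,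
      pd (domAll T) (spatial (s 2) j)
        (fun p' => stressQ r (grad T (s 0) (U e.1) p') (grad T (s 1) (U e.2) p') i j) p
  + ∑ s : Fin 4 → Fin 2, ∑ e ∈ Finset.Nat.antidiagonalTuple 3 (m - 1 + ∑ a, (s a : ℕ)),
      ∑ j : Fin 2, pd (domAll T) (spatial (s 3) j)
        (fun p' => stressC r (grad T (s 0) (U (e 0)) p') (grad T (s 1) (U (e 1)) p')
          (grad T (s 2) (U (e 2)) p') i j) p

/-- The boundary source `(h_m, k_m)`, as a function of all variables whose values at `y = Y = 0`
matter; `F = (f, g)` is the boundary forcing, which enters for `m = 2`. -/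
def srcBd (T r : ℝ) (F : Fin 2 → (Fin 3 → ℝ) → ℝ) (U : ℕ → Profile) (m : ℕ) (i : Fin 2)
    (p : Fin 5 → ℝ) : ℝ :=
  -opls T r (U m) i p
  - ∑ s : Fin 2 → Fin 2, ∑ e ∈ Finset.HasAntidiagonal.antidiagonal (m + ∑ a, (s a : ℕ)),
      stressQ r (grad T (s 0) (U e.1) p) (grad T (s 1) (U e.2) p) i 1
  - ∑ s : Fin 3 → Fin 2, ∑ e ∈ Finset.Nat.antidiagonalTuple 3 (m + ∑ a, (s a : ℕ)),
      stressC r (grad T (s 0) (U (e 0)) p) (grad T (s 1) (U (e 1)) p)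
        (grad T (s 2) (U (e 2)) p) i 1
  + if m = 2 then F i ![p 0, p 1, p 3] else 0

/-- Removes from the zeroth Fourier mode its limit as `Y → ∞`; the other modes are kept. -/
def decaying (n : ℤ) (φ : ℝ → ℂ) (Y : ℝ) : ℂ :=
  if n = 0 then φ Y - Filter.limUnder Filter.atTop φ else φ Y

/-- The `n`-th Fourier mode of the surface part of the modified interior source `(H'_m, K'_m)`:
the surface part of `(H_m, K_m)` together with the Taylor coefficients at `y = 0`, in powers of
`y = εY`, of the mixed (surface times non-decaying) parts of `(H_p, K_p)`; these mixed parts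
are absent for `p ≤ 4`.  At `y = 0` the surface part and the mixed part of `(H_m, K_m)` add up
to `(H_m, K_m)` minus its limit as `Y → ∞`. -/
def srcMod (T r c : ℝ) (U : ℕ → Profile) (m : ℕ) (n : ℤ) (i : Fin 2) (t x Y : ℝ) : ℂ :=
  ∑ j ∈ Finset.range (m + 1),
    if j = 0 ∨ j + 5 ≤ m then
      ((Y : ℂ) ^ j / (j.factorial : ℂ)) *
        decaying n (fun z => mode n ((pd (domAll T) 2)^[j] (srcInt T r c U (m - j) i)) t x 0 z) Y
    else 0

/-! ## Solution of the linear problems -/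

/-- The characteristic roots `ω₁, ω₂, ω₃, ω₄`. -/
def om (r c : ℝ) : Fin 4 → ℂ :=
  ![Complex.I * √(1 - c ^ 2), Complex.I * √(1 - c ^ 2 / r),
    -(Complex.I * √(1 - c ^ 2)), -(Complex.I * √(1 - c ^ 2 / r))]

/-- `q > 0` with `q² = -ω₁ω₂`. -/
def qR (r c : ℝ) : ℝ := √(√(1 - c ^ 2) * √(1 - c ^ 2 / r))

/-- The eigenvectors `R_j(n)`, `j = 1, …, 4`; their first two entries form `r_j`. -/
def Rvec (r c : ℝ) (n : ℤ) (j : Fin 4) : Fin 4 → ℂ :=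
  let w := om r c j
  if j = 0 ∨ j = 2 then ![-w, 1, -(Complex.I * n * w ^ 2), Complex.I * n * w]
  else ![1, w, Complex.I * n * w, Complex.I * n * w ^ 2]

/-- The vectors `r_j`. -/
def rvec (r c : ℝ) (j : Fin 4) : Fin 2 → ℂ :=
  let w := om r c j
  if j = 0 ∨ j = 2 then ![-w, 1] else ![1, w]

/-- The component `F_j^n = L_j(n) F̃^n` of a source `(f₁, f₂)`, where `F̃ = (0, 0, -f₁, -f₂/r)` and
`L_j(n)` are the left eigenvectors dual to `R_j(n)`. -/
def srcComp (r c : ℝ) (n : ℤ) (j : Fin 4) (f : Fin 2 → ℂ) : ℂ :=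
  let w := om r c j
  if j = 0 ∨ j = 2 then (w * f 0 - f 1) / (2 * Complex.I * w * c ^ 2 * n)
  else -(f 0 + w * f 1) / (2 * Complex.I * w * c ^ 2 * n)

/-- The coefficients `τ_j^n` of the decaying particular solution of
`L_{ff}(U_{k,p}) = (H'_{k-1}, K'_{k-1})^{osc}`, for `n ≠ 0`. -/
def tau (T r c : ℝ) (U : ℕ → Profile) (k : ℕ) (n : ℤ) (j : Fin 4) (t x Y : ℝ) : ℂ :=
  let g : ℝ → ℂ := fun s => Complex.exp (Complex.I * n * om r c j * (Y - s)) *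
    srcComp r c n j (fun i => srcMod T r c U (k - 1) n i t x s)
  if (0 < n ∧ j < 2) ∨ (n < 0 ∧ 2 ≤ j) then ∫ s in (0 : ℝ)..Y, g s else -∫ s in Ioi Y, g s

/-- The vector `Ũ_{k,p}^n = (U_{k,p}^n, ∂_Y U_{k,p}^n)`. -/
def UpTilde (T r c : ℝ) (U : ℕ → Profile) (k : ℕ) (n : ℤ) (t x Y : ℝ) : Fin 4 → ℂ :=
  ∑ j, tau T r c U k n j t x Y • Rvec r c n j

/-- The Fourier mode `U_{k,p}^n`. -/
def Up (T r c : ℝ) (U : ℕ → Profile) (k : ℕ) (n : ℤ) (t x Y : ℝ) : Fin 2 → ℂ :=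
  ∑ j, tau T r c U k n j t x Y • rvec r c j

/-- The zeroth mode `U_k^{0*}`, the decaying solution of
`L_{ff}(U_k^{0*}) = (H'_{k-1}, K'_{k-1})^{0*}`. -/
def Uzero (T r c : ℝ) (U : ℕ → Profile) (k : ℕ) (t x Y : ℝ) (i : Fin 2) : ℂ :=
  -(![1, (1 / r : ℂ)] i) * ∫ s in Ioi Y, ∫ z in Ioi s, srcMod T r c U (k - 1) 0 i t x z

/-- The matrix `C(β, n)` of the boundary operator: `l_f(U)^n = C(β, n) (U^n, ∂_Y U^n)`. -/
def bdMat (r : ℝ) (n : ℤ) : Matrix (Fin 2) (Fin 4) ℂ :=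
  !![0, Complex.I * n, 1, 0; (r - 2) * (Complex.I * n), 0, 0, (r : ℂ)]

/-- The Lopatinski matrix. -/
def lop (r c : ℝ) : Matrix (Fin 2) (Fin 2) ℂ :=
  !![2 - (c : ℂ) ^ 2, 2 * om r c 1; 2 * om r c 0, (c : ℂ) ^ 2 - 2]

/-- The inverse of the Lopatinski matrix as a map from the orthogonal complement of its kernel,
which is spanned by `(ω₂, -q)`, onto its range (extended by `0` off the range). -/
def lopInv (r c : ℝ) (w : Fin 2 → ℂ) : Fin 2 → ℂ :=
  open Classical in
  if h : ∃ σ : Fin 2 → ℂ, σ ⬝ᵥ star ![om r c 1, -(qR r c : ℂ)] = 0 ∧ lop r c *ᵥ σ = w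
  then h.choose else 0

/-- The right side `(h_{k-1}, k_{k-1})^n - l_f(U_{k,p})^n` of the boundary equation for
`U_{k,h}^n`. -/
def bdRhs (T r c : ℝ) (F : Fin 2 → (Fin 3 → ℝ) → ℝ) (U : ℕ → Profile) (k : ℕ) (n : ℤ)
    (t x : ℝ) : Fin 2 → ℂ :=
  (fun i => mode n (srcBd T r F U (k - 1) i) t x 0 0) - bdMat r n *ᵥ UpTilde T r c U k n t x 0

/-- The Fourier mode `U_{k,h}^n` for `n > 0`. -/
def UhPos (T r c : ℝ) (F : Fin 2 → (Fin 3 → ℝ) → ℝ) (U : ℕ → Profile) (k : ℕ) (n : ℤ)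
    (t x Y : ℝ) : Fin 2 → ℂ :=
  let σ := (1 / (Complex.I * n)) • lopInv r c (bdRhs T r c F U k n t x)
  (σ 0 * Complex.exp (Complex.I * n * om r c 0 * Y)) • rvec r c 0
    + (σ 1 * Complex.exp (Complex.I * n * om r c 1 * Y)) • rvec r c 1

/-- The Fourier mode `U_{k,h}^n`, for `n ≠ 0`. -/
def Uh (T r c : ℝ) (F : Fin 2 → (Fin 3 → ℝ) → ℝ) (U : ℕ → Profile) (k : ℕ) (n : ℤ)
    (t x Y : ℝ) : Fin 2 → ℂ :=
  if 0 < n then UhPos T r c F U k n t x Y else star (UhPos T r c F U k (-n) t x Y)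

/-- The Rayleigh mode `r̂(n, Y)` for `n > 0`. -/
def rhatPos (r c : ℝ) (n : ℤ) (Y : ℝ) : Fin 2 → ℂ :=
  (om r c 1 * Complex.exp (Complex.I * n * om r c 0 * Y)) • rvec r c 0
    - ((qR r c : ℂ) * Complex.exp (Complex.I * n * om r c 1 * Y)) • rvec r c 1

/-- The Rayleigh mode `r̂(n, Y)`, for `n ≠ 0`. -/
def rhat (r c : ℝ) (n : ℤ) (Y : ℝ) : Fin 2 → ℂ :=
  if 0 < n then rhatPos r c n Y else star (rhatPos r c (-n) Y)

/-- `U_k = U̲_k + U_k^{0*} + U_{k,p} + U_{k,h} + U_{k,α}` where `U_k^{0*}`, `U_{k,p}`, `U_{k,h}` are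
determined by the previous profiles as above, and `U_{k,α}^n = α(t,x,n) r̂(n,Y)`. -/
def HasAmplitude (T r c : ℝ) (F : Fin 2 → (Fin 3 → ℝ) → ℝ) (U : ℕ → Profile) (k : ℕ)
    (α : (Fin 3 → ℝ) → ℝ) : Prop :=
  ∀ t ∈ Icc 0 T, ∀ x : ℝ, ∀ Y ∈ Ici (0 : ℝ), ∀ i : Fin 2,
    fc 0 (fun θ => ((U k).surf i ![t, x, θ, Y] : ℂ)) = Uzero T r c U k t x Y i ∧
    ∀ n : ℤ, n ≠ 0 → fc n (fun θ => ((U k).surf i ![t, x, θ, Y] : ℂ)) =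
      Up T r c U k n t x Y i + Uh T r c F U k n t x Y i
        + fc n (slice α t x) * rhat r c n Y i

/-- The row vector spanning the cokernel of the Lopatinski matrix: `(q, ω₂)` for `n > 0`, and its
complex conjugate for `n < 0`. -/
def coker (r c : ℝ) (n : ℤ) : Fin 2 → ℂ :=
  if 0 < n then ![(qR r c : ℂ), om r c 1] else ![(qR r c : ℂ), conj (om r c 1)]

/-- The solvability condition for the boundary equation of `U_{k+1,h}`:
`(q  ω₂) ((h_k, k_k)^n - C(β,n) Ũ_{k+1,p}^n) = 0` for all `n ≠ 0`. -/
def Solvable (T r c : ℝ) (F : Fin 2 → (Fin 3 → ℝ) → ℝ) (U : ℕ → Profile) (k : ℕ) : Prop :=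
  ∀ t ∈ Icc 0 T, ∀ x : ℝ, ∀ n : ℤ, n ≠ 0 → coker r c n ⬝ᵥ bdRhs T r c F U (k + 1) n t x = 0

end RayleighWave

end

open RayleighWave

noncomputable section

namespace RayleighWave

/-! ## Partial derivatives on boxes -/

section Box

variable {d : ℕ} {D : Fin d → Set ℝ}

/-! The solvability condition is a Fredholm alternative. At each frequency n ≠ 0 the fast boundary
value problem is formally self-adjoint, and because c is a Rayleigh speed, r̂ solves the homogeneous
problem. So an interior source H and a boundary source h should be admissible exactly when
r̂(-n,0)·h - ∫ r̂(-n,s)·H(s) ds vanishes; this is `pairing`. `IsRayleigh.coker_bdRhs` confirms it by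
computation: ℓ_n is -1/(1-q) times r̂(-n,0), and at Y = 0 the particular solution contributes only
two half-line integrals, whose integrands add up to r̂(-n,s)·H.

It remains to count orders. Since U_0 = U_1 = 0, the sources of level k contain U_k only through
L_fs, l_s and the quadratic interaction with U_2 in which every derivative is fast. At level 2 these
terms are the whole source, apart from the forcing: the quadratic interaction of U_2 with itself
appears once, so the symmetrised interaction `crossQ` carries the factor 1/2. At level k ≥ 3 they
are the difference of the sources of two sequences with the same lower levels, and `crossQ` carries
the factor 1. This is the origin of the coefficient 2 in the higher equations. All pieces of U_k
except the non-decaying part and U_{k,α} are determined by the lower levels. Hence U_2, and the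
difference of two candidates for U_k, have oscillating modes α^n r̂(n,Y) and a mean that does not
depend on Y (`RayleighModes`).

The pairing of such leading terms is `RayleighModes.pairing_lin`. Its linear part is -2ic sgn(n) M
(∂_t + c∂_x)α^n, where M = `massR` is the squared L² norm of r̂(1,·). That the transport speed is c
expresses that Rayleigh waves are not dispersive; here it is the algebraic identity
`IsRayleigh.group_velocity`. In the quadratic part an integration by parts cancels the boundary
terms (`IsRayleigh.pairing_divergence`). What remains is the sum over n' of b(-n,n-n',n') times
Fourier coefficients, b being the integral over Y of the polarised cubic stored energy of three
Rayleigh gradients. Thus b is symmetric because the stress derives from an energy, and it is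
homogeneous of degree 3 - 1 = 2, three gradients counting 3 and dY counting -1. Division by -2ic
sgn(n) M, with c_0 = cM/π, produces the operator 𝓗𝓑.

The product of the three exponential decays gives |b(n₁,n₂,n₃)| ≤ K|n₂||n₃|, so all series converge
absolutely on smooth functions, and the amplitude equation is equivalent to the equality of its
Fourier coefficients (`IsRayleigh.amplitude_equation_iff`).

For G_2 one pairs (f,g) with the Rayleigh mode and divides by the symbol. For k ≥ 3 one chooses some
reference profile of level k over the given lower levels and reads G_k off its residual. By
`residual_sub` the same G_k serves every other profile of level k, and a reference exists whenever
there is anything to prove, since U_k is one itself. -/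

theorem update_mem_box {p : Fin d → ℝ} (hp : p ∈ univ.pi D) {i : Fin d} {s : ℝ} (hs : s ∈ D i) :
    Function.update p i s ∈ univ.pi D := by
  intro j _
  by_cases h : j = i
  · subst h; simpa using hs
  · simpa [h] using hp j (mem_univ j)

theorem pd_congr {f g : (Fin d → ℝ) → ℝ} (h : EqOn f g (univ.pi D)) (i : Fin d) :
    EqOn (pd D i f) (pd D i g) (univ.pi D) := by
  intro p hp
  refine derivWithin_congr (fun s hs => h (update_mem_box hp hs)) ?_
  simpa using h hp

theorem iterPd_congr {f g : (Fin d → ℝ) → ℝ} (h : EqOn f g (univ.pi D)) (l : List (Fin d)) :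
    EqOn (iterPd D l f) (iterPd D l g) (univ.pi D) := by
  induction l with
  | nil => exact h
  | cons i l ih => exact pd_congr ih i

theorem iterPd_append (l l' : List (Fin d)) (f : (Fin d → ℝ) → ℝ) :
    iterPd D (l ++ l') f = iterPd D l (iterPd D l' f) := by
  simp [iterPd, List.foldr_append]

theorem hasDerivWithinAt_update {f : (Fin d → ℝ) → ℝ} (hf : ContDiffOn ℝ ∞ f (univ.pi D))
    {p : Fin d → ℝ} (hp : p ∈ univ.pi D) (i : Fin d) :
    HasDerivWithinAt (fun s => f (Function.update p i s)) (pd D i f p) (D i) (p i) := by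
  have h1 : DifferentiableWithinAt ℝ f (univ.pi D) p :=
    (hf p hp).differentiableWithinAt (by simp)
  have h2 : HasDerivWithinAt (Function.update p i) (Pi.single i (1 : ℝ)) (D i) (p i) :=
    (hasDerivAt_update p i (p i)).hasDerivWithinAt
  have h3 : DifferentiableWithinAt ℝ (fun s => f (Function.update p i s)) (D i) (p i) := by
    have h1' : DifferentiableWithinAt ℝ f (univ.pi D) (Function.update p i (p i)) := by simpa
    exact h1'.comp (p i) h2.differentiableWithinAt (fun s hs => update_mem_box hp hs)
  exact h3.hasDerivWithinAt

/-- The link to the Fréchet derivative, through which smoothness up to the boundary of the box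
passes to partial derivatives. -/
theorem pd_eq_fderivWithin (hD : ∀ i, UniqueDiffOn ℝ (D i))
    {f : (Fin d → ℝ) → ℝ} (hf : ContDiffOn ℝ ∞ f (univ.pi D))
    {p : Fin d → ℝ} (hp : p ∈ univ.pi D) (i : Fin d) :
    pd D i f p = fderivWithin ℝ f (univ.pi D) p (Pi.single i 1) := by
  have h1 : HasFDerivWithinAt f (fderivWithin ℝ f (univ.pi D) p) (univ.pi D) p :=
    ((hf p hp).differentiableWithinAt (by simp)).hasFDerivWithinAt
  have h2 : HasDerivWithinAt (Function.update p i) (Pi.single i (1 : ℝ)) (D i) (p i) :=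
    (hasDerivAt_update p i (p i)).hasDerivWithinAt
  have h1' : HasFDerivWithinAt f (fderivWithin ℝ f (univ.pi D) p) (univ.pi D)
      (Function.update p i (p i)) := by simpa
  have h3 := h1'.comp_hasDerivWithinAt (p i) h2 (fun s hs => update_mem_box hp hs)
  exact h3.derivWithin (hD i (p i) (hp i (mem_univ i)))

theorem contDiffOn_pd (hD : ∀ i, UniqueDiffOn ℝ (D i))
    {f : (Fin d → ℝ) → ℝ} (hf : ContDiffOn ℝ ∞ f (univ.pi D)) (i : Fin d) :
    ContDiffOn ℝ ∞ (pd D i f) (univ.pi D) := by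
  have hU : UniqueDiffOn ℝ (univ.pi D) := UniqueDiffOn.univ_pi hD
  have h := (hf.fderivWithin hU (m := ∞) (by simp)).clm_apply
    (contDiffOn_const (c := (Pi.single i (1 : ℝ) : Fin d → ℝ)))
  exact h.congr fun p hp => pd_eq_fderivWithin hD hf hp i

theorem contDiffOn_iterPd (hD : ∀ i, UniqueDiffOn ℝ (D i))
    {f : (Fin d → ℝ) → ℝ} (hf : ContDiffOn ℝ ∞ f (univ.pi D))
    (l : List (Fin d)) : ContDiffOn ℝ ∞ (iterPd D l f) (univ.pi D) := by
  induction l with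
  | nil => exact hf
  | cons i l ih => exact contDiffOn_pd hD ih i

theorem pd_add (hD : ∀ i, UniqueDiffOn ℝ (D i))
    {f g : (Fin d → ℝ) → ℝ} (hf : ContDiffOn ℝ ∞ f (univ.pi D))
    (hg : ContDiffOn ℝ ∞ g (univ.pi D)) (i : Fin d) :
    EqOn (pd D i (fun p => f p + g p)) (fun p => pd D i f p + pd D i g p) (univ.pi D) := by
  intro p hp
  exact ((hasDerivWithinAt_update hf hp i).add
    (hasDerivWithinAt_update hg hp i)).derivWithin (hD i (p i) (hp i (mem_univ i)))

theorem pd_sub (hD : ∀ i, UniqueDiffOn ℝ (D i))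
    {f g : (Fin d → ℝ) → ℝ} (hf : ContDiffOn ℝ ∞ f (univ.pi D))
    (hg : ContDiffOn ℝ ∞ g (univ.pi D)) (i : Fin d) :
    EqOn (pd D i (fun p => f p - g p)) (fun p => pd D i f p - pd D i g p) (univ.pi D) := by
  intro p hp
  exact ((hasDerivWithinAt_update hf hp i).sub
    (hasDerivWithinAt_update hg hp i)).derivWithin (hD i (p i) (hp i (mem_univ i)))

theorem pd_const_mul (hD : ∀ i, UniqueDiffOn ℝ (D i))
    {f : (Fin d → ℝ) → ℝ} (hf : ContDiffOn ℝ ∞ f (univ.pi D)) (a : ℝ)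
    (i : Fin d) :
    EqOn (pd D i (fun p => a * f p)) (fun p => a * pd D i f p) (univ.pi D) := by
  intro p hp
  exact ((hasDerivWithinAt_update hf hp i).const_mul a).derivWithin
    (hD i (p i) (hp i (mem_univ i)))

theorem pd_mul (hD : ∀ i, UniqueDiffOn ℝ (D i))
    {f g : (Fin d → ℝ) → ℝ} (hf : ContDiffOn ℝ ∞ f (univ.pi D))
    (hg : ContDiffOn ℝ ∞ g (univ.pi D)) (i : Fin d) :
    EqOn (pd D i (fun p => f p * g p)) (fun p => pd D i f p * g p + f p * pd D i g p)
      (univ.pi D) := by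
  intro p hp
  have h := ((hasDerivWithinAt_update hf hp i).mul
    (hasDerivWithinAt_update hg hp i)).derivWithin (hD i (p i) (hp i (mem_univ i)))
  simp only [Function.update_eq_self] at h
  exact h

theorem pd_const (a : ℝ) (i : Fin d) (p : Fin d → ℝ) : pd D i (fun _ => a) p = 0 := by
  simp [pd]

/-- Functions independent of the variable `i` have zero derivative in it. -/
theorem pd_eq_zero_of_update {f : (Fin d → ℝ) → ℝ} {i : Fin d} {p : Fin d → ℝ}
    (h : ∀ s, f (Function.update p i s) = f p) : pd D i f p = 0 := by
  simp [pd, h]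

end Box

/-! ### Differentiation under the integral sign -/

section Parametric

/-- Differentiation under the integral sign over a compact interval, one-sided at the ends. -/
theorem hasDerivWithinAt_intervalIntegral_of_continuousOn {I : Set ℝ} (hI : Convex ℝ I)
    {a b s₀ : ℝ} (hab : a ≤ b) (hs₀ : s₀ ∈ I) (hIc : IsClosed I) {g g' : ℝ → ℝ → ℂ}
    (hg : ∀ s ∈ I, ContinuousOn (g s) (Icc a b))
    (hg' : ContinuousOn (fun z : ℝ × ℝ => g' z.1 z.2) (I ×ˢ Icc a b))
    (hd : ∀ s ∈ I, ∀ θ ∈ Icc a b, HasDerivWithinAt (fun s => g s θ) (g' s θ) I s) :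
    HasDerivWithinAt (fun s => ∫ θ in a..b, g s θ) (∫ θ in a..b, g' s₀ θ) I s₀ := by
  rw [hasDerivWithinAt_iff_tendsto_slope]
  -- Near s₀ the derivative is bounded on a compact set; the mean value inequality on the convex set
  -- `I ∩ closedBall s₀ 1` then dominates the difference quotients by the constant C.
  have hK : IsCompact ((I ∩ Metric.closedBall s₀ 1) ×ˢ Icc a b) :=
    ((isCompact_closedBall s₀ 1).inter_left hIc).prod isCompact_Icc
  obtain ⟨C, hC⟩ := hK.exists_bound_of_continuousOn
    (hg'.mono (prod_mono inter_subset_left subset_rfl))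
  have hconv : Convex ℝ (I ∩ Metric.closedBall s₀ 1) := hI.inter (convex_closedBall s₀ 1)
  have key : Filter.Tendsto (fun s => ∫ θ in a..b, (s - s₀)⁻¹ • (g s θ - g s₀ θ))
      (nhdsWithin s₀ (I \ {s₀})) (nhds (∫ θ in a..b, g' s₀ θ)) := by
    refine intervalIntegral.tendsto_integral_filter_of_dominated_convergence (fun _ => C) ?_ ?_
      (by simp) ?_
    · filter_upwards [self_mem_nhdsWithin] with s hs
      have h1 : ContinuousOn (fun θ => (s - s₀)⁻¹ • (g s θ - g s₀ θ)) (Icc a b) :=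
        ContinuousOn.const_smul ((hg s hs.1).sub (hg s₀ hs₀)) (s - s₀)⁻¹
      rw [uIoc_of_le hab]
      exact (h1.mono Ioc_subset_Icc_self).aestronglyMeasurable measurableSet_Ioc
    · have hball : Metric.closedBall s₀ 1 ∈ nhdsWithin s₀ (I \ {s₀}) :=
        mem_nhdsWithin_of_mem_nhds (Metric.closedBall_mem_nhds s₀ one_pos)
      filter_upwards [self_mem_nhdsWithin, hball] with s hs hsb
      refine Filter.Eventually.of_forall fun θ hθ => ?_
      rw [uIoc_of_le hab] at hθ
      have hθ' := Ioc_subset_Icc_self hθ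
      have h2 := hconv.norm_image_sub_le_of_norm_hasDerivWithin_le (C := C)
        (f := fun s => g s θ) (f' := fun s => g' s θ) (x := s₀) (y := s)
        (fun s' hs' => (hd s' hs'.1 θ hθ').mono inter_subset_left)
        (fun s' hs' => hC (s', θ) ⟨hs', hθ'⟩) ⟨hs₀, Metric.mem_closedBall_self zero_le_one⟩
        ⟨hs.1, hsb⟩
      have hne : s - s₀ ≠ 0 := sub_ne_zero.mpr hs.2
      rw [norm_smul, norm_inv]
      rw [inv_mul_le_iff₀ (norm_pos_iff.mpr hne), mul_comm]
      exact h2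
    · refine Filter.Eventually.of_forall fun θ hθ => ?_
      rw [uIoc_of_le hab] at hθ
      have h3 := hd s₀ hs₀ θ (Ioc_subset_Icc_self hθ)
      rw [hasDerivWithinAt_iff_tendsto_slope] at h3
      exact h3
  refine key.congr' ?_
  filter_upwards [self_mem_nhdsWithin] with s hs
  rw [slope_def_module, intervalIntegral.integral_smul, intervalIntegral.integral_sub]
  · exact (hg s hs.1).intervalIntegrable_of_Icc hab
  · exact (hg s₀ hs₀).intervalIntegrable_of_Icc hab

end Parametric

/-! ## Pointwise bounds from `L²` bounds in one variable -/

/-- An interval of length one is a probability space, so the L¹ norm on it is at most the L² norm.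
-/
theorem setIntegral_abs_le_of_eLpNorm_le {h : ℝ → ℝ} (hc : Continuous h) {A : ℝ} (hA : 0 ≤ A)
    (h2 : eLpNorm h 2 volume ≤ ENNReal.ofReal A) (x : ℝ) :
    ∫ z in Icc x (x + 1), |h z| ≤ A := by
  have hint : IntegrableOn h (Icc x (x + 1)) := hc.continuousOn.integrableOn_compact isCompact_Icc
  have hm : AEStronglyMeasurable h (volume.restrict (Icc x (x + 1))) :=
    hc.aestronglyMeasurable
  have hprob : IsProbabilityMeasure (volume.restrict (Icc x (x + 1))) := ⟨by simp⟩
  have h1 : eLpNorm h 1 (volume.restrict (Icc x (x + 1))) ≤ ENNReal.ofReal A :=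
    calc _ ≤ eLpNorm h 2 (volume.restrict (Icc x (x + 1))) :=
          eLpNorm_le_eLpNorm_of_exponent_le (by norm_num) hm
      _ ≤ eLpNorm h 2 volume := eLpNorm_mono_measure _ Measure.restrict_le_self
      _ ≤ _ := h2
  have h3 : ∫ z in Icc x (x + 1), |h z| = (eLpNorm h 1 (volume.restrict (Icc x (x + 1)))).toReal := by
    rw [eLpNorm_one_eq_lintegral_enorm]
    exact integral_norm_eq_lintegral_enorm hm
  rw [h3]
  exact ENNReal.toReal_le_of_le_ofReal hA h1

/-- A one-dimensional Sobolev inequality. -/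
theorem abs_le_of_eLpNorm_le {h h' : ℝ → ℝ} (hd : ∀ x, HasDerivAt h (h' x) x)
    (hc : Continuous h') {A B : ℝ} (hA : 0 ≤ A) (hB : 0 ≤ B)
    (h0 : eLpNorm h 2 volume ≤ ENNReal.ofReal A)
    (h1 : eLpNorm h' 2 volume ≤ ENNReal.ofReal B) (x : ℝ) : |h x| ≤ A + B := by
  have hcont : Continuous h := continuous_iff_continuousAt.mpr fun x => (hd x).continuousAt
  have hIh := setIntegral_abs_le_of_eLpNorm_le hcont hA h0 x
  have hIh' := setIntegral_abs_le_of_eLpNorm_le hc hB h1 x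
  -- On the unit interval h varies from its value at x by at most the integral of |h'|, hence by at
  -- most B. Integrating over the interval compares |h x| - B with the L¹ norm of h.
  have hpt : ∀ z ∈ Icc x (x + 1), |h x| - B ≤ |h z| := by
    intro z hz
    have hftc : ∫ y in x..z, h' y = h z - h x :=
      intervalIntegral.integral_eq_sub_of_hasDerivAt (fun y _ => hd y) (hc.intervalIntegrable _ _)
    have hle : |∫ y in x..z, h' y| ≤ B := by
      refine (intervalIntegral.abs_integral_le_integral_abs hz.1).trans ?_
      rw [intervalIntegral.integral_of_le hz.1]
      refine le_trans ?_ hIh'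
      refine setIntegral_mono_set (hc.abs.continuousOn.integrableOn_compact isCompact_Icc)
        (Filter.Eventually.of_forall fun _ => abs_nonneg _) ?_
      exact (Ioc_subset_Icc_self.trans (Icc_subset_Icc_right hz.2)).eventuallyLE
    rw [hftc] at hle
    have := abs_sub_abs_le_abs_sub (h x) (h z)
    rw [abs_sub_comm] at this
    linarith
  have hfin : ∫ _ in Icc x (x + 1), (|h x| - B) ≤ ∫ z in Icc x (x + 1), |h z| :=
    setIntegral_mono_on (by simp) (hcont.abs.continuousOn.integrableOn_compact isCompact_Icc)
      measurableSet_Icc hpt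
  simp at hfin
  linarith

/-! ## Fourier coefficients -/

/-- The exponential `e^{inθ}`. -/
def ex (n : ℤ) (θ : ℝ) : ℂ := Complex.exp (Complex.I * n * θ)

theorem continuous_ex (n : ℤ) : Continuous (ex n) := by unfold ex; fun_prop

theorem norm_ex (n : ℤ) (θ : ℝ) : ‖ex n θ‖ = 1 := by
  have : Complex.I * n * θ = ((n * θ : ℝ) : ℂ) * Complex.I := by push_cast; ring
  rw [ex, this, Complex.norm_exp_ofReal_mul_I]

theorem ex_add (m n : ℤ) (θ : ℝ) : ex (m + n) θ = ex m θ * ex n θ := by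
  simp only [ex, ← Complex.exp_add]; congr 1; push_cast; ring

theorem ex_neg (n : ℤ) (θ : ℝ) : ex (-n) θ = Complex.exp (-(Complex.I * n * θ)) := by
  simp only [ex]; congr 1; push_cast; ring

theorem conj_ex (n : ℤ) (θ : ℝ) : conj (ex n θ) = ex (-n) θ := by
  simp only [ex, ← Complex.exp_conj]; congr 1; simp

theorem ex_periodic (n : ℤ) (θ : ℝ) : ex n (θ + 2 * Real.pi) = ex n θ := by
  simp only [ex]
  rw [Complex.exp_eq_exp_iff_exists_int]
  exact ⟨n, by push_cast; ring⟩

theorem hasDerivAt_ex (n : ℤ) (θ : ℝ) : HasDerivAt (ex n) (Complex.I * n * ex n θ) θ := by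
  have h : HasDerivAt (fun θ : ℝ => Complex.I * n * (θ : ℂ)) (Complex.I * n * 1) θ :=
    (Complex.ofRealCLM.hasDerivAt).const_mul _
  have := h.cexp
  unfold ex
  convert this using 1
  ring

theorem fc_eq (n : ℤ) (φ : ℝ → ℂ) :
    fc n φ = (1 / (2 * Real.pi) : ℂ) * ∫ θ in (0 : ℝ)..(2 * Real.pi), φ θ * ex (-n) θ := by
  simp only [fc, ex_neg]

theorem fc_congr {φ ψ : ℝ → ℂ} (n : ℤ) (h : ∀ θ, φ θ = ψ θ) : fc n φ = fc n ψ := by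
  rw [funext h]

theorem norm_fc_le {φ : ℝ → ℂ} {C : ℝ} (h : ∀ θ, ‖φ θ‖ ≤ C) (n : ℤ) : ‖fc n φ‖ ≤ C := by
  rw [fc_eq, norm_mul]
  have h1 : ‖∫ θ in (0 : ℝ)..(2 * Real.pi), φ θ * ex (-n) θ‖ ≤ C * |2 * Real.pi - 0| :=
    intervalIntegral.norm_integral_le_of_norm_le_const fun θ _ => by
      rw [norm_mul, norm_ex, mul_one]; exact h θ
  have hpi := Real.pi_pos
  rw [sub_zero, abs_of_pos (by positivity)] at h1
  have h2 : ‖(1 / (2 * Real.pi) : ℂ)‖ = 1 / (2 * Real.pi) := by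
    rw [norm_div, norm_one, norm_mul]
    simp [abs_of_pos hpi]
  rw [h2, one_div, inv_mul_le_iff₀ (by positivity)]
  linarith

theorem intervalIntegrable_mul_ex {φ : ℝ → ℂ} (h : Continuous φ) (n : ℤ) (a b : ℝ) :
    IntervalIntegrable (fun θ => φ θ * ex n θ) volume a b :=
  (h.mul (continuous_ex n)).intervalIntegrable a b

theorem fc_add {φ ψ : ℝ → ℂ} (hφ : Continuous φ) (hψ : Continuous ψ) (n : ℤ) :
    fc n (fun θ => φ θ + ψ θ) = fc n φ + fc n ψ := by
  simp only [fc_eq, add_mul]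
  rw [intervalIntegral.integral_add (intervalIntegrable_mul_ex hφ _ _ _)
    (intervalIntegrable_mul_ex hψ _ _ _), mul_add]

theorem fc_const_mul (a : ℂ) (φ : ℝ → ℂ) (n : ℤ) : fc n (fun θ => a * φ θ) = a * fc n φ := by
  simp only [fc_eq, mul_assoc]
  rw [intervalIntegral.integral_const_mul]; ring

theorem fc_neg (φ : ℝ → ℂ) (n : ℤ) : fc n (fun θ => -φ θ) = -fc n φ := by
  simpa using fc_const_mul (-1) φ n

theorem fc_sub {φ ψ : ℝ → ℂ} (hφ : Continuous φ) (hψ : Continuous ψ) (n : ℤ) :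
    fc n (fun θ => φ θ - ψ θ) = fc n φ - fc n ψ := by
  simp only [sub_eq_add_neg]
  rw [fc_add hφ hψ.fun_neg n, fc_neg]

theorem fc_zero_fun (n : ℤ) : fc n (fun _ => 0) = 0 := by simp [fc]

theorem fc_conj (φ : ℝ → ℂ) (n : ℤ) : fc (-n) (fun θ => conj (φ θ)) = conj (fc n φ) := by
  simp only [fc_eq, map_mul]
  congr 1
  · simp [map_ofNat]
  · rw [intervalIntegral.integral_of_le (by positivity), intervalIntegral.integral_of_le
      (by positivity), ← integral_conj]
    simp [conj_ex]

theorem fc_neg_ofReal (φ : ℝ → ℝ) (n : ℤ) :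
    fc (-n) (fun θ => (φ θ : ℂ)) = conj (fc n (fun θ => (φ θ : ℂ))) := by
  rw [← fc_conj]; simp

theorem fc_ex_mul (φ : ℝ → ℂ) (m n : ℤ) : fc n (fun θ => ex m θ * φ θ) = fc (n - m) φ := by
  simp only [fc_eq]
  congr 2
  funext θ
  rw [neg_sub, sub_eq_add_neg, ex_add]; ring

theorem fc_deriv {φ φ' : ℝ → ℂ} (hd : ∀ θ, HasDerivAt φ (φ' θ) θ) (hc : Continuous φ')
    (hp : φ (2 * Real.pi) = φ 0) (n : ℤ) : fc n φ' = Complex.I * n * fc n φ := by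
  have hper : ex (-n) (2 * Real.pi) = ex (-n) 0 := by simpa using ex_periodic (-n) 0
  have hcont : Continuous φ := continuous_iff_continuousAt.mpr fun x => (hd x).continuousAt
  have h := intervalIntegral.integral_mul_deriv_eq_deriv_mul (a := 0) (b := 2 * Real.pi)
    (fun θ _ => hasDerivAt_ex (-n) θ) (fun θ _ => hd θ)
    ((continuous_const.mul (continuous_ex _)).intervalIntegrable _ _)
    (hc.intervalIntegrable _ _)
  rw [hp, hper, sub_self, zero_sub] at h
  have h1 : ∫ θ in (0 : ℝ)..(2 * Real.pi), φ' θ * ex (-n) θ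
      = Complex.I * n * ∫ θ in (0 : ℝ)..(2 * Real.pi), φ θ * ex (-n) θ := by
    rw [← intervalIntegral.integral_const_mul]
    calc _ = ∫ θ in (0 : ℝ)..(2 * Real.pi), ex (-n) θ * φ' θ := by simp only [mul_comm]
      _ = _ := h
      _ = _ := by
        rw [← intervalIntegral.integral_neg]
        congr 1; funext θ; push_cast; ring
  rw [fc_eq, fc_eq, h1]; ring

theorem fc_const (a : ℂ) {n : ℤ} (hn : n ≠ 0) : fc n (fun _ => a) = 0 := by
  have h := fc_deriv (φ := fun _ => a) (φ' := fun _ => 0) (fun θ => hasDerivAt_const θ a)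
    continuous_const rfl n
  rw [fc_zero_fun] at h
  have : Complex.I * n ≠ 0 := mul_ne_zero Complex.I_ne_zero (by exact_mod_cast hn)
  exact (mul_eq_zero.mp h.symm).resolve_left this

theorem fc_zero_const (a : ℂ) : fc 0 (fun _ => a) = a := by
  have hpi : (Real.pi : ℂ) ≠ 0 := by exact_mod_cast Real.pi_ne_zero
  simp [fc]
  field_simp

/-- The summable weights `1 / (1 + n²)`. -/
def wt (n : ℤ) : ℝ := (1 + (n : ℝ) ^ 2)⁻¹

theorem wt_nonneg (n : ℤ) : 0 ≤ wt n := by unfold wt; positivity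

theorem summable_wt : Summable wt := by
  have h : Summable fun n : ℤ => 1 / (n : ℝ) ^ 2 := Real.summable_one_div_int_pow.mpr one_lt_two
  refine Summable.of_norm_bounded_eventually h ?_
  have : {n : ℤ | n ≠ 0} ∈ Filter.cofinite := (finite_singleton 0).compl_mem_cofinite
  filter_upwards [this] with n hn
  have hn' : (n : ℝ) ≠ 0 := by exact_mod_cast hn
  rw [Real.norm_of_nonneg (wt_nonneg n), wt, one_div]
  gcongr
  linarith

/-- Two integrations by parts bound n² times the coefficient. The constant is explicit, so that
bounds on φ and φ'' uniform in a parameter give uniform bounds on the coefficients. -/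
theorem norm_fc_le_wt {φ φ' φ'' : ℝ → ℂ} (hd : ∀ θ, HasDerivAt φ (φ' θ) θ)
    (hd' : ∀ θ, HasDerivAt φ' (φ'' θ) θ) (hc : Continuous φ'')
    (hp : φ (2 * Real.pi) = φ 0) (hp' : φ' (2 * Real.pi) = φ' 0)
    {A B : ℝ} (hA : ∀ θ, ‖φ θ‖ ≤ A) (hB : ∀ θ, ‖φ'' θ‖ ≤ B) (n : ℤ) :
    ‖fc n φ‖ ≤ (A + B) * wt n := by
  have hcont' : Continuous φ' := continuous_iff_continuousAt.mpr fun x => (hd' x).continuousAt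
  have h1 := norm_fc_le hA n
  have h2 := norm_fc_le hB n
  rw [fc_deriv hd' hc hp' n, fc_deriv hd hcont' hp n, norm_mul, norm_mul, norm_mul, norm_mul] at h2
  simp only [Complex.norm_I, one_mul, Complex.norm_intCast] at h2
  have h3 : (n : ℝ) ^ 2 * ‖fc n φ‖ ≤ B := by
    rw [← sq_abs]; linarith [h2, sq (|(n : ℝ)|), mul_assoc |(n : ℝ)| |(n : ℝ)| ‖fc n φ‖]
  rw [wt, ← div_eq_mul_inv, le_div_iff₀ (by positivity)]
  linarith

/-- Termwise integration of an absolutely convergent trigonometric series. It yields uniqueness of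
coefficients, and it computes the coefficients of `bilin`, which is defined as a series. -/
theorem fc_hasSum {a : ℤ → ℂ} (ha : Summable a) (n : ℤ) :
    fc n (fun θ => ∑' m, a m * ex m θ) = a n := by
  have hpi : (Real.pi : ℂ) ≠ 0 := by exact_mod_cast Real.pi_ne_zero
  have han : Summable fun m => ‖a m‖ := ha.norm
  have hS : HasSum (fun m => ∫ θ in (0 : ℝ)..(2 * Real.pi), a m * ex m θ * ex (-n) θ)
      (∫ θ in (0 : ℝ)..(2 * Real.pi), (∑' m, a m * ex m θ) * ex (-n) θ) := by
    refine intervalIntegral.hasSum_integral_of_dominated_convergence (fun m _ => ‖a m‖) ?_ ?_ ?_ ?_ ?_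
    · intro m
      exact ((continuous_const.mul (continuous_ex m)).mul (continuous_ex (-n))).aestronglyMeasurable
    · intro m
      exact Filter.Eventually.of_forall fun θ _ => by simp [norm_ex]
    · exact Filter.Eventually.of_forall fun _ _ => han
    · simp
    · refine Filter.Eventually.of_forall fun θ _ => HasSum.mul_right _ (Summable.hasSum ?_)
      exact Summable.of_norm (by simpa [norm_ex] using han)
  have hterm : ∀ m, (1 / (2 * Real.pi) : ℂ) *
      ∫ θ in (0 : ℝ)..(2 * Real.pi), a m * ex m θ * ex (-n) θ = if m = n then a n else 0 := by
    intro m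
    rw [← fc_eq, fc_const_mul]
    have := fc_ex_mul (fun _ => 1) m n
    simp only [mul_one] at this
    rw [show fc n (ex m) = _ from this]
    split_ifs with h
    · rw [h, sub_self, fc_zero_const, mul_one]
    · rw [fc_const _ (sub_ne_zero.mpr fun h' => h h'.symm), mul_zero]
  rw [fc_eq]
  have h2 := hS.mul_left (1 / (2 * Real.pi) : ℂ)
  simp only [hterm] at h2
  exact h2.unique (hasSum_ite_eq n (a n))

/-- Transported from the Fourier theory on `AddCircle (2 * Real.pi)`. -/
theorem hasSum_fc {φ : ℝ → ℂ} (hc : Continuous φ) (hp : Function.Periodic φ (2 * Real.pi))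
    (hs : Summable fun n => fc n φ) (θ : ℝ) : HasSum (fun n => fc n φ * ex n θ) (φ θ) := by
  have : Fact (0 < 2 * Real.pi) := ⟨Real.two_pi_pos⟩
  let f : C(AddCircle (2 * Real.pi), ℂ) := ⟨hp.lift, continuous_quot_lift _ hc⟩
  have hf : ∀ x : ℝ, f (x : AddCircle (2 * Real.pi)) = φ x := fun x => hp.lift_coe x
  have hfour : ∀ (n : ℤ) (x : ℝ), fourier n (x : AddCircle (2 * Real.pi)) = ex n x := by
    intro n x
    rw [fourier_coe_apply, ex]
    have hpi : (Real.pi : ℂ) ≠ 0 := by exact_mod_cast Real.pi_ne_zero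
    congr 1
    push_cast
    field_simp
  have hcoeff : ∀ n, fourierCoeff f n = fc n φ := by
    intro n
    rw [fourierCoeff_eq_intervalIntegral f n 0, fc_eq, zero_add]
    simp only [hf, hfour, smul_eq_mul]
    rw [Complex.real_smul]
    push_cast
    simp only [mul_comm (ex _ _)]
  have hs' : Summable (fourierCoeff f) := by
    rw [funext hcoeff]; exact hs
  have h := has_pointwise_sum_fourier_series_of_summable hs' (θ : AddCircle (2 * Real.pi))
  simpa only [hcoeff, hfour, hf, smul_eq_mul] using h

/-- Only ψ is expanded in its series; φ need only be continuous, being bounded on one period. -/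
theorem hasSum_fc_mul {φ ψ : ℝ → ℂ} (hφ : Continuous φ) (hψ : Continuous ψ)
    (hp : Function.Periodic ψ (2 * Real.pi)) (hs : Summable fun n => fc n ψ) (n : ℤ) :
    HasSum (fun m => fc (n - m) φ * fc m ψ) (fc n (fun θ => φ θ * ψ θ)) := by
  obtain ⟨C, hC⟩ := (isCompact_Icc (a := 0) (b := 2 * Real.pi)).exists_bound_of_continuousOn
    hφ.continuousOn
  have hS : HasSum (fun m => ∫ θ in (0 : ℝ)..(2 * Real.pi), φ θ * (fc m ψ * ex m θ) * ex (-n) θ)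
      (∫ θ in (0 : ℝ)..(2 * Real.pi), φ θ * ψ θ * ex (-n) θ) := by
    refine intervalIntegral.hasSum_integral_of_dominated_convergence
      (fun m _ => C * ‖fc m ψ‖) ?_ ?_ ?_ ?_ ?_
    · intro m
      exact ((hφ.mul (continuous_const.mul (continuous_ex m))).mul
        (continuous_ex (-n))).aestronglyMeasurable
    · intro m
      refine Filter.Eventually.of_forall fun θ hθ => ?_
      rw [uIoc_of_le Real.two_pi_pos.le] at hθ
      simp only [norm_mul, norm_ex, mul_one]
      gcongr
      exact hC θ (Ioc_subset_Icc_self hθ)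
    · exact Filter.Eventually.of_forall fun _ _ => hs.norm.mul_left C
    · simp
    · exact Filter.Eventually.of_forall fun θ _ =>
        ((hasSum_fc hψ hp hs θ).mul_left (φ θ)).mul_right _
  rw [fc_eq]
  refine (hS.mul_left (1 / (2 * Real.pi) : ℂ)).congr_fun fun m => ?_
  rw [← fc_eq, ← fc_ex_mul, mul_comm, ← fc_const_mul]
  exact fc_congr n fun θ => by ring

/-- Fourier coefficients of a `C²` function with uniform bounds are summable. -/
theorem summable_of_norm_le_wt {a : ℤ → ℂ} {C : ℝ} (h : ∀ n, ‖a n‖ ≤ C * wt n) : Summable a :=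
  Summable.of_norm_bounded (summable_wt.mul_left C) h

theorem exists_bound_of_periodic {φ : ℝ → ℂ} (hc : Continuous φ)
    (hp : Function.Periodic φ (2 * Real.pi)) : ∃ C, ∀ θ, ‖φ θ‖ ≤ C := by
  obtain ⟨C, hC⟩ := (isCompact_Icc (a := 0) (b := 2 * Real.pi)).exists_bound_of_continuousOn
    hc.continuousOn
  refine ⟨C, fun θ => ?_⟩
  obtain ⟨y, hy, hyθ⟩ := hp.exists_mem_Ico₀ Real.two_pi_pos θ
  rw [hyθ]
  exact hC y (Ico_subset_Icc_self hy)

theorem exists_norm_fc_le_wt {φ φ' φ'' : ℝ → ℂ} (hd : ∀ θ, HasDerivAt φ (φ' θ) θ)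
    (hd' : ∀ θ, HasDerivAt φ' (φ'' θ) θ) (hc : Continuous φ'')
    (hp : Function.Periodic φ (2 * Real.pi)) (hp' : Function.Periodic φ' (2 * Real.pi))
    (hp'' : Function.Periodic φ'' (2 * Real.pi)) : ∃ C, 0 ≤ C ∧ ∀ n, ‖fc n φ‖ ≤ C * wt n := by
  have hcφ : Continuous φ := continuous_iff_continuousAt.mpr fun x => (hd x).continuousAt
  obtain ⟨A, hA⟩ := exists_bound_of_periodic hcφ hp
  obtain ⟨B, hB⟩ := exists_bound_of_periodic hc hp''
  refine ⟨A + B, add_nonneg ((norm_nonneg _).trans (hA 0)) ((norm_nonneg _).trans (hB 0)),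
    norm_fc_le_wt hd hd' hc (by simpa using hp 0) (by simpa using hp' 0) hA hB⟩

/-- Smooth periodic functions. -/
def SmoothPer (φ : ℝ → ℂ) : Prop := ContDiff ℝ ∞ φ ∧ Function.Periodic φ (2 * Real.pi)

theorem SmoothPer.hasDerivAt {φ : ℝ → ℂ} (h : SmoothPer φ) (θ : ℝ) :
    HasDerivAt φ (deriv φ θ) θ :=
  (h.1.differentiable (by simp) θ).hasDerivAt

theorem SmoothPer.deriv {φ : ℝ → ℂ} (h : SmoothPer φ) : SmoothPer (deriv φ) := by
  refine ⟨((contDiff_infty_iff_deriv (𝕜 := ℝ)).mp h.1).2, fun θ => ?_⟩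
  have : (fun x => φ (x + 2 * Real.pi)) = φ := funext h.2
  rw [← deriv_comp_add_const, this]

theorem SmoothPer.continuous {φ : ℝ → ℂ} (h : SmoothPer φ) : Continuous φ := h.1.continuous

theorem SmoothPer.exists_norm_fc_le {φ : ℝ → ℂ} (h : SmoothPer φ) :
    ∃ C, 0 ≤ C ∧ ∀ n, ‖fc n φ‖ ≤ C * wt n :=
  exists_norm_fc_le_wt h.hasDerivAt h.deriv.hasDerivAt h.deriv.deriv.continuous h.2 h.deriv.2
    h.deriv.deriv.2

theorem SmoothPer.summable_fc {φ : ℝ → ℂ} (h : SmoothPer φ) : Summable fun n => fc n φ :=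
  let ⟨_, _, hC⟩ := h.exists_norm_fc_le
  summable_of_norm_le_wt hC

theorem SmoothPer.fc_deriv {φ : ℝ → ℂ} (h : SmoothPer φ) (n : ℤ) :
    fc n (_root_.deriv φ) = Complex.I * n * fc n φ :=
  RayleighWave.fc_deriv h.hasDerivAt h.deriv.continuous (by simpa using h.2 0) n

theorem SmoothPer.exists_abs_mul_norm_fc_le {φ : ℝ → ℂ} (h : SmoothPer φ) :
    ∃ C, 0 ≤ C ∧ ∀ n : ℤ, |(n : ℝ)| * ‖fc n φ‖ ≤ C * wt n := by
  obtain ⟨C, hC0, hC⟩ := h.deriv.exists_norm_fc_le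
  refine ⟨C, hC0, fun n => ?_⟩
  have := hC n
  rw [h.fc_deriv, norm_mul, norm_mul] at this
  simpa using this

theorem SmoothPer.hasSum_fc {φ : ℝ → ℂ} (h : SmoothPer φ) (θ : ℝ) :
    HasSum (fun n => fc n φ * ex n θ) (φ θ) :=
  RayleighWave.hasSum_fc h.continuous h.2 h.summable_fc θ

/-! ## Fourier modes of functions on boxes with one periodic variable -/

/-- Boxes of closed nondegenerate intervals, unbounded in the variable number `j`. -/
structure PerBox {d : ℕ} (D : Fin d → Set ℝ) (j : Fin d) : Prop where
  uniq : ∀ i, UniqueDiffOn ℝ (D i)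
  conv : ∀ i, Convex ℝ (D i)
  closed : ∀ i, IsClosed (D i)
  eq_univ : D j = univ

/-- Smooth functions on a box that are periodic in the variable number `j`. -/
structure SmoothPerOn {d : ℕ} (D : Fin d → Set ℝ) (j : Fin d) (f : (Fin d → ℝ) → ℝ) : Prop where
  smooth : ContDiffOn ℝ ∞ f (univ.pi D)
  per : ∀ p ∈ univ.pi D, f (Function.update p j (p j + 2 * Real.pi)) = f p

/-- The Fourier coefficient in the variable number `j`. -/
def modeAt {d : ℕ} (j : Fin d) (n : ℤ) (f : (Fin d → ℝ) → ℝ) (p : Fin d → ℝ) : ℂ :=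
  fc n (fun θ => (f (Function.update p j θ) : ℂ))

section

variable {d : ℕ} {D : Fin d → Set ℝ} {j : Fin d}

theorem PerBox.update_mem (hD : PerBox D j) {p : Fin d → ℝ} (hp : p ∈ univ.pi D) (θ : ℝ) :
    Function.update p j θ ∈ univ.pi D :=
  update_mem_box hp (by rw [hD.eq_univ]; trivial)

theorem SmoothPerOn.pd (hD : PerBox D j) {f : (Fin d → ℝ) → ℝ} (hf : SmoothPerOn D j f)
    (i : Fin d) : SmoothPerOn D j (pd D i f) := by
  refine ⟨contDiffOn_pd hD.uniq hf.smooth i, fun p hp => ?_⟩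
  by_cases h : i = j
  · subst h
    simp only [RayleighWave.pd, Function.update_idem, Function.update_self]
    rw [hD.eq_univ, derivWithin_univ, ← deriv_comp_add_const]
    congr 1
    funext s
    have := hf.per _ (hD.update_mem hp s)
    simpa using this
  · simp only [RayleighWave.pd]
    rw [Function.update_of_ne h]
    have key : ∀ s ∈ D i, f (Function.update (Function.update p j (p j + 2 * Real.pi)) i s)
        = f (Function.update p i s) := by
      intro s hs
      have := hf.per _ (update_mem_box hp hs)
      rw [Function.update_of_ne (Ne.symm h)] at this
      rw [Function.update_comm (Ne.symm h)]
      exact this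
    refine derivWithin_congr key ?_
    exact key _ (hp i (mem_univ i))

theorem SmoothPerOn.hasDerivAt (hD : PerBox D j) {f : (Fin d → ℝ) → ℝ} (hf : SmoothPerOn D j f)
    {p : Fin d → ℝ} (hp : p ∈ univ.pi D) (θ : ℝ) :
    HasDerivAt (fun θ => (f (Function.update p j θ) : ℂ))
      (RayleighWave.pd D j f (Function.update p j θ) : ℂ) θ := by
  have h := hasDerivWithinAt_update hf.smooth (hD.update_mem hp θ) j
  rw [hD.eq_univ, hasDerivWithinAt_univ] at h
  simp only [Function.update_idem, Function.update_self] at h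
  exact h.ofReal_comp

theorem SmoothPerOn.continuous (hD : PerBox D j) {f : (Fin d → ℝ) → ℝ} (hf : SmoothPerOn D j f)
    {p : Fin d → ℝ} (hp : p ∈ univ.pi D) :
    Continuous fun θ => (f (Function.update p j θ) : ℂ) :=
  continuous_iff_continuousAt.mpr fun θ => (hf.hasDerivAt hD hp θ).continuousAt

theorem SmoothPerOn.periodic (hD : PerBox D j) {f : (Fin d → ℝ) → ℝ} (hf : SmoothPerOn D j f)
    {p : Fin d → ℝ} (hp : p ∈ univ.pi D) :
    Function.Periodic (fun θ => (f (Function.update p j θ) : ℂ)) (2 * Real.pi) := by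
  intro θ
  have := hf.per _ (hD.update_mem hp θ)
  simp only [Function.update_idem, Function.update_self] at this
  simp only [this]

theorem SmoothPerOn.modeAt_pd_self (hD : PerBox D j) {f : (Fin d → ℝ) → ℝ}
    (hf : SmoothPerOn D j f) {p : Fin d → ℝ} (hp : p ∈ univ.pi D) (n : ℤ) :
    modeAt j n (RayleighWave.pd D j f) p = Complex.I * n * modeAt j n f p :=
  fc_deriv (hf.hasDerivAt hD hp) ((hf.pd hD j).continuous hD hp)
    (by simpa using hf.periodic hD hp 0) n

/-- The constant A + B is independent of the point p; this makes the bounds on modes uniform in Y.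
-/
theorem SmoothPerOn.norm_modeAt_le (hD : PerBox D j) {f : (Fin d → ℝ) → ℝ}
    (hf : SmoothPerOn D j f) {p : Fin d → ℝ} (hp : p ∈ univ.pi D) {A B : ℝ}
    (hA : ∀ θ, |f (Function.update p j θ)| ≤ A)
    (hB : ∀ θ, |RayleighWave.pd D j (RayleighWave.pd D j f) (Function.update p j θ)| ≤ B) (n : ℤ) :
    ‖modeAt j n f p‖ ≤ (A + B) * wt n :=
  norm_fc_le_wt (hf.hasDerivAt hD hp) ((hf.pd hD j).hasDerivAt hD hp)
    (((hf.pd hD j).pd hD j).continuous hD hp) (by simpa using hf.periodic hD hp 0)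
    (by simpa using (hf.pd hD j).periodic hD hp 0) (fun θ => by simpa using hA θ)
    (fun θ => by simpa using hB θ) n

theorem SmoothPerOn.exists_norm_modeAt_le (hD : PerBox D j) {f : (Fin d → ℝ) → ℝ}
    (hf : SmoothPerOn D j f) {p : Fin d → ℝ} (hp : p ∈ univ.pi D) :
    ∃ C, 0 ≤ C ∧ ∀ n, ‖modeAt j n f p‖ ≤ C * wt n :=
  exists_norm_fc_le_wt (hf.hasDerivAt hD hp) ((hf.pd hD j).hasDerivAt hD hp)
    (((hf.pd hD j).pd hD j).continuous hD hp) (hf.periodic hD hp)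
    ((hf.pd hD j).periodic hD hp) (((hf.pd hD j).pd hD j).periodic hD hp)

theorem SmoothPerOn.summable_modeAt (hD : PerBox D j) {f : (Fin d → ℝ) → ℝ}
    (hf : SmoothPerOn D j f) {p : Fin d → ℝ} (hp : p ∈ univ.pi D) :
    Summable fun n => modeAt j n f p :=
  let ⟨_, _, hC⟩ := hf.exists_norm_modeAt_le hD hp
  summable_of_norm_le_wt hC

/-- Fourier coefficients may be differentiated in the other variables. -/
theorem SmoothPerOn.hasDerivWithinAt_modeAt (hD : PerBox D j) {f : (Fin d → ℝ) → ℝ}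
    (hf : SmoothPerOn D j f) {p : Fin d → ℝ} (hp : p ∈ univ.pi D) {i : Fin d} (hi : i ≠ j)
    (n : ℤ) :
    HasDerivWithinAt (fun s => modeAt j n f (Function.update p i s))
      (modeAt j n (RayleighWave.pd D i f) p) (D i) (p i) := by
  have hmem : ∀ s ∈ D i, ∀ θ, Function.update (Function.update p i s) j θ ∈ univ.pi D :=
    fun s hs θ => hD.update_mem (update_mem_box hp hs) θ
  have hcont : Continuous fun z : ℝ × ℝ => Function.update (Function.update p i z.1) j z.2 := by
    have h1 : Continuous fun z : ℝ × ℝ => Function.update p i z.1 :=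
      Continuous.update (f := fun _ => p) continuous_const i continuous_fst
    exact Continuous.update h1 j continuous_snd
  have h := hasDerivWithinAt_intervalIntegral_of_continuousOn (hD.conv i) (a := 0)
    (b := 2 * Real.pi) Real.two_pi_pos.le (hp i (mem_univ i)) (hD.closed i)
    (g := fun s θ => (f (Function.update (Function.update p i s) j θ) : ℂ) * ex (-n) θ)
    (g' := fun s θ => (RayleighWave.pd D i f (Function.update (Function.update p i s) j θ) : ℂ)
      * ex (-n) θ) ?_ ?_ ?_
  · have h' := h.const_mul (1 / (2 * Real.pi) : ℂ)
    simp only [Function.update_eq_self] at h'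
    simp only [modeAt, fc_eq]
    exact h'
  · intro s hs
    exact ((hf.continuous hD (update_mem_box hp hs)).mul (continuous_ex _)).continuousOn
  · refine ContinuousOn.mul ?_ ((continuous_ex (-n)).comp continuous_snd).continuousOn
    refine Complex.continuous_ofReal.comp_continuousOn ?_
    exact (contDiffOn_pd hD.uniq hf.smooth i).continuousOn.comp hcont.continuousOn
      fun z hz => hmem z.1 hz.1 z.2
  · intro s hs θ _
    refine HasDerivWithinAt.mul_const ?_ (ex (-n) θ)
    have h1 := hasDerivWithinAt_update hf.smooth (hmem s hs θ) i
    rw [Function.update_of_ne hi, Function.update_self] at h1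
    have h2 := h1.ofReal_comp
    have h3 : ∀ s', Function.update (Function.update (Function.update p i s) j θ) i s'
        = Function.update (Function.update p i s') j θ := fun s' => by
      rw [Function.update_comm (Ne.symm hi), Function.update_idem]
    simp only [h3] at h2
    exact h2

theorem SmoothPerOn.modeAt_add (hD : PerBox D j) {f g : (Fin d → ℝ) → ℝ}
    (hf : SmoothPerOn D j f) (hg : SmoothPerOn D j g) {p : Fin d → ℝ} (hp : p ∈ univ.pi D)
    (n : ℤ) : modeAt j n (fun p => f p + g p) p = modeAt j n f p + modeAt j n g p := by
  simp only [modeAt]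
  rw [← fc_add (hf.continuous hD hp) (hg.continuous hD hp)]
  simp

theorem SmoothPerOn.modeAt_sub (hD : PerBox D j) {f g : (Fin d → ℝ) → ℝ}
    (hf : SmoothPerOn D j f) (hg : SmoothPerOn D j g) {p : Fin d → ℝ} (hp : p ∈ univ.pi D)
    (n : ℤ) : modeAt j n (fun p => f p - g p) p = modeAt j n f p - modeAt j n g p := by
  simp only [modeAt]
  rw [← fc_sub (hf.continuous hD hp) (hg.continuous hD hp)]
  simp

theorem modeAt_const_mul (a : ℝ) (f : (Fin d → ℝ) → ℝ) (p : Fin d → ℝ) (n : ℤ) :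
    modeAt j n (fun p => a * f p) p = a * modeAt j n f p := by
  simp only [modeAt]
  rw [← fc_const_mul]
  simp

theorem modeAt_neg (f : (Fin d → ℝ) → ℝ) (p : Fin d → ℝ) (n : ℤ) :
    modeAt j n (fun p => -f p) p = -modeAt j n f p := by
  simpa using modeAt_const_mul (j := j) (-1) f p n

theorem SmoothPerOn.hasSum_modeAt_mul (hD : PerBox D j) {f g : (Fin d → ℝ) → ℝ}
    (hf : SmoothPerOn D j f) (hg : SmoothPerOn D j g) {p : Fin d → ℝ} (hp : p ∈ univ.pi D)
    (n : ℤ) : HasSum (fun m => modeAt j (n - m) f p * modeAt j m g p)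
      (modeAt j n (fun p => f p * g p) p) := by
  have := hasSum_fc_mul (hf.continuous hD hp) (hg.continuous hD hp) (hg.periodic hD hp)
    (hg.summable_modeAt hD hp) n
  simpa [modeAt] using this

theorem SmoothPerOn.add {f g : (Fin d → ℝ) → ℝ} (hf : SmoothPerOn D j f)
    (hg : SmoothPerOn D j g) : SmoothPerOn D j (fun p => f p + g p) :=
  ⟨hf.smooth.add hg.smooth, fun p hp => by simp only [hf.per p hp, hg.per p hp]⟩

theorem SmoothPerOn.mul {f g : (Fin d → ℝ) → ℝ} (hf : SmoothPerOn D j f)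
    (hg : SmoothPerOn D j g) : SmoothPerOn D j (fun p => f p * g p) :=
  ⟨hf.smooth.mul hg.smooth, fun p hp => by simp only [hf.per p hp, hg.per p hp]⟩

theorem smoothPerOn_const (a : ℝ) : SmoothPerOn D j (fun _ => a) :=
  ⟨contDiffOn_const, fun _ _ => rfl⟩

end

theorem perBox_domAll {T : ℝ} (hT : 0 < T) : PerBox (domAll T) 3 := by
  refine ⟨fun i => ?_, fun i => ?_, fun i => ?_, rfl⟩
  · fin_cases i
    · exact uniqueDiffOn_Icc hT
    · exact uniqueDiffOn_univ
    · exact uniqueDiffOn_Ici 0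
    · exact uniqueDiffOn_univ
    · exact uniqueDiffOn_Ici 0
  · fin_cases i
    · exact convex_Icc 0 T
    · exact convex_univ
    · exact convex_Ici 0
    · exact convex_univ
    · exact convex_Ici 0
  · fin_cases i
    · exact isClosed_Icc
    · exact isClosed_univ
    · exact isClosed_Ici
    · exact isClosed_univ
    · exact isClosed_Ici

theorem perBox_domSurf {T : ℝ} (hT : 0 < T) : PerBox (domSurf T) 2 := by
  refine ⟨fun i => ?_, fun i => ?_, fun i => ?_, rfl⟩
  · fin_cases i
    · exact uniqueDiffOn_Icc hT
    · exact uniqueDiffOn_univ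
    · exact uniqueDiffOn_univ
    · exact uniqueDiffOn_Ici 0
  · fin_cases i
    · exact convex_Icc 0 T
    · exact convex_univ
    · exact convex_univ
    · exact convex_Ici 0
  · fin_cases i
    · exact isClosed_Icc
    · exact isClosed_univ
    · exact isClosed_univ
    · exact isClosed_Ici

theorem perBox_domBd {T : ℝ} (hT : 0 < T) : PerBox (domBd T) 2 := by
  refine ⟨fun i => ?_, fun i => ?_, fun i => ?_, rfl⟩
  · fin_cases i
    · exact uniqueDiffOn_Icc hT
    · exact uniqueDiffOn_univ
    · exact uniqueDiffOn_univ
  · fin_cases i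
    · exact convex_Icc 0 T
    · exact convex_univ
    · exact convex_univ
  · fin_cases i
    · exact isClosed_Icc
    · exact isClosed_univ
    · exact isClosed_univ

theorem mem_domAll {T t x y θ Y : ℝ} (ht : t ∈ Icc 0 T) (hy : 0 ≤ y) (hY : 0 ≤ Y) :
    ![t, x, y, θ, Y] ∈ univ.pi (domAll T) := by
  intro i _
  fin_cases i
  · exact ht
  · exact mem_univ x
  · exact hy
  · exact mem_univ θ
  · exact hY

theorem mem_domSurf {T t x θ Y : ℝ} (ht : t ∈ Icc 0 T) (hY : 0 ≤ Y) :
    ![t, x, θ, Y] ∈ univ.pi (domSurf T) := by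
  intro i _
  fin_cases i
  · exact ht
  · exact mem_univ x
  · exact mem_univ θ
  · exact hY

theorem mem_domBd {T t x θ : ℝ} (ht : t ∈ Icc 0 T) :
    ![t, x, θ] ∈ univ.pi (domBd T) := by
  intro i _
  fin_cases i
  · exact ht
  · exact mem_univ x
  · exact mem_univ θ

theorem mode_eq_modeAt (n : ℤ) (f : (Fin 5 → ℝ) → ℝ) (t x y θ Y : ℝ) :
    mode n f t x y Y = modeAt 3 n f ![t, x, y, θ, Y] := by
  refine fc_congr n fun s => ?_
  congr 2
  ext i; fin_cases i <;> rfl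

theorem fc_slice_eq_modeAt (n : ℤ) (α : (Fin 3 → ℝ) → ℝ) (t x θ : ℝ) :
    fc n (slice α t x) = modeAt 2 n α ![t, x, θ] := by
  refine fc_congr n fun s => ?_
  simp only [slice]
  congr 2
  ext i; fin_cases i <;> rfl

theorem InBd.smoothPerOn {T : ℝ} {α : (Fin 3 → ℝ) → ℝ} (h : InBd T α) :
    SmoothPerOn (domBd T) 2 α := by
  refine ⟨h.1.1, fun p _ => ?_⟩
  have h1 := h.2 (p 0) (p 1) (p 2)
  convert h1 using 2 <;> (ext i; fin_cases i <;> rfl)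

/-! ## Smooth functions of all variables that are bounded in the fast variables -/

/-- Smooth `θ`-periodic functions of `(t, x, y, θ, Y)` all of whose derivatives are bounded in
`(θ, Y)` for fixed `(t, x, y)`. -/
structure IsReg (T : ℝ) (f : (Fin 5 → ℝ) → ℝ) : Prop where
  per : SmoothPerOn (domAll T) 3 f
  bdd : ∀ l : List (Fin 5), ∀ t ∈ Icc 0 T, ∀ x y : ℝ, 0 ≤ y →
    ∃ C, ∀ θ Y : ℝ, 0 ≤ Y → |iterPd (domAll T) l f ![t, x, y, θ, Y]| ≤ C

section

variable {T : ℝ}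

theorem iterPd_add {d : ℕ} {D : Fin d → Set ℝ} (hD : ∀ i, UniqueDiffOn ℝ (D i))
    {f g : (Fin d → ℝ) → ℝ} (hf : ContDiffOn ℝ ∞ f (univ.pi D))
    (hg : ContDiffOn ℝ ∞ g (univ.pi D)) (l : List (Fin d)) :
    EqOn (iterPd D l (fun p => f p + g p)) (fun p => iterPd D l f p + iterPd D l g p)
      (univ.pi D) := by
  induction l with
  | nil => intro p _; rfl
  | cons i l ih =>
    intro p hp
    refine (pd_congr ih i hp).trans ?_
    exact pd_add hD (contDiffOn_iterPd hD hf l) (contDiffOn_iterPd hD hg l) i hp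

theorem IsReg.pd (hT : 0 < T) {f : (Fin 5 → ℝ) → ℝ} (hf : IsReg T f) (i : Fin 5) :
    IsReg T (pd (domAll T) i f) := by
  refine ⟨hf.per.pd (perBox_domAll hT) i, fun l t ht x y hy => ?_⟩
  obtain ⟨C, hC⟩ := hf.bdd (l ++ [i]) t ht x y hy
  refine ⟨C, fun θ Y hY => ?_⟩
  have := hC θ Y hY
  rw [iterPd_append] at this
  exact this

theorem IsReg.add (hT : 0 < T) {f g : (Fin 5 → ℝ) → ℝ} (hf : IsReg T f) (hg : IsReg T g) :
    IsReg T (fun p => f p + g p) := by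
  refine ⟨hf.per.add hg.per, fun l t ht x y hy => ?_⟩
  obtain ⟨C, hC⟩ := hf.bdd l t ht x y hy
  obtain ⟨C', hC'⟩ := hg.bdd l t ht x y hy
  refine ⟨C + C', fun θ Y hY => ?_⟩
  rw [iterPd_add (perBox_domAll hT).uniq hf.per.smooth hg.per.smooth l (mem_domAll ht hy hY)]
  exact (abs_add_le _ _).trans (add_le_add (hC θ Y hY) (hC' θ Y hY))

theorem IsReg.mul (hT : 0 < T) {f g : (Fin 5 → ℝ) → ℝ} (hf : IsReg T f) (hg : IsReg T g) :
    IsReg T (fun p => f p * g p) := by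
  have hD := (perBox_domAll hT).uniq
  refine ⟨hf.per.mul hg.per, fun l => ?_⟩
  -- The induction removes the innermost derivative, to which the product rule applies directly; f
  -- and g are generalised because the rule replaces one of them by its derivative.
  induction l using List.reverseRecOn generalizing f g with
  | nil =>
    intro t ht x y hy
    obtain ⟨C, hC⟩ := hf.bdd [] t ht x y hy
    obtain ⟨C', hC'⟩ := hg.bdd [] t ht x y hy
    refine ⟨C * C', fun θ Y hY => ?_⟩
    have h1 := hC θ Y hY
    simp only [iterPd, List.foldr_nil] at h1 ⊢
    rw [abs_mul]
    exact mul_le_mul h1 (hC' θ Y hY) (abs_nonneg _) ((abs_nonneg _).trans h1)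
  | append_singleton l i ih =>
    intro t ht x y hy
    obtain ⟨C, hC⟩ := ih (hf.pd hT i) hg t ht x y hy
    obtain ⟨C', hC'⟩ := ih hf (hg.pd hT i) t ht x y hy
    refine ⟨C + C', fun θ Y hY => ?_⟩
    have hmem := mem_domAll (x := x) (θ := θ) ht hy hY
    rw [iterPd_append]
    have h1 : EqOn (iterPd (domAll T) [i] fun p => f p * g p)
        (fun p => RayleighWave.pd (domAll T) i f p * g p + f p * RayleighWave.pd (domAll T) i g p)
        (univ.pi (domAll T)) := pd_mul hD hf.per.smooth hg.per.smooth i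
    rw [iterPd_congr h1 l hmem, iterPd_add hD ((hf.pd hT i).per.mul hg.per).smooth
      (hf.per.mul (hg.pd hT i).per).smooth l hmem]
    exact (abs_add_le _ _).trans (add_le_add (hC θ Y hY) (hC' θ Y hY))

theorem iterPd_const {d : ℕ} {D : Fin d → Set ℝ} (a : ℝ) (l : List (Fin d)) :
    ∃ b, iterPd D l (fun _ => a) = fun _ => b := by
  induction l with
  | nil => exact ⟨a, rfl⟩
  | cons i l ih =>
    obtain ⟨b, hb⟩ := ih
    refine ⟨0, ?_⟩
    have : iterPd D (i :: l) (fun _ => a) = pd D i (iterPd D l fun _ => a) := rfl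
    rw [this, hb]
    exact funext fun p => pd_const b i p

theorem isReg_const (a : ℝ) : IsReg T (fun _ => a) := by
  refine ⟨smoothPerOn_const a, fun l t _ x y _ => ?_⟩
  obtain ⟨b, hb⟩ := iterPd_const (D := domAll T) a l
  exact ⟨|b|, fun θ Y _ => by rw [hb]⟩

theorem IsReg.const_mul (hT : 0 < T) {f : (Fin 5 → ℝ) → ℝ} (hf : IsReg T f) (a : ℝ) :
    IsReg T (fun p => a * f p) := (isReg_const a).mul hT hf

theorem IsReg.neg (hT : 0 < T) {f : (Fin 5 → ℝ) → ℝ} (hf : IsReg T f) :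
    IsReg T (fun p => -f p) := by simpa using hf.const_mul hT (-1)

theorem IsReg.sub (hT : 0 < T) {f g : (Fin 5 → ℝ) → ℝ} (hf : IsReg T f) (hg : IsReg T g) :
    IsReg T (fun p => f p - g p) := by
  simpa only [sub_eq_add_neg] using hf.add hT (hg.neg hT)

theorem IsReg.sum (hT : 0 < T) {ι : Type*} (s : Finset ι) {f : ι → (Fin 5 → ℝ) → ℝ}
    (hf : ∀ i ∈ s, IsReg T (f i)) : IsReg T (fun p => ∑ i ∈ s, f i p) := by
  classical
  induction s using Finset.induction_on with
  | empty => simpa using isReg_const 0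
  | insert a s ha ih =>
    simp only [Finset.sum_insert ha]
    exact (hf a (by simp)).add hT (ih fun i hi => hf i (by simp [hi]))

theorem IsReg.iterate_pd (hT : 0 < T) {f : (Fin 5 → ℝ) → ℝ} (hf : IsReg T f) (i : Fin 5)
    (n : ℕ) : IsReg T ((RayleighWave.pd (domAll T) i)^[n] f) := by
  induction n with
  | zero => exact hf
  | succ n ih => rw [Function.iterate_succ_apply']; exact ih.pd hT i

theorem update_domAll_three (t x y θ Y s : ℝ) :
    Function.update ![t, x, y, θ, Y] 3 s = ![t, x, y, s, Y] := by
  ext i; fin_cases i <;> rfl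

theorem IsReg.exists_norm_mode_le (hT : 0 < T) {f : (Fin 5 → ℝ) → ℝ} (hf : IsReg T f)
    {t x y : ℝ} (ht : t ∈ Icc 0 T) (hy : 0 ≤ y) :
    ∃ C, 0 ≤ C ∧ ∀ n : ℤ, ∀ Y, 0 ≤ Y → ‖mode n f t x y Y‖ ≤ C * wt n := by
  obtain ⟨A, hA⟩ := hf.bdd [] t ht x y hy
  obtain ⟨B, hB⟩ := hf.bdd [3, 3] t ht x y hy
  refine ⟨A + B, add_nonneg ((abs_nonneg _).trans (hA 0 0 le_rfl))
    ((abs_nonneg _).trans (hB 0 0 le_rfl)), fun n Y hY => ?_⟩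
  rw [mode_eq_modeAt n f t x y 0 Y]
  refine hf.per.norm_modeAt_le (perBox_domAll hT) (mem_domAll ht hy hY) ?_ ?_ n
  · intro θ
    rw [update_domAll_three]; exact hA θ Y hY
  · intro θ
    rw [update_domAll_three]; exact hB θ Y hY

theorem IsReg.hasDerivWithinAt_mode (hT : 0 < T) {f : (Fin 5 → ℝ) → ℝ} (hf : IsReg T f)
    {t x y Y : ℝ} (ht : t ∈ Icc 0 T) (hy : 0 ≤ y) (hY : 0 ≤ Y) (n : ℤ) :
    HasDerivWithinAt (fun s => mode n f t x y s)
      (mode n (RayleighWave.pd (domAll T) 4 f) t x y Y) (Ici 0) Y := by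
  have h := hf.per.hasDerivWithinAt_modeAt (perBox_domAll hT)
    (mem_domAll (x := x) (θ := 0) ht hy hY) (i := 4) (by decide) n
  rw [← mode_eq_modeAt] at h
  have h2 : ∀ s, Function.update ![t, x, y, 0, Y] 4 s = ![t, x, y, 0, s] := by
    intro s; ext i; fin_cases i <;> rfl
  simp only [h2, ← mode_eq_modeAt] at h
  exact h

theorem IsReg.continuousOn_mode (hT : 0 < T) {f : (Fin 5 → ℝ) → ℝ} (hf : IsReg T f)
    {t x y : ℝ} (ht : t ∈ Icc 0 T) (hy : 0 ≤ y) (n : ℤ) :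
    ContinuousOn (fun s => mode n f t x y s) (Ici 0) := fun _ hY =>
  (hf.hasDerivWithinAt_mode hT ht hy hY n).continuousWithinAt

/-! ### Profiles -/

/-- Functions of `(t, x, y)` alone. -/
theorem isReg_of_low {a : (Fin 3 → ℝ) → ℝ} (ha : InLow T a) :
    IsReg T (fun p => a ![p 0, p 1, p 2]) := by
  -- All iterated derivatives still depend on (t, x, y) only, so for fixed (t, x, y) they are
  -- constant in the fast variables and therefore bounded.
  have hind : ∀ l : List (Fin 5), ∀ p p' : Fin 5 → ℝ, p 0 = p' 0 → p 1 = p' 1 → p 2 = p' 2 →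
      iterPd (domAll T) l (fun p => a ![p 0, p 1, p 2]) p
        = iterPd (domAll T) l (fun p => a ![p 0, p 1, p 2]) p' := by
    intro l
    induction l with
    | nil => intro p p' h0 h1 h2; simp [iterPd, h0, h1, h2]
    | cons i l ih =>
      intro p p' h0 h1 h2
      change derivWithin _ _ _ = derivWithin _ _ _
      have hs : (fun s => iterPd (domAll T) l (fun p => a ![p 0, p 1, p 2]) (Function.update p i s))
          = fun s => iterPd (domAll T) l (fun p => a ![p 0, p 1, p 2]) (Function.update p' i s) :=
        funext fun s => ih _ _ (by simp [Function.update_apply, h0])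
          (by simp [Function.update_apply, h1]) (by simp [Function.update_apply, h2])
      have hconst : (i = 3 ∨ i = 4) → ∀ q : Fin 5 → ℝ, ∀ s s' : ℝ,
          iterPd (domAll T) l (fun p => a ![p 0, p 1, p 2]) (Function.update q i s)
          = iterPd (domAll T) l (fun p => a ![p 0, p 1, p 2]) (Function.update q i s') := by
        rintro (rfl | rfl) q s s' <;>
        exact ih _ _ (by simp) (by simp) (by simp)
      have hzero : (i = 3 ∨ i = 4) → ∀ q : Fin 5 → ℝ, ∀ z : ℝ, derivWithin
          (fun s => iterPd (domAll T) l (fun p => a ![p 0, p 1, p 2]) (Function.update q i s))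
          (domAll T i) z = 0 := by
        intro hi q z
        rw [funext fun s => hconst hi q s 0]
        simp
      refine (congrArg (fun φ => derivWithin φ (domAll T i) (p i)) hs).trans ?_
      change derivWithin (fun s => iterPd (domAll T) l (fun p => a ![p 0, p 1, p 2]) (Function.update p' i s)) _ _ = derivWithin (fun s => iterPd (domAll T) l (fun p => a ![p 0, p 1, p 2]) (Function.update p' i s)) _ _
      fin_cases i
      · exact congrArg _ h0
      · exact congrArg _ h1
      · exact congrArg _ h2
      · rw [hzero (Or.inl rfl), hzero (Or.inl rfl)]
      · rw [hzero (Or.inr rfl), hzero (Or.inr rfl)]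
  refine ⟨⟨?_, fun p _ => ?_⟩, fun l t _ x y _ => ?_⟩
  · refine ha.1.comp (f := fun p : Fin 5 → ℝ => ![p 0, p 1, p 2]) ?_ ?_
    · refine ContDiff.contDiffOn (contDiff_pi.mpr fun i => ?_)
      fin_cases i
      · exact contDiff_apply ℝ ℝ 0
      · exact contDiff_apply ℝ ℝ 1
      · exact contDiff_apply ℝ ℝ 2
    · intro p hp i _
      fin_cases i
      · exact hp 0 trivial
      · exact hp 1 trivial
      · exact hp 2 trivial
  · simp
  · refine ⟨|iterPd (domAll T) l (fun p => a ![p 0, p 1, p 2]) ![t, x, y, 0, 0]|,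
      fun θ Y _ => ?_⟩
    rw [hind l ![t, x, y, θ, Y] ![t, x, y, 0, 0] rfl rfl rfl]

/-- The space only controls L² norms in x; the one-dimensional Sobolev inequality, applied to a
derivative and its x-derivative, turns them into pointwise bounds. -/
theorem InSurf.exists_bound (hT : 0 < T) {a : (Fin 4 → ℝ) → ℝ} (ha : InSurf T a)
    (l : List (Fin 4)) : ∃ C, ∀ t ∈ Icc 0 T, ∀ x θ Y : ℝ, 0 ≤ Y →
      |iterPd (domSurf T) l a ![t, x, θ, Y]| ≤ C := by
  obtain ⟨⟨hsm, -⟩, -, δ, hδ, hdec⟩ := ha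
  obtain ⟨A, hA⟩ := hdec l
  obtain ⟨B, hB⟩ := hdec (1 :: l)
  have hD := (perBox_domSurf hT).uniq
  have hbound : ∀ (C : ℝ) (Y : ℝ), 0 ≤ Y →
      ENNReal.ofReal (C * Real.exp (-δ * Y)) ≤ ENNReal.ofReal |C| := by
    intro C Y hY
    refine ENNReal.ofReal_le_ofReal ?_
    calc C * Real.exp (-δ * Y) ≤ |C| * Real.exp (-δ * Y) := by gcongr; exact le_abs_self C
      _ ≤ |C| * 1 := by
        gcongr
        rw [Real.exp_le_one_iff]
        nlinarith
      _ = |C| := mul_one _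
  refine ⟨|A| + |B|, fun t ht x θ Y hY => ?_⟩
  have hup : ∀ z s : ℝ, Function.update ![t, z, θ, Y] 1 s = ![t, s, θ, Y] := by
    intro z s; ext i; fin_cases i <;> rfl
  refine abs_le_of_eLpNorm_le (h := fun x => iterPd (domSurf T) l a ![t, x, θ, Y])
    (h' := fun x => iterPd (domSurf T) (1 :: l) a ![t, x, θ, Y]) ?_ ?_ (abs_nonneg A)
    (abs_nonneg B) ((hA t ht θ Y hY).trans (hbound A Y hY))
    ((hB t ht θ Y hY).trans (hbound B Y hY)) x
  · intro z
    have h := hasDerivWithinAt_update (contDiffOn_iterPd hD hsm l)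
      (mem_domSurf (x := z) (θ := θ) ht hY) 1
    simp only [hup] at h
    exact hasDerivWithinAt_univ.mp h
  · have hc : Continuous fun z : ℝ => (![t, z, θ, Y] : Fin 4 → ℝ) := by
      refine continuous_pi fun i => ?_
      fin_cases i
      · exact continuous_const
      · exact continuous_id
      · exact continuous_const
      · exact continuous_const
    exact (contDiffOn_iterPd hD hsm (1 :: l)).continuousOn.comp_continuous hc
      fun z => mem_domSurf ht hY

/-- Surface parts of profiles. -/
theorem isReg_of_surf (hT : 0 < T) {a : (Fin 4 → ℝ) → ℝ} (ha : InSurf T a) :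
    IsReg T (fun p => a ![p 0, p 1, p 3, p 4]) := by
  -- A derivative in one of the five variables is either a derivative in one of the four surface
  -- variables or, for y, zero.
  have hpd : ∀ g : (Fin 4 → ℝ) → ℝ, ∀ i : Fin 5,
      (∃ i' : Fin 4, pd (domAll T) i (fun p => g ![p 0, p 1, p 3, p 4])
        = fun p => pd (domSurf T) i' g ![p 0, p 1, p 3, p 4]) ∨
      pd (domAll T) i (fun p => g ![p 0, p 1, p 3, p 4]) = fun _ => 0 := by
    intro g i
    have key : ∀ i' : Fin 4, domAll T i = domSurf T i' →
        (∀ (p : Fin 5 → ℝ), ![p 0, p 1, p 3, p 4] i' = p i) →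
        (∀ (p : Fin 5 → ℝ) (s : ℝ), ![Function.update p i s 0, Function.update p i s 1,
          Function.update p i s 3, Function.update p i s 4]
          = Function.update ![p 0, p 1, p 3, p 4] i' s) →
        pd (domAll T) i (fun p => g ![p 0, p 1, p 3, p 4])
          = fun p => pd (domSurf T) i' g ![p 0, p 1, p 3, p 4] := by
      intro i' h1 h2 h3
      funext p
      simp only [pd, h3, h2, h1]
    fin_cases i
    · refine Or.inl ⟨0, key 0 rfl (fun p => rfl) fun p s => ?_⟩
      ext i; fin_cases i <;> rfl
    · refine Or.inl ⟨1, key 1 rfl (fun p => rfl) fun p s => ?_⟩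
      ext i; fin_cases i <;> rfl
    · right
      funext p
      refine pd_eq_zero_of_update fun s => ?_
      simp
    · refine Or.inl ⟨2, key 2 rfl (fun p => rfl) fun p s => ?_⟩
      ext i; fin_cases i <;> rfl
    · refine Or.inl ⟨3, key 3 rfl (fun p => rfl) fun p s => ?_⟩
      ext i; fin_cases i <;> rfl
  have hit : ∀ l : List (Fin 5), (∃ l' : List (Fin 4),
      iterPd (domAll T) l (fun p => a ![p 0, p 1, p 3, p 4])
        = fun p => iterPd (domSurf T) l' a ![p 0, p 1, p 3, p 4]) ∨
      iterPd (domAll T) l (fun p => a ![p 0, p 1, p 3, p 4]) = fun _ => 0 := by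
    intro l
    induction l with
    | nil => exact Or.inl ⟨[], rfl⟩
    | cons i l ih =>
      have hcons : iterPd (domAll T) (i :: l) (fun p => a ![p 0, p 1, p 3, p 4])
        = pd (domAll T) i (iterPd (domAll T) l fun p => a ![p 0, p 1, p 3, p 4]) := rfl
      rcases ih with ⟨l', hl'⟩ | h0
      · rw [hcons, hl']
        rcases hpd (iterPd (domSurf T) l' a) i with ⟨i', hi'⟩ | h0
        · exact Or.inl ⟨i' :: l', hi'⟩
        · exact Or.inr h0
      · rw [hcons, h0]
        exact Or.inr (funext fun p => pd_const 0 i p)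
  refine ⟨⟨?_, fun p _ => ?_⟩, fun l t ht x y hy => ?_⟩
  · refine ha.1.1.comp (f := fun p : Fin 5 → ℝ => ![p 0, p 1, p 3, p 4]) ?_ ?_
    · refine ContDiff.contDiffOn (contDiff_pi.mpr fun i => ?_)
      fin_cases i
      · exact contDiff_apply ℝ ℝ 0
      · exact contDiff_apply ℝ ℝ 1
      · exact contDiff_apply ℝ ℝ 3
      · exact contDiff_apply ℝ ℝ 4
    · intro p hp i _
      fin_cases i
      · exact hp 0 trivial
      · exact hp 1 trivial
      · exact hp 3 trivial
      · exact hp 4 trivial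
  · exact ha.2.1 (p 0) (p 1) (p 3) (p 4)
  · rcases hit l with ⟨l', hl'⟩ | h0
    · obtain ⟨C, hC⟩ := ha.exists_bound hT l'
      exact ⟨C, fun θ Y hY => by rw [hl']; exact hC t ht x θ Y hY⟩
    · exact ⟨0, fun θ Y _ => by rw [h0]; simp⟩

theorem InS.isReg_eval (hT : 0 < T) {U : Profile} (hU : InS T U) (i : Fin 2) :
    IsReg T (U.eval i) :=
  (isReg_of_low (hU i).1).add hT (isReg_of_surf hT (hU i).2)

theorem Profile.eval_zero (i : Fin 2) : (0 : Profile).eval i = fun _ => 0 := by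
  funext p
  change (0 : ℝ) + 0 = 0
  simp

/-- Profiles both components of which are smooth and bounded in the fast variables. -/
def RegProfile (T : ℝ) (U : Profile) : Prop := ∀ i, IsReg T (U.eval i)

theorem regProfile_zero : RegProfile T 0 := fun i => by
  rw [Profile.eval_zero]; exact isReg_const 0

end

/-! ## Regularity and structure of the sources -/

section

variable {T r c : ℝ}

theorem hooke_zero : hooke r 0 = 0 := by simp [hooke]

theorem stressQ_zero_left (B : Matrix (Fin 2) (Fin 2) ℝ) : stressQ r 0 B = 0 := by
  simp [stressQ, hooke_zero]

theorem stressQ_zero_right (A : Matrix (Fin 2) (Fin 2) ℝ) : stressQ r A 0 = 0 := by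
  simp [stressQ, hooke_zero]

theorem stressC_zero_left (B D : Matrix (Fin 2) (Fin 2) ℝ) : stressC r 0 B D = 0 := by
  simp [stressC]

theorem stressC_zero_mid (A D : Matrix (Fin 2) (Fin 2) ℝ) : stressC r A 0 D = 0 := by
  simp [stressC, hooke_zero]

theorem stressC_zero_right (A B : Matrix (Fin 2) (Fin 2) ℝ) : stressC r A B 0 = 0 := by
  simp [stressC, hooke_zero]

theorem hooke_add (M N : Matrix (Fin 2) (Fin 2) ℝ) :
    hooke r (M + N) = hooke r M + hooke r N := by
  simp only [hooke, Matrix.trace_add, mul_add, add_smul, smul_add]; abel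

theorem hooke_neg (M : Matrix (Fin 2) (Fin 2) ℝ) : hooke r (-M) = -hooke r M := by
  simp only [hooke, Matrix.trace_neg, mul_neg, neg_smul, smul_neg]; abel

theorem hooke_sub (M N : Matrix (Fin 2) (Fin 2) ℝ) :
    hooke r (M - N) = hooke r M - hooke r N := by
  rw [sub_eq_add_neg, hooke_add, hooke_neg, sub_eq_add_neg]

theorem stressQ_sub_right (A B B' : Matrix (Fin 2) (Fin 2) ℝ) :
    stressQ r A (B - B') = stressQ r A B - stressQ r A B' := by
  have h1 : (1 / 2 : ℝ) • (Aᵀ * (B - B')) = (1 / 2 : ℝ) • (Aᵀ * B) - (1 / 2 : ℝ) • (Aᵀ * B') := by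
    rw [mul_sub, smul_sub]
  have h2 : (1 / 2 : ℝ) • (B - B' + (B - B')ᵀ)
      = (1 / 2 : ℝ) • (B + Bᵀ) - (1 / 2 : ℝ) • (B' + B'ᵀ) := by
    rw [Matrix.transpose_sub, ← smul_sub]; congr 1; abel
  simp only [stressQ]
  rw [h1, h2, hooke_sub, hooke_sub, mul_sub]; abel

theorem stressQ_sub_left (A A' B : Matrix (Fin 2) (Fin 2) ℝ) :
    stressQ r (A - A') B = stressQ r A B - stressQ r A' B := by
  have h1 : (1 / 2 : ℝ) • ((A - A')ᵀ * B) = (1 / 2 : ℝ) • (Aᵀ * B) - (1 / 2 : ℝ) • (A'ᵀ * B) := by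
    rw [Matrix.transpose_sub, sub_mul, smul_sub]
  simp only [stressQ]
  rw [h1, hooke_sub, sub_mul]; abel

theorem grad_zero (s : Fin 2) (p : Fin 5 → ℝ) : grad T s 0 p = 0 := by
  ext i j
  simp only [grad, Matrix.of_apply, Profile.eval_zero, pd_const, Matrix.zero_apply]

/-- Matrix functions with regular entries. -/
def RegMat (T : ℝ) (A : (Fin 5 → ℝ) → Matrix (Fin 2) (Fin 2) ℝ) : Prop :=
  ∀ i j, IsReg T (fun p => A p i j)

theorem RegMat.transpose {A : (Fin 5 → ℝ) → Matrix (Fin 2) (Fin 2) ℝ} (hA : RegMat T A) :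
    RegMat T (fun p => (A p)ᵀ) := fun i j => hA j i

theorem RegMat.add (hT : 0 < T) {A B : (Fin 5 → ℝ) → Matrix (Fin 2) (Fin 2) ℝ}
    (hA : RegMat T A) (hB : RegMat T B) : RegMat T (fun p => A p + B p) :=
  fun i j => (hA i j).add hT (hB i j)

theorem RegMat.smul (hT : 0 < T) {A : (Fin 5 → ℝ) → Matrix (Fin 2) (Fin 2) ℝ} (hA : RegMat T A)
    (a : ℝ) : RegMat T (fun p => a • A p) := fun i j => (hA i j).const_mul hT a

theorem RegMat.mul (hT : 0 < T) {A B : (Fin 5 → ℝ) → Matrix (Fin 2) (Fin 2) ℝ}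
    (hA : RegMat T A) (hB : RegMat T B) : RegMat T (fun p => A p * B p) := fun i j => by
  simp only [Matrix.mul_apply]
  exact IsReg.sum hT _ fun k _ => (hA i k).mul hT (hB k j)

theorem RegMat.hooke (hT : 0 < T) {A : (Fin 5 → ℝ) → Matrix (Fin 2) (Fin 2) ℝ}
    (hA : RegMat T A) : RegMat T (fun p => hooke r (A p)) := fun i j => by
  simp only [RayleighWave.hooke, Matrix.add_apply, Matrix.smul_apply, smul_eq_mul, Matrix.trace,
    Matrix.diag]
  refine IsReg.add hT (IsReg.mul hT (IsReg.const_mul hT (IsReg.sum hT _ fun k _ => hA k k) _)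
    (isReg_const _)) (IsReg.const_mul hT (hA i j) 2)

theorem RegMat.stressQ (hT : 0 < T) {A B : (Fin 5 → ℝ) → Matrix (Fin 2) (Fin 2) ℝ}
    (hA : RegMat T A) (hB : RegMat T B) : RegMat T (fun p => stressQ r (A p) (B p)) :=
  RegMat.add hT (RegMat.hooke hT ((hA.transpose.mul hT hB).smul hT _))
    (hA.mul hT (RegMat.hooke hT ((hB.add hT hB.transpose).smul hT _)))

theorem RegMat.stressC (hT : 0 < T) {A B D : (Fin 5 → ℝ) → Matrix (Fin 2) (Fin 2) ℝ}
    (hA : RegMat T A) (hB : RegMat T B) (hD : RegMat T D) :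
    RegMat T (fun p => stressC r (A p) (B p) (D p)) :=
  hA.mul hT (RegMat.hooke hT ((hB.transpose.mul hT hD).smul hT _))

theorem RegProfile.grad (hT : 0 < T) {U : Profile} (hU : RegProfile T U) (s : Fin 2) :
    RegMat T (grad T s U) := fun i j => (hU i).pd hT (spatial s j)

theorem RegProfile.pd2 (hT : 0 < T) {U : Profile} (hU : RegProfile T U) (i j : Fin 5)
    (a : Fin 2) : IsReg T (pd2 T i j U a) := ((hU a).pd hT j).pd hT i

theorem RegProfile.opLfs (hT : 0 < T) {U : Profile} (hU : RegProfile T U) (i : Fin 2) :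
    IsReg T (opLfs T r c U i) :=
  ((((hU.pd2 hT 0 3 i).const_mul hT _).sub hT ((hU.pd2 hT 1 3 i).const_mul hT _)).sub hT
    (((hU.pd2 hT 1 4 (1 - i)).add hT (hU.pd2 hT 2 3 (1 - i))).const_mul hT _)).sub hT
    ((hU.pd2 hT 2 4 i).const_mul hT _)

theorem RegProfile.opLss (hT : 0 < T) {U : Profile} (hU : RegProfile T U) (i : Fin 2) :
    IsReg T (opLss T r U i) :=
  (((hU.pd2 hT 0 0 i).sub hT ((hU.pd2 hT 1 1 i).const_mul hT _)).sub hT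
    ((hU.pd2 hT 1 2 (1 - i)).const_mul hT _)).sub hT ((hU.pd2 hT 2 2 i).const_mul hT _)

theorem RegProfile.opls (hT : 0 < T) {U : Profile} (hU : RegProfile T U) (i : Fin 2) :
    IsReg T (opls T r U i) :=
  (((hU (1 - i)).pd hT 1).const_mul hT _).add hT (((hU i).pd hT 2).const_mul hT _)

/-- The quadratic part of the interior source. -/
def quadInt (T r : ℝ) (U : ℕ → Profile) (m : ℕ) (i : Fin 2) (p : Fin 5 → ℝ) : ℝ :=
  ∑ s : Fin 3 → Fin 2, ∑ e ∈ Finset.HasAntidiagonal.antidiagonal (m - 1 + ∑ a, (s a : ℕ)),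
    ∑ j : Fin 2, pd (domAll T) (spatial (s 2) j)
      (fun p' => stressQ r (grad T (s 0) (U e.1) p') (grad T (s 1) (U e.2) p') i j) p

/-- The cubic part of the interior source. -/
def cubInt (T r : ℝ) (U : ℕ → Profile) (m : ℕ) (i : Fin 2) (p : Fin 5 → ℝ) : ℝ :=
  ∑ s : Fin 4 → Fin 2, ∑ e ∈ Finset.Nat.antidiagonalTuple 3 (m - 1 + ∑ a, (s a : ℕ)),
    ∑ j : Fin 2, pd (domAll T) (spatial (s 3) j)
      (fun p' => stressC r (grad T (s 0) (U (e 0)) p') (grad T (s 1) (U (e 1)) p')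
        (grad T (s 2) (U (e 2)) p') i j) p

theorem srcInt_eq (U : ℕ → Profile) (m : ℕ) (i : Fin 2) (p : Fin 5 → ℝ) :
    srcInt T r c U m i p = -opLfs T r c (U m) i p - opLss T r (U (m - 1)) i p
      + quadInt T r U m i p + cubInt T r U m i p := rfl

/-- The quadratic part of the boundary source. -/
def quadBd (T r : ℝ) (U : ℕ → Profile) (m : ℕ) (i : Fin 2) (p : Fin 5 → ℝ) : ℝ :=
  ∑ s : Fin 2 → Fin 2, ∑ e ∈ Finset.HasAntidiagonal.antidiagonal (m + ∑ a, (s a : ℕ)),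
    stressQ r (grad T (s 0) (U e.1) p) (grad T (s 1) (U e.2) p) i 1

/-- The cubic part of the boundary source. -/
def cubBd (T r : ℝ) (U : ℕ → Profile) (m : ℕ) (i : Fin 2) (p : Fin 5 → ℝ) : ℝ :=
  ∑ s : Fin 3 → Fin 2, ∑ e ∈ Finset.Nat.antidiagonalTuple 3 (m + ∑ a, (s a : ℕ)),
    stressC r (grad T (s 0) (U (e 0)) p) (grad T (s 1) (U (e 1)) p)
      (grad T (s 2) (U (e 2)) p) i 1

/-- The part of the boundary source that depends on the profiles. -/
def srcBdPart (T r : ℝ) (U : ℕ → Profile) (m : ℕ) (i : Fin 2) (p : Fin 5 → ℝ) : ℝ :=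
  -opls T r (U m) i p - quadBd T r U m i p - cubBd T r U m i p

theorem srcBd_eq (F : Fin 2 → (Fin 3 → ℝ) → ℝ) (U : ℕ → Profile) (m : ℕ) (i : Fin 2)
    (p : Fin 5 → ℝ) :
    srcBd T r F U m i p = srcBdPart T r U m i p + if m = 2 then F i ![p 0, p 1, p 3] else 0 := rfl

theorem isReg_srcInt (hT : 0 < T) {U : ℕ → Profile} (hU : ∀ j, RegProfile T (U j)) (m : ℕ)
    (i : Fin 2) : IsReg T (srcInt T r c U m i) := by
  have hq : IsReg T (quadInt T r U m i) :=
    IsReg.sum hT _ fun s _ => IsReg.sum hT _ fun e _ => IsReg.sum hT _ fun j _ =>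
      IsReg.pd hT (RegMat.stressQ hT ((hU e.1).grad hT _) ((hU e.2).grad hT _) i j) _
  have hc : IsReg T (cubInt T r U m i) :=
    IsReg.sum hT _ fun s _ => IsReg.sum hT _ fun e _ => IsReg.sum hT _ fun j _ =>
      IsReg.pd hT (RegMat.stressC hT ((hU (e 0)).grad hT _) ((hU (e 1)).grad hT _)
        ((hU (e 2)).grad hT _) i j) _
  exact ((((hU m).opLfs hT i).neg hT |>.sub hT ((hU (m - 1)).opLss hT i)).add hT hq).add hT hc

theorem isReg_srcBdPart (hT : 0 < T) {U : ℕ → Profile} (hU : ∀ j, RegProfile T (U j)) (m : ℕ)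
    (i : Fin 2) : IsReg T (srcBdPart T r U m i) := by
  have hq : IsReg T (quadBd T r U m i) :=
    IsReg.sum hT _ fun s _ => IsReg.sum hT _ fun e _ =>
      RegMat.stressQ hT ((hU e.1).grad hT _) ((hU e.2).grad hT _) i 1
  have hc : IsReg T (cubBd T r U m i) :=
    IsReg.sum hT _ fun s _ => IsReg.sum hT _ fun e _ =>
      RegMat.stressC hT ((hU (e 0)).grad hT _) ((hU (e 1)).grad hT _)
        ((hU (e 2)).grad hT _) i 1
  exact (((hU m).opls hT i).neg hT |>.sub hT hq).sub hT hc

/-! ### Dependence on the profiles -/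

theorem sum_val_le {q : ℕ} (s : Fin q → Fin 2) : ∑ a, (s a : ℕ) ≤ q := by
  calc ∑ a, (s a : ℕ) ≤ ∑ _a : Fin q, 1 := Finset.sum_le_sum fun a _ => by omega
    _ = q := by simp

theorem sum_val_lt {q : ℕ} {s : Fin q → Fin 2} (hs : s ≠ fun _ => 1) :
    ∑ a, (s a : ℕ) < q := by
  obtain ⟨a, ha⟩ := Function.ne_iff.mp hs
  calc ∑ a, (s a : ℕ) < ∑ _a : Fin q, 1 :=
        Finset.sum_lt_sum (fun a _ => by omega) ⟨a, Finset.mem_univ a, by omega⟩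
    _ = q := by simp

theorem mem_tuple_three {e : Fin 3 → ℕ} {N : ℕ} (he : e ∈ Finset.Nat.antidiagonalTuple 3 N) :
    e 0 + e 1 + e 2 = N := by
  rw [Finset.Nat.mem_antidiagonalTuple, Fin.sum_univ_three] at he
  exact he

/-- The quadratic and cubic terms vanish if one of the indices is less than two. -/
theorem quad_vanish {U : ℕ → Profile} (h0 : ∀ j < 2, U j = 0) {e : ℕ × ℕ}
    (he : e.1 < 2 ∨ e.2 < 2) (s s' : Fin 2) (p : Fin 5 → ℝ) :
    stressQ r (grad T s (U e.1) p) (grad T s' (U e.2) p) = 0 := by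
  rcases he with h | h
  · rw [h0 _ h, grad_zero, stressQ_zero_left]
  · rw [h0 _ h, grad_zero, stressQ_zero_right]

theorem cubic_vanish {U : ℕ → Profile} (h0 : ∀ j < 2, U j = 0) {e : Fin 3 → ℕ}
    (he : e 0 < 2 ∨ e 1 < 2 ∨ e 2 < 2) (s s' s'' : Fin 2) (p : Fin 5 → ℝ) :
    stressC r (grad T s (U (e 0)) p) (grad T s' (U (e 1)) p) (grad T s'' (U (e 2)) p) = 0 := by
  rcases he with h | h | h
  · rw [h0 _ h, grad_zero, stressC_zero_left]
  · rw [h0 _ h, grad_zero, stressC_zero_mid]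
  · rw [h0 _ h, grad_zero, stressC_zero_right]

/-- The two indices add up to at most m + 2 when m ≥ 1. Nonzero terms have both at least 2, so
neither exceeds m. -/
theorem quadInt_congr {U U' : ℕ → Profile} (h0 : ∀ j < 2, U j = 0) (h0' : ∀ j < 2, U' j = 0)
    {m : ℕ} (h : ∀ j ≤ m, U j = U' j) : quadInt T r U m = quadInt T r U' m := by
  funext i p
  refine Finset.sum_congr rfl fun s _ => Finset.sum_congr rfl fun e he =>
    Finset.sum_congr rfl fun j _ => ?_
  have hs := sum_val_le s
  have he' := Finset.HasAntidiagonal.mem_antidiagonal.mp he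
  by_cases hv : e.1 < 2 ∨ e.2 < 2
  · simp only [quad_vanish h0 hv, quad_vanish h0' hv]
  · rw [h e.1 (by omega), h e.2 (by omega)]

/-- The three indices add up to at most m + 3 when m ≥ 1, and in nonzero terms each is at least 2,
so each is less than m: cubic terms never see the top level. -/
theorem cubInt_congr {U U' : ℕ → Profile} (h0 : ∀ j < 2, U j = 0) (h0' : ∀ j < 2, U' j = 0)
    {m : ℕ} (h : ∀ j < m, U j = U' j) : cubInt T r U m = cubInt T r U' m := by
  funext i p
  refine Finset.sum_congr rfl fun s _ => Finset.sum_congr rfl fun e he =>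
    Finset.sum_congr rfl fun j _ => ?_
  have hs := sum_val_le s
  have he' := mem_tuple_three he
  by_cases hv : e 0 < 2 ∨ e 1 < 2 ∨ e 2 < 2
  · simp only [cubic_vanish h0 hv, cubic_vanish h0' hv]
  · rw [h (e 0) (by omega), h (e 1) (by omega), h (e 2) (by omega)]

theorem quadBd_congr {U U' : ℕ → Profile} (h0 : ∀ j < 2, U j = 0) (h0' : ∀ j < 2, U' j = 0)
    {m : ℕ} (h : ∀ j ≤ m, U j = U' j) : quadBd T r U m = quadBd T r U' m := by
  funext i p
  refine Finset.sum_congr rfl fun s _ => Finset.sum_congr rfl fun e he => ?_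
  have hs := sum_val_le s
  have he' := Finset.HasAntidiagonal.mem_antidiagonal.mp he
  by_cases hv : e.1 < 2 ∨ e.2 < 2
  · rw [quad_vanish h0 hv, quad_vanish h0' hv]
  · rw [h e.1 (by omega), h e.2 (by omega)]

theorem cubBd_congr {U U' : ℕ → Profile} (h0 : ∀ j < 2, U j = 0) (h0' : ∀ j < 2, U' j = 0)
    {m : ℕ} (h : ∀ j < m, U j = U' j) : cubBd T r U m = cubBd T r U' m := by
  funext i p
  refine Finset.sum_congr rfl fun s _ => Finset.sum_congr rfl fun e he => ?_
  have hs := sum_val_le s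
  have he' := mem_tuple_three he
  by_cases hv : e 0 < 2 ∨ e 1 < 2 ∨ e 2 < 2
  · rw [cubic_vanish h0 hv, cubic_vanish h0' hv]
  · rw [h (e 0) (by omega), h (e 1) (by omega), h (e 2) (by omega)]

theorem srcInt_congr {U U' : ℕ → Profile} (h0 : ∀ j < 2, U j = 0) (h0' : ∀ j < 2, U' j = 0)
    {m : ℕ} (h : ∀ j ≤ m, U j = U' j) : srcInt T r c U m = srcInt T r c U' m := by
  funext i p
  rw [srcInt_eq, srcInt_eq, quadInt_congr h0 h0' h, cubInt_congr h0 h0' fun j hj => h j hj.le,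
    h m le_rfl, h (m - 1) (Nat.sub_le m 1)]

theorem srcBdPart_congr {U U' : ℕ → Profile} (h0 : ∀ j < 2, U j = 0) (h0' : ∀ j < 2, U' j = 0)
    {m : ℕ} (h : ∀ j ≤ m, U j = U' j) : srcBdPart T r U m = srcBdPart T r U' m := by
  funext i p
  rw [srcBdPart, srcBdPart, quadBd_congr h0 h0' h, cubBd_congr h0 h0' fun j hj => h j hj.le,
    h m le_rfl]

theorem srcMod_congr {U U' : ℕ → Profile} (h0 : ∀ j < 2, U j = 0) (h0' : ∀ j < 2, U' j = 0)
    {m : ℕ} (h : ∀ j ≤ m, U j = U' j) : srcMod T r c U m = srcMod T r c U' m := by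
  funext n i t x Y
  simp only [srcMod]
  refine Finset.sum_congr rfl fun j _ => ?_
  rw [srcInt_congr h0 h0' fun a ha => h a (ha.trans (Nat.sub_le m j))]

/-- A double sum over multi-indices and exponents reduced to its top order terms. -/
theorem sum_top_order {q N k : ℕ} (hk : 3 ≤ k) (hN : N + q = k + 2)
    (X : (Fin q → Fin 2) → ℕ × ℕ → ℝ)
    (hX : ∀ s e, (e.1 < 2 ∨ e.2 < 2 ∨ (e.1 < k ∧ e.2 < k)) → X s e = 0) :
    ∑ s : Fin q → Fin 2, ∑ e ∈ Finset.HasAntidiagonal.antidiagonal (N + ∑ a, (s a : ℕ)), X s e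
      = X (fun _ => 1) (2, k) + X (fun _ => 1) (k, 2) := by
  -- If some derivative is slow, the indices add up to at most k + 1, and two indices that are at
  -- least 2 are then both less than k. With fast derivatives only, the total is k + 2 and the pairs
  -- (2, k) and (k, 2) survive.
  rw [Finset.sum_eq_single (fun _ => 1)]
  · have hsum : N + ∑ a : Fin q, (((fun _ => 1 : Fin q → Fin 2) a : Fin 2) : ℕ) = k + 2 := by
      simp [hN]
    rw [hsum, ← Finset.sum_pair (f := X fun _ => 1) (a := (2, k)) (b := (k, 2))]
    · symm
      refine Finset.sum_subset ?_ ?_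
      · intro e he
        simp only [Finset.mem_insert, Finset.mem_singleton] at he
        rw [Finset.HasAntidiagonal.mem_antidiagonal]
        rcases he with rfl | rfl
        · simp [Nat.add_comm]
        · simp
      · intro e he hne
        rw [Finset.HasAntidiagonal.mem_antidiagonal] at he
        simp only [Finset.mem_insert, Finset.mem_singleton, not_or, Prod.ext_iff] at hne
        exact hX _ _ (by omega)
    · simp only [ne_eq, Prod.mk.injEq, not_and]; omega
  · intro s _ hs
    refine Finset.sum_eq_zero fun e he => hX _ _ ?_
    have := sum_val_lt hs
    rw [Finset.HasAntidiagonal.mem_antidiagonal] at he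
    omega
  · simp

theorem sum_top_order_two {q N : ℕ} (hN : N + q = 4)
    (X : (Fin q → Fin 2) → ℕ × ℕ → ℝ) (hX : ∀ s e, (e.1 < 2 ∨ e.2 < 2) → X s e = 0) :
    ∑ s : Fin q → Fin 2, ∑ e ∈ Finset.HasAntidiagonal.antidiagonal (N + ∑ a, (s a : ℕ)), X s e
      = X (fun _ => 1) (2, 2) := by
  rw [Finset.sum_eq_single (fun _ => 1)]
  · have hsum : N + ∑ a : Fin q, (((fun _ => 1 : Fin q → Fin 2) a : Fin 2) : ℕ) = 4 := by
      simp [hN]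
    rw [hsum, Finset.sum_eq_single (2, 2)]
    · intro e he hne
      rw [Finset.HasAntidiagonal.mem_antidiagonal] at he
      rw [ne_eq, Prod.ext_iff] at hne
      exact hX _ _ (by simp only at hne; omega)
    · simp
  · intro s _ hs
    refine Finset.sum_eq_zero fun e he => hX _ _ ?_
    have := sum_val_lt hs
    rw [Finset.HasAntidiagonal.mem_antidiagonal] at he
    omega
  · simp

/-- The difference of two profiles. -/
def Profile.diff (U V : Profile) : Profile := ⟨fun i p => U.low i p - V.low i p,
  fun i p => U.surf i p - V.surf i p⟩

theorem Profile.eval_diff (U V : Profile) (i : Fin 2) :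
    (U.diff V).eval i = fun p => U.eval i p - V.eval i p := by
  funext p
  simp only [Profile.eval, Profile.diff]; ring

theorem RegProfile.diff (hT : 0 < T) {U V : Profile} (hU : RegProfile T U)
    (hV : RegProfile T V) : RegProfile T (U.diff V) := fun i => by
  rw [Profile.eval_diff]; exact (hU i).sub hT (hV i)

theorem pd_eval_diff (hT : 0 < T) {U V : Profile} (hU : RegProfile T U) (hV : RegProfile T V)
    (i : Fin 5) (a : Fin 2) : EqOn (pd (domAll T) i ((U.diff V).eval a))
      (fun p => pd (domAll T) i (U.eval a) p - pd (domAll T) i (V.eval a) p)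
      (univ.pi (domAll T)) := by
  rw [Profile.eval_diff]
  exact pd_sub (perBox_domAll hT).uniq (hU a).per.smooth (hV a).per.smooth i

theorem pd2_diff (hT : 0 < T) {U V : Profile} (hU : RegProfile T U) (hV : RegProfile T V)
    (i j : Fin 5) (a : Fin 2) : EqOn (pd2 T i j (U.diff V) a)
      (fun p => pd2 T i j U a p - pd2 T i j V a p) (univ.pi (domAll T)) := by
  intro p hp
  simp only [pd2]
  rw [pd_congr (pd_eval_diff hT hU hV j a) i hp]
  exact pd_sub (perBox_domAll hT).uniq ((hU a).pd hT j).per.smooth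
    ((hV a).pd hT j).per.smooth i hp

theorem grad_diff (hT : 0 < T) {U V : Profile} (hU : RegProfile T U) (hV : RegProfile T V)
    (s : Fin 2) : EqOn (grad T s (U.diff V)) (fun p => grad T s U p - grad T s V p)
      (univ.pi (domAll T)) := by
  intro p hp
  ext i j
  exact pd_eval_diff hT hU hV _ i hp

theorem opLfs_diff (hT : 0 < T) {U V : Profile} (hU : RegProfile T U) (hV : RegProfile T V)
    (i : Fin 2) : EqOn (opLfs T r c (U.diff V) i)
      (fun p => opLfs T r c U i p - opLfs T r c V i p) (univ.pi (domAll T)) := by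
  intro p hp
  simp only [opLfs, pd2_diff hT hU hV _ _ _ hp]; ring

theorem opls_diff (hT : 0 < T) {U V : Profile} (hU : RegProfile T U) (hV : RegProfile T V)
    (i : Fin 2) : EqOn (opls T r (U.diff V) i)
      (fun p => opls T r U i p - opls T r V i p) (univ.pi (domAll T)) := by
  intro p hp
  simp only [opls, pd_eval_diff hT hU hV _ _ hp]; ring

/-- The stress of the interaction of two profiles, to leading order. -/
def crossQ (T r : ℝ) (P D : Profile) (i j : Fin 2) (p : Fin 5 → ℝ) : ℝ :=
  stressQ r (grad T 1 P p) (grad T 1 D p) i j + stressQ r (grad T 1 D p) (grad T 1 P p) i j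

theorem isReg_crossQ (hT : 0 < T) {P D : Profile} (hP : RegProfile T P) (hD : RegProfile T D)
    (i j : Fin 2) : IsReg T (crossQ T r P D i j) :=
  IsReg.add hT (RegMat.stressQ hT (hP.grad hT 1) (hD.grad hT 1) i j)
    (RegMat.stressQ hT (hD.grad hT 1) (hP.grad hT 1) i j)

theorem crossQ_diff (hT : 0 < T) {P U V : Profile} (hU : RegProfile T U)
    (hV : RegProfile T V) (i j : Fin 2) : EqOn (crossQ T r P (U.diff V) i j)
      (fun p => crossQ T r P U i j p - crossQ T r P V i j p) (univ.pi (domAll T)) := by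
  intro p hp
  simp only [crossQ, grad_diff hT hU hV 1 hp, stressQ_sub_left, stressQ_sub_right,
    Matrix.sub_apply]
  ring

/-- The source terms that contain the difference of two profiles of the same level. -/
def linInt (T r c : ℝ) (P D : Profile) (a : ℝ) (i : Fin 2) (p : Fin 5 → ℝ) : ℝ :=
  -opLfs T r c D i p + a * ∑ j : Fin 2, pd (domAll T) (spatial 1 j) (crossQ T r P D i j) p

/-- The boundary counterpart of `linInt`. -/
def linBd (T r : ℝ) (P D : Profile) (a : ℝ) (i : Fin 2) (p : Fin 5 → ℝ) : ℝ :=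
  -opls T r D i p - a * crossQ T r P D i 1 p

/-! ### The sources of level two, and differences of sources of higher levels -/

theorem cubInt_two {U : ℕ → Profile} (h0 : ∀ j < 2, U j = 0) (i : Fin 2) (p : Fin 5 → ℝ) :
    cubInt T r U 2 i p = 0 := by
  refine Finset.sum_eq_zero fun s _ => Finset.sum_eq_zero fun e he =>
    Finset.sum_eq_zero fun j _ => ?_
  have he' := mem_tuple_three he
  have hs := sum_val_le s
  -- The indices add up to at most five, so three of them cannot all reach two.
  have hv : e 0 < 2 ∨ e 1 < 2 ∨ e 2 < 2 := by omega
  simp only [cubic_vanish h0 hv, Matrix.zero_apply, pd_const]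

theorem cubBd_two {U : ℕ → Profile} (h0 : ∀ j < 2, U j = 0) (i : Fin 2) (p : Fin 5 → ℝ) :
    cubBd T r U 2 i p = 0 := by
  refine Finset.sum_eq_zero fun s _ => Finset.sum_eq_zero fun e he => ?_
  have he' := mem_tuple_three he
  have hs := sum_val_le s
  have hv : e 0 < 2 ∨ e 1 < 2 ∨ e 2 < 2 := by omega
  rw [cubic_vanish h0 hv, Matrix.zero_apply]

theorem quadInt_two {U : ℕ → Profile} (h0 : ∀ j < 2, U j = 0) (i : Fin 2) (p : Fin 5 → ℝ) :
    quadInt T r U 2 i p = ∑ j : Fin 2, pd (domAll T) (spatial 1 j)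
      (fun p' => stressQ r (grad T 1 (U 2) p') (grad T 1 (U 2) p') i j) p := by
  refine sum_top_order_two (q := 3) (N := 2 - 1) (by norm_num)
    (fun s e => ∑ j : Fin 2, pd (domAll T) (spatial (s 2) j)
        (fun p' => stressQ r (grad T (s 0) (U e.1) p') (grad T (s 1) (U e.2) p') i j) p) ?_
  intro s e hv
  refine Finset.sum_eq_zero fun j _ => ?_
  simp only [quad_vanish h0 hv, Matrix.zero_apply, pd_const]

theorem quadBd_two {U : ℕ → Profile} (h0 : ∀ j < 2, U j = 0) (i : Fin 2) (p : Fin 5 → ℝ) :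
    quadBd T r U 2 i p = stressQ r (grad T 1 (U 2) p) (grad T 1 (U 2) p) i 1 := by
  refine sum_top_order_two (q := 2) (N := 2) (by norm_num)
    (fun s e => stressQ r (grad T (s 0) (U e.1) p) (grad T (s 1) (U e.2) p) i 1) ?_
  intro s e hv
  simp only [quad_vanish h0 hv, Matrix.zero_apply]

/-- The factor 1/2 corrects for `crossQ`, which counts the interaction of a profile with itself
twice. The term L_ss drops out because U_1 = 0. -/
theorem srcInt_two {U : ℕ → Profile} (hT : 0 < T) (h0 : ∀ j < 2, U j = 0)
    (hU : RegProfile T (U 2)) (i : Fin 2) :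
    EqOn (srcInt T r c U 2 i) (linInt T r c (U 2) (U 2) (1 / 2) i) (univ.pi (domAll T)) := by
  intro p hp
  have hss : opLss T r (U (2 - 1)) i p = 0 := by
    rw [h0 (2 - 1) (by norm_num)]
    simp [opLss, pd2, Profile.eval_zero, pd_const, funext (pd_const _ _)]
  rw [srcInt_eq, hss, cubInt_two h0, quadInt_two h0, linInt, sub_zero, add_zero, Finset.mul_sum]
  congr 1
  refine Finset.sum_congr rfl fun j _ => ?_
  refine Eq.trans ?_ (pd_const_mul (perBox_domAll hT).uniq
    (isReg_crossQ hT hU hU i j).per.smooth _ _ hp)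
  refine congrArg (fun f => pd (domAll T) (spatial 1 j) f p) (funext fun p' => ?_)
  simp only [crossQ]; ring

theorem srcBdPart_two {U : ℕ → Profile} (h0 : ∀ j < 2, U j = 0) (i : Fin 2) (p : Fin 5 → ℝ) :
    srcBdPart T r U 2 i p = linBd T r (U 2) (U 2) (1 / 2) i p := by
  rw [srcBdPart, quadBd_two h0, cubBd_two h0, linBd, crossQ]; ring

/-- U_k meets only U_2, in either order, with all derivatives fast; every other term has equal
lower-level factors in U and V and cancels. -/
theorem quadInt_sub {U V : ℕ → Profile} (hT : 0 < T) (h0 : ∀ j < 2, U j = 0)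
    (h0' : ∀ j < 2, V j = 0) {k : ℕ} (hk : 3 ≤ k) (h : ∀ j < k, U j = V j)
    (hU2 : RegProfile T (U 2)) (hU : RegProfile T (U k)) (hV : RegProfile T (V k)) (i : Fin 2) :
    EqOn (fun p => quadInt T r U k i p - quadInt T r V k i p)
      (fun p => ∑ j : Fin 2, pd (domAll T) (spatial 1 j)
        (crossQ T r (U 2) ((U k).diff (V k)) i j) p) (univ.pi (domAll T)) := by
  intro p hp
  have hD := (perBox_domAll hT).uniq
  let X : (ℕ → Profile) → (Fin 3 → Fin 2) → ℕ × ℕ → ℝ := fun W s e =>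
    ∑ j : Fin 2, pd (domAll T) (spatial (s 2) j)
        (fun p' => stressQ r (grad T (s 0) (W e.1) p') (grad T (s 1) (W e.2) p') i j) p
  have hquad := sum_top_order (q := 3) (N := k - 1) hk (by omega)
    (fun s e => X U s e - X V s e) ?_
  · have hsub : quadInt T r U k i p - quadInt T r V k i p
        = ∑ s : Fin 3 → Fin 2,
          ∑ e ∈ Finset.HasAntidiagonal.antidiagonal (k - 1 + ∑ a, (s a : ℕ)),
            (X U s e - X V s e) := by
      simp only [Finset.sum_sub_distrib]; rfl
    refine (hsub.trans hquad).trans ?_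
    simp only [X]
    rw [← h 2 (by omega)]
    simp only [← Finset.sum_sub_distrib, ← Finset.sum_add_distrib]
    refine Finset.sum_congr rfl fun j _ => ?_
    have hadd : ∀ W, RegProfile T W → pd (domAll T) (spatial 1 j) (crossQ T r (U 2) W i j) p
        = pd (domAll T) (spatial 1 j)
            (fun p' => stressQ r (grad T 1 (U 2) p') (grad T 1 W p') i j) p
          + pd (domAll T) (spatial 1 j)
            (fun p' => stressQ r (grad T 1 W p') (grad T 1 (U 2) p') i j) p := fun W hW =>
      pd_add hD (RegMat.stressQ hT (hU2.grad hT 1) (hW.grad hT 1) i j).per.smooth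
        (RegMat.stressQ hT (hW.grad hT 1) (hU2.grad hT 1) i j).per.smooth _ hp
    have h1 := (pd_congr (crossQ_diff (r := r) (P := U 2) hT hU hV i j) (spatial 1 j) hp).trans
      (pd_sub hD (isReg_crossQ hT hU2 hU i j).per.smooth
        (isReg_crossQ hT hU2 hV i j).per.smooth _ hp)
    refine Eq.trans ?_ h1.symm
    simp only [hadd _ hU, hadd _ hV]
    ring
  · intro s e hv
    simp only [X, ← Finset.sum_sub_distrib]
    refine Finset.sum_eq_zero fun j _ => ?_
    by_cases hv' : e.1 < 2 ∨ e.2 < 2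
    · simp only [quad_vanish h0 hv', quad_vanish h0' hv', sub_self]
    · rw [h e.1 (by omega), h e.2 (by omega), sub_self]

theorem quadBd_sub {U V : ℕ → Profile} (hT : 0 < T) (h0 : ∀ j < 2, U j = 0)
    (h0' : ∀ j < 2, V j = 0) {k : ℕ} (hk : 3 ≤ k) (h : ∀ j < k, U j = V j)
    (hU : RegProfile T (U k)) (hV : RegProfile T (V k)) (i : Fin 2) :
    EqOn (fun p => quadBd T r U k i p - quadBd T r V k i p)
      (crossQ T r (U 2) ((U k).diff (V k)) i 1) (univ.pi (domAll T)) := by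
  intro p hp
  let X : (ℕ → Profile) → (Fin 2 → Fin 2) → ℕ × ℕ → ℝ := fun W s e =>
    stressQ r (grad T (s 0) (W e.1) p) (grad T (s 1) (W e.2) p) i 1
  have hquad := sum_top_order (q := 2) (N := k) hk (by omega)
    (fun s e => X U s e - X V s e) ?_
  · have hsub : quadBd T r U k i p - quadBd T r V k i p
        = ∑ s : Fin 2 → Fin 2,
          ∑ e ∈ Finset.HasAntidiagonal.antidiagonal (k + ∑ a, (s a : ℕ)),
            (X U s e - X V s e) := by
      simp only [Finset.sum_sub_distrib]; rfl
    refine (hsub.trans hquad).trans ?_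
    refine Eq.trans ?_ (crossQ_diff hT hU hV i 1 hp).symm
    simp only [X, crossQ]
    rw [← h 2 (by omega)]
    ring
  · intro s e hv
    simp only [X]
    by_cases hv' : e.1 < 2 ∨ e.2 < 2
    · simp only [quad_vanish h0 hv', quad_vanish h0' hv', sub_self]
    · rw [h e.1 (by omega), h e.2 (by omega), sub_self]

/-- The cubic terms and L_ss U_{k-1} involve lower levels only and cancel in the difference. -/
theorem srcInt_sub {U V : ℕ → Profile} (hT : 0 < T) (h0 : ∀ j < 2, U j = 0)
    (h0' : ∀ j < 2, V j = 0) {k : ℕ} (hk : 3 ≤ k) (h : ∀ j < k, U j = V j)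
    (hU2 : RegProfile T (U 2)) (hU : RegProfile T (U k)) (hV : RegProfile T (V k)) (i : Fin 2) :
    EqOn (fun p => srcInt T r c U k i p - srcInt T r c V k i p)
      (linInt T r c (U 2) ((U k).diff (V k)) 1 i) (univ.pi (domAll T)) := by
  intro p hp
  have h1 := quadInt_sub (r := r) hT h0 h0' hk h hU2 hU hV i hp
  have h2 := opLfs_diff (r := r) (c := c) hT hU hV i hp
  simp only [] at h1 h2
  simp only [srcInt_eq]
  rw [linInt, cubInt_congr h0 h0' h, ← h1, h2, h (k - 1) (by omega)]
  ring

theorem srcBdPart_sub {U V : ℕ → Profile} (hT : 0 < T) (h0 : ∀ j < 2, U j = 0)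
    (h0' : ∀ j < 2, V j = 0) {k : ℕ} (hk : 3 ≤ k) (h : ∀ j < k, U j = V j)
    (hU : RegProfile T (U k)) (hV : RegProfile T (V k)) (i : Fin 2) :
    EqOn (fun p => srcBdPart T r U k i p - srcBdPart T r V k i p)
      (linBd T r (U 2) ((U k).diff (V k)) 1 i) (univ.pi (domAll T)) := by
  intro p hp
  have h1 := quadBd_sub (r := r) hT h0 h0' hk h hU hV i hp
  have h2 := opls_diff (r := r) hT hU hV i hp
  simp only [] at h1 h2
  simp only [srcBdPart]
  rw [linBd, cubBd_congr h0 h0' h, ← h1, h2]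
  ring

end

/-! ## The Rayleigh mode -/

/-- The decay rate of the shear part of the Rayleigh mode. -/
def decS (c : ℝ) : ℝ := √(1 - c ^ 2)

/-- The decay rate of the pressure part of the Rayleigh mode. -/
def decP (r c : ℝ) : ℝ := √(1 - c ^ 2 / r)

/-- The assumptions on the parameters: `c` is a Rayleigh speed. -/
structure IsRayleigh (r c : ℝ) : Prop where
  one_lt : 1 < r
  pos : 0 < c
  lt_one : c < 1
  rayleigh : 2 - c ^ 2 = 2 * qR r c

/-! ### Decay rates, explicit form and bounds of the Rayleigh mode -/

section

variable {r c : ℝ}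

theorem IsRayleigh.sq_lt (h : IsRayleigh r c) : c ^ 2 < 1 := by nlinarith [h.pos, h.lt_one]

theorem IsRayleigh.div_lt (h : IsRayleigh r c) : c ^ 2 / r < c ^ 2 :=
  div_lt_self (pow_pos h.pos 2) h.one_lt

theorem IsRayleigh.decS_pos (h : IsRayleigh r c) : 0 < decS c :=
  Real.sqrt_pos.mpr (by linarith [h.sq_lt])

theorem IsRayleigh.decP_pos (h : IsRayleigh r c) : 0 < decP r c :=
  Real.sqrt_pos.mpr (by linarith [h.sq_lt, h.div_lt])

theorem IsRayleigh.decS_lt (h : IsRayleigh r c) : decS c < decP r c :=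
  Real.sqrt_lt_sqrt (by linarith [h.sq_lt]) (by linarith [h.div_lt])

theorem IsRayleigh.decS_sq (h : IsRayleigh r c) : decS c ^ 2 = 1 - c ^ 2 :=
  Real.sq_sqrt (by linarith [h.sq_lt])

theorem IsRayleigh.decP_sq (h : IsRayleigh r c) : r * decP r c ^ 2 = r - c ^ 2 := by
  have hr : r ≠ 0 := by linarith [h.one_lt]
  rw [decP, Real.sq_sqrt (by linarith [h.sq_lt, h.div_lt])]
  field_simp

theorem IsRayleigh.q_pos (h : IsRayleigh r c) : 0 < qR r c := by
  have := h.rayleigh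
  nlinarith [h.sq_lt]

theorem IsRayleigh.q_sq (h : IsRayleigh r c) : qR r c ^ 2 = decS c * decP r c :=
  Real.sq_sqrt (mul_nonneg h.decS_pos.le h.decP_pos.le)

theorem IsRayleigh.one_sub_q (h : IsRayleigh r c) : 1 - qR r c = c ^ 2 / 2 := by
  linarith [h.rayleigh]

theorem IsRayleigh.one_sub_q_pos (h : IsRayleigh r c) : 0 < 1 - qR r c := by
  rw [h.one_sub_q]; exact div_pos (pow_pos h.pos 2) two_pos

/-- The exponential `e^{-|ν|aY}`. -/
def dex (a ν Y : ℝ) : ℝ := Real.exp (-(|ν| * a * Y))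

theorem dex_neg (a ν Y : ℝ) : dex a (-ν) Y = dex a ν Y := by simp [dex]

theorem dex_zero (a ν : ℝ) : dex a ν 0 = 1 := by simp [dex]

theorem dex_mul (a b ν Y : ℝ) : dex a ν Y * dex b ν Y = dex (a + b) ν Y := by
  simp only [dex, ← Real.exp_add]; congr 1; ring

theorem hasDerivAt_dex (a ν Y : ℝ) : HasDerivAt (dex a ν) (-(|ν| * a) * dex a ν Y) Y := by
  have h : HasDerivAt (fun Y : ℝ => -(|ν| * a * Y)) (-(|ν| * a * 1)) Y :=
    ((hasDerivAt_id Y).const_mul (|ν| * a)).neg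
  have := h.exp
  unfold dex
  convert this using 1
  ring

theorem continuous_dex (a ν : ℝ) : Continuous (dex a ν) := by unfold dex; fun_prop

theorem dex_pos (a ν Y : ℝ) : 0 < dex a ν Y := Real.exp_pos _

theorem dex_anti {a b : ℝ} (hab : a ≤ b) (ν : ℝ) {Y : ℝ} (hY : 0 ≤ Y) :
    dex b ν Y ≤ dex a ν Y := by
  refine Real.exp_le_exp.mpr (neg_le_neg ?_)
  gcongr

theorem integrableOn_dex {a ν : ℝ} (ha : 0 < a) (hν : ν ≠ 0) :
    IntegrableOn (dex a ν) (Ioi 0) := by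
  have h := integrableOn_exp_mul_Ioi (a := -(|ν| * a))
    (neg_lt_zero.mpr (mul_pos (abs_pos.mpr hν) ha)) 0
  refine h.congr_fun (fun Y _ => ?_) measurableSet_Ioi
  simp only [dex]; congr 1; ring

theorem integral_dex {a ν : ℝ} (ha : 0 < a) (hν : ν ≠ 0) :
    ∫ Y in Ioi 0, dex a ν Y = 1 / (|ν| * a) := by
  have hpos := mul_pos (abs_pos.mpr hν) ha
  have h := integral_exp_mul_Ioi (a := -(|ν| * a)) (neg_lt_zero.mpr hpos) 0
  rw [mul_zero, Real.exp_zero, neg_div_neg_eq] at h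
  rw [← h]
  refine integral_congr_ae (Filter.Eventually.of_forall fun Y => ?_)
  simp only [dex]; congr 1; ring

/-- An explicit form of the Rayleigh mode, for real frequencies. -/
def rmode (r c ν Y : ℝ) : Fin 2 → ℂ :=
  ![((qR r c * (qR r c * dex (decS c) ν Y - dex (decP r c) ν Y) : ℝ) : ℂ),
    ((SignType.sign ν * decP r c * (dex (decS c) ν Y - qR r c * dex (decP r c) ν Y) : ℝ) : ℂ)
      * Complex.I]

/-- The gradient of the Rayleigh mode `e^{iνθ} r̂(ν, Y)`. -/
def gradMode (r c ν Y : ℝ) : Matrix (Fin 2) (Fin 2) ℂ :=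
  !![((ν * (qR r c * (qR r c * dex (decS c) ν Y - dex (decP r c) ν Y)) : ℝ) : ℂ) * Complex.I,
    ((-|ν| * (qR r c * (qR r c * decS c * dex (decS c) ν Y
      - decP r c * dex (decP r c) ν Y)) : ℝ) : ℂ);
    ((-|ν| * (decP r c * (dex (decS c) ν Y - qR r c * dex (decP r c) ν Y)) : ℝ) : ℂ),
    ((-ν * (decP r c * (decS c * dex (decS c) ν Y
      - qR r c * decP r c * dex (decP r c) ν Y)) : ℝ) : ℂ) * Complex.I]

theorem rmode_apply_zero (ν Y : ℝ) : rmode r c ν Y 0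
    = ((qR r c * (qR r c * dex (decS c) ν Y - dex (decP r c) ν Y) : ℝ) : ℂ) := rfl

theorem rmode_apply_one (ν Y : ℝ) : rmode r c ν Y 1
    = ((SignType.sign ν * decP r c * (dex (decS c) ν Y - qR r c * dex (decP r c) ν Y) : ℝ) : ℂ)
      * Complex.I := rfl

theorem gradMode_apply_zero_zero (ν Y : ℝ) : gradMode r c ν Y 0 0
    = ((ν * (qR r c * (qR r c * dex (decS c) ν Y - dex (decP r c) ν Y)) : ℝ) : ℂ) * Complex.I := rfl

theorem gradMode_apply_zero_one (ν Y : ℝ) : gradMode r c ν Y 0 1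
    = ((-|ν| * (qR r c * (qR r c * decS c * dex (decS c) ν Y
      - decP r c * dex (decP r c) ν Y)) : ℝ) : ℂ) := rfl

theorem gradMode_apply_one_zero (ν Y : ℝ) : gradMode r c ν Y 1 0
    = ((-|ν| * (decP r c * (dex (decS c) ν Y - qR r c * dex (decP r c) ν Y)) : ℝ) : ℂ) := rfl

theorem gradMode_apply_one_one (ν Y : ℝ) : gradMode r c ν Y 1 1
    = ((-ν * (decP r c * (decS c * dex (decS c) ν Y
      - qR r c * decP r c * dex (decP r c) ν Y)) : ℝ) : ℂ) * Complex.I := rfl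

theorem sign_mul_abs (ν : ℝ) : (SignType.sign ν : ℝ) * |ν| = ν := by
  rcases lt_trichotomy ν 0 with h | h | h
  · simp [sign_neg h, abs_of_neg h]
  · simp [h]
  · simp [sign_pos h, abs_of_pos h]

theorem sign_mul_self' (ν : ℝ) : (SignType.sign ν : ℝ) * ν = |ν| := by
  rcases lt_trichotomy ν 0 with h | h | h
  · simp [sign_neg h, abs_of_neg h]
  · simp [h]
  · simp [sign_pos h, abs_of_pos h]

theorem gradMode_zero_freq (Y : ℝ) : gradMode r c 0 Y = 0 := by
  ext i j; fin_cases i <;> fin_cases j <;> simp [gradMode]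

theorem gradMode_col_zero (ν Y : ℝ) (i : Fin 2) :
    gradMode r c ν Y i 0 = Complex.I * ν * rmode r c ν Y i := by
  revert i
  rw [Fin.forall_fin_two, gradMode_apply_zero_zero, gradMode_apply_one_zero, rmode_apply_zero,
    rmode_apply_one]
  constructor
  · push_cast; ring
  · rw [← sign_mul_self']
    push_cast
    linear_combination (-(((SignType.sign ν : ℝ) : ℂ) * (ν : ℂ)) * ((decP r c : ℂ)
      * ((dex (decS c) ν Y : ℂ) - qR r c * dex (decP r c) ν Y))) * Complex.I_sq

theorem hasDerivAt_rmode (ν Y : ℝ) (i : Fin 2) :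
    HasDerivAt (fun Y => rmode r c ν Y i) (gradMode r c ν Y i 1) Y := by
  have hS := hasDerivAt_dex (decS c) ν Y
  have hP := hasDerivAt_dex (decP r c) ν Y
  revert i
  rw [Fin.forall_fin_two, gradMode_apply_zero_one, gradMode_apply_one_one]
  constructor
  · have h := ((((hS.const_mul (qR r c)).sub hP).const_mul (qR r c))).ofReal_comp
    refine h.congr_deriv ?_
    congr 1; ring
  · have h := (((hS.sub (hP.const_mul (qR r c))).const_mul
      (SignType.sign ν * decP r c))).ofReal_comp.mul_const Complex.I
    refine h.congr_deriv ?_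
    congr 2
    linear_combination (-(decP r c * (decS c * dex (decS c) ν Y
      - qR r c * decP r c * dex (decP r c) ν Y))) * sign_mul_abs ν

theorem rmode_neg (ν Y : ℝ) (i : Fin 2) : rmode r c (-ν) Y i = conj (rmode r c ν Y i) := by
  fin_cases i <;> simp [rmode, dex_neg, Left.sign_neg]

theorem gradMode_neg (ν Y : ℝ) (i j : Fin 2) :
    gradMode r c (-ν) Y i j = conj (gradMode r c ν Y i j) := by
  fin_cases i <;> fin_cases j <;> simp [gradMode, dex_neg]

theorem continuous_rmode (ν : ℝ) (i : Fin 2) : Continuous fun Y => rmode r c ν Y i :=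
  continuous_iff_continuousAt.mpr fun Y => (hasDerivAt_rmode ν Y i).continuousAt

theorem continuous_gradMode (ν : ℝ) (i j : Fin 2) : Continuous fun Y => gradMode r c ν Y i j := by
  have h1 := continuous_dex (decS c) ν
  have h2 := continuous_dex (decP r c) ν
  fin_cases i <;> fin_cases j <;> simp [gradMode] <;> fun_prop

/-- The exponentials depend on |ν|Y alone and the gradient brings out one factor of the frequency.
The homogeneity of the kernel comes from here, and it is why the modes are defined for real ν. -/
theorem gradMode_smul {s : ℝ} (hs : 0 < s) (ν Y : ℝ) :
    gradMode r c (s * ν) Y = (s : ℂ) • gradMode r c ν (s * Y) := by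
  have h : ∀ a, dex a (s * ν) Y = dex a ν (s * Y) := fun a => by
    simp only [dex, abs_mul, abs_of_pos hs]; congr 1; ring
  ext i j
  fin_cases i <;> fin_cases j <;> simp [gradMode, h, abs_mul, abs_of_pos hs] <;> ring

/-- The Rayleigh mode decays like its slower exponential. -/
theorem IsRayleigh.exists_norm_mode_le (h : IsRayleigh r c) : ∃ K, 0 < K ∧ ∀ ν Y : ℝ, 0 ≤ Y →
    (∀ i, ‖rmode r c ν Y i‖ ≤ K * dex (decS c) ν Y) ∧
    ∀ i j, ‖gradMode r c ν Y i j‖ ≤ K * |ν| * dex (decS c) ν Y := by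
  obtain ⟨q, hq⟩ : ∃ q, q = qR r c := ⟨_, rfl⟩
  obtain ⟨a, ha⟩ : ∃ a, a = decS c := ⟨_, rfl⟩
  obtain ⟨b, hb⟩ : ∃ b, b = decP r c := ⟨_, rfl⟩
  have hq0 : 0 < q := hq ▸ h.q_pos
  have ha0 : 0 < a := ha ▸ h.decS_pos
  have hb0 : 0 < b := hb ▸ h.decP_pos
  have hab : a ≤ b := by rw [ha, hb]; exact h.decS_lt.le
  -- A crude constant that dominates x(u + v) for each of the four coefficient triples used in `k1`
  -- to `k4`.
  refine ⟨(1 + q + b) * (1 + q + b) * (1 + q + a + b), by positivity, fun ν Y hY => ?_⟩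
  have hE : 0 < dex a ν Y := dex_pos _ _ _
  have hE' : 0 < dex b ν Y := dex_pos _ _ _
  have hEE : dex b ν Y ≤ dex a ν Y := dex_anti hab ν hY
  have key : ∀ x u v : ℝ, 0 ≤ x → 0 ≤ u → 0 ≤ v →
      x * (u + v) ≤ (1 + q + b) * (1 + q + b) * (1 + q + a + b) →
      |x * (u * dex a ν Y - v * dex b ν Y)|
        ≤ (1 + q + b) * (1 + q + b) * (1 + q + a + b) * dex a ν Y := by
    intro x u v hx hu hv hK
    rw [abs_mul, abs_of_nonneg hx]
    calc x * |u * dex a ν Y - v * dex b ν Y|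
        ≤ x * (u * dex a ν Y + v * dex a ν Y) := by
          refine mul_le_mul_of_nonneg_left ?_ hx
          rw [abs_le]
          constructor <;> nlinarith [mul_nonneg hu hE.le, mul_nonneg hv hE'.le,
            mul_le_mul_of_nonneg_left hEE hv]
      _ = x * (u + v) * dex a ν Y := by ring
      _ ≤ _ := mul_le_mul_of_nonneg_right hK hE.le
  have k1 := key q q 1 hq0.le hq0.le one_pos.le (by
    have : 0 ≤ q ^ 2 + q + (1 + q + b) * (1 + q + b) * (a + b) := by positivity
    nlinarith [mul_pos hq0 hb0, mul_pos hq0 hq0, mul_pos (mul_pos hq0 hq0) hb0,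
      mul_pos (mul_pos hq0 hq0) hq0, mul_pos (mul_pos hq0 hb0) hb0])
  have k2 := key b 1 q hb0.le one_pos.le hq0.le (by
    have : 0 ≤ (1 + q + b) * (1 + q + b) * (a + b) := by positivity
    nlinarith [mul_pos hq0 hb0, mul_pos hq0 hq0, mul_pos (mul_pos hq0 hq0) hb0,
      mul_pos (mul_pos hq0 hq0) hq0, mul_pos (mul_pos hq0 hb0) hb0])
  have k3 := key q (q * a) b hq0.le (mul_pos hq0 ha0).le hb0.le (by
    have h1 : q * (q * a + b) ≤ (1 + q + b) * ((1 + q + b) * (a + b)) := by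
      refine mul_le_mul (by linarith) ?_ (by positivity) (by positivity)
      nlinarith [mul_pos hq0 ha0, mul_pos hq0 hb0, mul_pos hb0 ha0, mul_pos hb0 hb0]
    have : 0 ≤ (1 + q + b) * (1 + q + b) * (1 + q) := by positivity
    nlinarith)
  have k4 := key b a (q * b) hb0.le ha0.le (mul_pos hq0 hb0).le (by
    have h1 : b * (a + q * b) ≤ (1 + q + b) * ((1 + q + b) * (a + b)) := by
      refine mul_le_mul (by linarith) ?_ (by positivity) (by positivity)
      nlinarith [mul_pos hq0 ha0, mul_pos hq0 hb0, mul_pos hb0 ha0, mul_pos hb0 hb0]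
    have : 0 ≤ (1 + q + b) * (1 + q + b) * (1 + q) := by positivity
    nlinarith)
  have hsign : |(SignType.sign ν : ℝ)| ≤ 1 := by
    rcases lt_trichotomy ν 0 with h | h | h <;> simp [h]
  have hν := abs_nonneg ν
  rw [one_mul] at k1 k2
  have fin : ∀ z : ℝ, z ≤ (1 + q + b) * (1 + q + b) * (1 + q + a + b) * dex a ν Y →
      |ν| * z ≤ (1 + q + b) * (1 + q + b) * (1 + q + a + b) * |ν| * dex a ν Y :=
    fun z hz => by nlinarith [mul_le_mul_of_nonneg_left hz hν]
  rw [abs_mul] at k1 k2 k3 k4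
  simp only [Fin.forall_fin_two, gradMode_apply_zero_zero, gradMode_apply_zero_one,
    gradMode_apply_one_zero, gradMode_apply_one_one, rmode_apply_zero, rmode_apply_one]
  simp only [norm_mul, Complex.norm_real, Complex.norm_I, mul_one, Real.norm_eq_abs, ← hq, ← ha,
    ← hb, abs_neg, abs_abs]
  refine ⟨⟨k1, ?_⟩, ⟨fin _ k1, fin _ k3⟩, fin _ k2, fin _ k4⟩
  rw [mul_assoc]
  refine le_trans (mul_le_mul_of_nonneg_right hsign (by positivity)) ?_
  rw [one_mul]; exact k2

theorem exp_om_pos {n : ℤ} (hn : 0 < n) (a Y : ℝ) :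
    Complex.exp (Complex.I * n * (Complex.I * a) * Y) = (dex a n Y : ℂ) := by
  have hn' : (0 : ℝ) < n := by exact_mod_cast hn
  rw [dex, Complex.ofReal_exp, abs_of_pos hn']
  congr 1
  push_cast
  linear_combination (n * a * Y : ℂ) * Complex.I_sq

/-- The product -ω₁ω₂ in the first component is replaced by q², which leaves real coefficients. -/
theorem rhatPos_eq (h : IsRayleigh r c) {n : ℤ} (hn : 0 < n) (Y : ℝ) (i : Fin 2) :
    rhatPos r c n Y i = rmode r c n Y i := by
  have hn' : (0 : ℝ) < n := by exact_mod_cast hn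
  have hq : ((decS c : ℝ) : ℂ) * (decP r c : ℝ) = (qR r c : ℂ) ^ 2 := by
    exact_mod_cast h.q_sq.symm
  have e1 := exp_om_pos hn (decS c) Y
  have e2 := exp_om_pos hn (decP r c) Y
  have o1 : om r c 0 = Complex.I * (decS c : ℂ) := rfl
  have o2 : om r c 1 = Complex.I * (decP r c : ℂ) := rfl
  revert i
  rw [Fin.forall_fin_two, rmode_apply_zero, rmode_apply_one]
  constructor
  · simp [rhatPos, rvec, o1, o2, e1, e2]
    linear_combination (dex (decS c) n Y : ℂ) * hq
      - (decS c * decP r c * dex (decS c) n Y : ℂ) * Complex.I_sq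
  · simp [rhatPos, rvec, o1, o2, e1, e2, sign_pos hn']
    ring

theorem rhat_eq (h : IsRayleigh r c) {n : ℤ} (hn : n ≠ 0) (Y : ℝ) (i : Fin 2) :
    rhat r c n Y i = rmode r c n Y i := by
  rcases lt_or_gt_of_ne hn with hn | hn
  · rw [rhat, if_neg (not_lt.mpr hn.le), Pi.star_apply, rhatPos_eq h (by omega)]
    have := rmode_neg (r := r) (c := c) (-(n : ℝ)) Y i
    rw [neg_neg] at this
    rw [this]; push_cast; rfl
  · rw [rhat, if_pos hn, rhatPos_eq h hn]

end

/-! ## The cubic form of the energy and the kernel -/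

/-- Coefficients of the polarized cubic part of the stored energy. -/
def coefQ (lam : ℝ) (i j a b k l : Fin 2) : ℝ :=
  lam * ((if a = k then 1 else 0) * (if b = l then 1 else 0) * (if i = j then 1 else 0)
    + (if a = i then 1 else 0) * (if b = j then 1 else 0) * (if k = l then 1 else 0)
    + (if a = b then 1 else 0) * (if k = i then 1 else 0) * (if l = j then 1 else 0))
  + ((if a = k then 1 else 0) * (if b = i then 1 else 0) * (if l = j then 1 else 0)
    + (if a = k then 1 else 0) * (if b = j then 1 else 0) * (if l = i then 1 else 0)
    + (if a = i then 1 else 0) * (if b = k then 1 else 0) * (if l = j then 1 else 0)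
    + (if a = i then 1 else 0) * (if k = j then 1 else 0) * (if b = l then 1 else 0)
    + (if b = j then 1 else 0) * (if a = l then 1 else 0) * (if k = i then 1 else 0)
    + (if a = j then 1 else 0) * (if b = l then 1 else 0) * (if k = i then 1 else 0))

/-- The coefficients are the third derivatives of the cubic energy (λ/2) tr A |A|² + tr(A Aᵀ A), so
index pairs may be permuted. This swap and the next one generate all permutations. -/
theorem coefQ_swap_right (lam : ℝ) (i j a b k l : Fin 2) :
    coefQ lam i j a b k l = coefQ lam i j k l a b := by
  simp only [coefQ, eq_comm (a := k) (b := a), eq_comm (a := l) (b := b),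
    eq_comm (a := l) (b := a), eq_comm (a := k) (b := b)]
  ring

theorem coefQ_swap_left (lam : ℝ) (i j a b k l : Fin 2) :
    coefQ lam i j a b k l = coefQ lam a b i j k l := by
  simp only [coefQ, eq_comm (a := i) (b := a), eq_comm (a := j) (b := b),
    eq_comm (a := i) (b := k), eq_comm (a := j) (b := l), eq_comm (a := i) (b := l),
    eq_comm (a := j) (b := k), eq_comm (a := i) (b := b), eq_comm (a := j) (b := a),
    eq_comm (a := a) (b := k), eq_comm (a := b) (b := l), eq_comm (a := a) (b := l),
    eq_comm (a := b) (b := k)]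
  ring

theorem abs_coefQ_le (lam : ℝ) (i j a b k l : Fin 2) :
    |coefQ lam i j a b k l| ≤ 3 * |lam| + 6 := by
  have h : ∀ (p q s : Prop) [Decidable p] [Decidable q] [Decidable s],
      |(if p then (1 : ℝ) else 0) * (if q then 1 else 0) * (if s then 1 else 0)| ≤ 1 := by
    intro p q s _ _ _
    split_ifs <;> simp
  unfold coefQ
  refine (abs_add_le _ _).trans (add_le_add ?_ ?_)
  · rw [abs_mul, mul_comm]
    refine mul_le_mul_of_nonneg_right ?_ (abs_nonneg lam)
    linarith [(abs_add_three _ _ _).trans (add_le_add_three (h (a = k) (b = l) (i = j))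
      (h (a = i) (b = j) (k = l)) (h (a = b) (k = i) (l = j)))]
  · refine (abs_add_le _ _).trans ?_
    refine (add_le_add ((abs_add_le _ _).trans (add_le_add ((abs_add_le _ _).trans
      (add_le_add (abs_add_three _ _ _) le_rfl)) le_rfl)) le_rfl).trans ?_
    linarith [h (a = k) (b = i) (l = j), h (a = k) (b = j) (l = i), h (a = i) (b = k) (l = j),
      h (a = i) (k = j) (b = l), h (b = j) (a = l) (k = i), h (a = j) (b = l) (k = i)]

/-- The quadratic stress is the gradient of the cubic stored energy, so its symmetrisation is a
contraction with the symmetric third-derivative tensor. It is checked entry by entry. -/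
theorem crossQ_eq (T r : ℝ) (P D : Profile) (i j : Fin 2) (p : Fin 5 → ℝ) :
    crossQ T r P D i j p = ∑ a, ∑ b, ∑ k, ∑ l,
      coefQ (r - 2) i j a b k l * (grad T 1 P p a b * grad T 1 D p k l) := by
  simp only [crossQ]
  generalize grad T 1 P p = A
  generalize grad T 1 D p = B
  fin_cases i <;> fin_cases j <;>
  simp [stressQ, hooke, coefQ, Matrix.mul_apply, Fin.sum_univ_two, Matrix.trace] <;> ring

/-- The symmetric trilinear form of the cubic part of the stored energy. -/
def cubicForm (lam : ℝ) (A B C : Matrix (Fin 2) (Fin 2) ℂ) : ℂ :=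
  ∑ i, ∑ j, ∑ a, ∑ b, ∑ k, ∑ l, (coefQ lam i j a b k l : ℂ) * (A i j * (B a b * C k l))

theorem cubicForm_swap_right (lam : ℝ) (A B C : Matrix (Fin 2) (Fin 2) ℂ) :
    cubicForm lam A B C = cubicForm lam A C B := by
  unfold cubicForm
  refine Finset.sum_congr rfl fun i _ => Finset.sum_congr rfl fun j _ => ?_
  have h : ∀ f : Fin 2 → Fin 2 → Fin 2 → Fin 2 → ℂ,
      ∑ a, ∑ b, ∑ k, ∑ l, f a b k l = ∑ k, ∑ l, ∑ a, ∑ b, f a b k l := by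
    intro f; simp only [Fin.sum_univ_two]; ring
  rw [h]
  refine Finset.sum_congr rfl fun k _ => Finset.sum_congr rfl fun l _ =>
    Finset.sum_congr rfl fun a _ => Finset.sum_congr rfl fun b _ => ?_
  rw [coefQ_swap_right]; ring

theorem cubicForm_swap_left (lam : ℝ) (A B C : Matrix (Fin 2) (Fin 2) ℂ) :
    cubicForm lam A B C = cubicForm lam B A C := by
  unfold cubicForm
  have h : ∀ f : Fin 2 → Fin 2 → Fin 2 → Fin 2 → ℂ,
      ∑ i, ∑ j, ∑ a, ∑ b, f i j a b = ∑ a, ∑ b, ∑ i, ∑ j, f i j a b := by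
    intro f; simp only [Fin.sum_univ_two]; ring
  rw [h]
  refine Finset.sum_congr rfl fun a _ => Finset.sum_congr rfl fun b _ =>
    Finset.sum_congr rfl fun i _ => Finset.sum_congr rfl fun j _ =>
    Finset.sum_congr rfl fun k _ => Finset.sum_congr rfl fun l _ => ?_
  rw [coefQ_swap_left]; ring

theorem norm_cubicForm_le (lam : ℝ) {A B C : Matrix (Fin 2) (Fin 2) ℂ} {x y z : ℝ}
    (hA : ∀ i j, ‖A i j‖ ≤ x) (hB : ∀ i j, ‖B i j‖ ≤ y) (hC : ∀ i j, ‖C i j‖ ≤ z) :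
    ‖cubicForm lam A B C‖ ≤ 64 * (3 * |lam| + 6) * (x * y * z) := by
  have hx : 0 ≤ x := (norm_nonneg _).trans (hA 0 0)
  have hy : 0 ≤ y := (norm_nonneg _).trans (hB 0 0)
  have hterm : ∀ i j a b k l, ‖(coefQ lam i j a b k l : ℂ) * (A i j * (B a b * C k l))‖
      ≤ (3 * |lam| + 6) * (x * y * z) := by
    intro i j a b k l
    rw [norm_mul, norm_mul, norm_mul, Complex.norm_real, Real.norm_eq_abs, mul_assoc x]
    have h1 := abs_coefQ_le lam i j a b k l
    exact mul_le_mul h1 (mul_le_mul (hA i j) (mul_le_mul (hB a b) (hC k l) (norm_nonneg _) hy)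
      (by positivity) hx) (by positivity) (by positivity)
  have hs : ∀ (f : Fin 2 → ℂ) (M : ℝ), (∀ i, ‖f i‖ ≤ M) → ‖∑ i, f i‖ ≤ 2 * M := by
    intro f M hf
    refine (norm_sum_le _ _).trans ((Finset.sum_le_sum fun i _ => hf i).trans ?_)
    simp
  have := hs _ _ fun i => hs _ _ fun j => hs _ _ fun a => hs _ _ fun b => hs _ _ fun k =>
    hs _ _ fun l => hterm i j a b k l
  unfold cubicForm
  linarith

theorem cubicForm_smul (lam : ℝ) (s : ℂ) (A B C : Matrix (Fin 2) (Fin 2) ℂ) :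
    cubicForm lam (s • A) (s • B) (s • C) = s ^ 3 * cubicForm lam A B C := by
  simp only [cubicForm, Finset.mul_sum, Matrix.smul_apply, smul_eq_mul]
  refine Finset.sum_congr rfl fun i _ => Finset.sum_congr rfl fun j _ =>
    Finset.sum_congr rfl fun a _ => Finset.sum_congr rfl fun b _ =>
    Finset.sum_congr rfl fun k _ => Finset.sum_congr rfl fun l _ => ?_
  ring

/-! ### The kernel: symmetry, homogeneity, bounds and convergence of the multiplier series -/

section

variable {r c : ℝ}

/-- The integrand of the kernel. -/
def kerFun (r c n₁ n₂ n₃ Y : ℝ) : ℂ :=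
  cubicForm (r - 2) (gradMode r c n₁ Y) (gradMode r c n₂ Y) (gradMode r c n₃ Y)

/-- The kernel of the bilinear Fourier multiplier: the cubic energy of three Rayleigh modes. -/
def ker (r c n₁ n₂ n₃ : ℝ) : ℂ := ∫ Y in Ioi (0 : ℝ), kerFun r c n₁ n₂ n₃ Y

theorem ker_swap_left (n₁ n₂ n₃ : ℝ) : ker r c n₁ n₂ n₃ = ker r c n₂ n₁ n₃ := by
  simp only [ker, kerFun, cubicForm_swap_left (r - 2) (gradMode r c n₁ _)]

theorem ker_swap_right (n₁ n₂ n₃ : ℝ) : ker r c n₁ n₂ n₃ = ker r c n₁ n₃ n₂ := by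
  simp only [ker, kerFun, cubicForm_swap_right (r - 2) _ (gradMode r c n₂ _)]

/-- Three gradients contribute s³ and the substitution sY in the integral contributes 1/s. -/
theorem ker_smul {s : ℝ} (hs : 0 < s) (n₁ n₂ n₃ : ℝ) :
    ker r c (s * n₁) (s * n₂) (s * n₃) = (s : ℂ) ^ 2 * ker r c n₁ n₂ n₃ := by
  have h : ∀ Y, kerFun r c (s * n₁) (s * n₂) (s * n₃) Y
      = (s : ℂ) ^ 3 * kerFun r c n₁ n₂ n₃ (s * Y) := by
    intro Y
    simp only [kerFun, gradMode_smul hs, cubicForm_smul]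
  simp only [ker, h]
  rw [integral_const_mul, integral_comp_mul_left_Ioi _ 0 hs, mul_zero, Complex.real_smul]
  have hs' : (s : ℂ) ≠ 0 := by exact_mod_cast hs.ne'
  push_cast
  field_simp

theorem kerFun_zero_right (n₁ n₂ Y : ℝ) : kerFun r c n₁ n₂ 0 Y = 0 := by
  simp [kerFun, gradMode_zero_freq, cubicForm]

theorem kerFun_zero_left (n₂ n₃ Y : ℝ) : kerFun r c 0 n₂ n₃ Y = 0 := by
  simp [kerFun, gradMode_zero_freq, cubicForm]

theorem kerFun_neg (n₁ n₂ n₃ Y : ℝ) :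
    kerFun r c (-n₁) (-n₂) (-n₃) Y = conj (kerFun r c n₁ n₂ n₃ Y) := by
  simp only [kerFun, cubicForm, map_sum, map_mul, gradMode_neg, Complex.conj_ofReal]

theorem ker_neg (n₁ n₂ n₃ : ℝ) : ker r c (-n₁) (-n₂) (-n₃) = conj (ker r c n₁ n₂ n₃) := by
  simp only [ker, kerFun_neg]
  exact integral_conj

theorem continuous_kerFun (n₁ n₂ n₃ : ℝ) : Continuous (kerFun r c n₁ n₂ n₃) := by
  unfold kerFun cubicForm
  refine continuous_finsetSum _ fun i _ => continuous_finsetSum _ fun j _ =>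
    continuous_finsetSum _ fun a _ => continuous_finsetSum _ fun b _ =>
    continuous_finsetSum _ fun k _ => continuous_finsetSum _ fun l _ => ?_
  exact continuous_const.mul ((continuous_gradMode n₁ i j).mul
    ((continuous_gradMode n₂ a b).mul (continuous_gradMode n₃ k l)))

/-- The integrand is at most |n₁n₂n₃| e^{-(|n₁|+|n₂|+|n₃|)aY} up to a constant, with a the slower
decay rate. Integration divides by |n₁|+|n₂|+|n₃| ≥ |n₁|, which removes the factor |n₁|. The
integral of the norm is bounded because sum and integral are exchanged later. -/
theorem IsRayleigh.exists_kerFun_bound (h : IsRayleigh r c) : ∃ K, 0 ≤ K ∧ ∀ n₁ n₂ n₃ : ℝ,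
    IntegrableOn (kerFun r c n₁ n₂ n₃) (Ioi 0) ∧
    ∫ Y in Ioi (0 : ℝ), ‖kerFun r c n₁ n₂ n₃ Y‖ ≤ K * |n₂| * |n₃| := by
  obtain ⟨K, hK, hmode⟩ := h.exists_norm_mode_le
  have ha := h.decS_pos
  refine ⟨64 * (3 * |r - 2| + 6) * K ^ 3 / decS c, by positivity, fun n₁ n₂ n₃ => ?_⟩
  -- If n₁ = 0 the exponential decay may be absent, but then the integrand is identically zero.
  by_cases h1 : n₁ = 0
  · subst h1
    have : kerFun r c 0 n₂ n₃ = fun _ => 0 := funext fun Y => kerFun_zero_left n₂ n₃ Y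
    rw [this]
    refine ⟨integrableOn_zero, ?_⟩
    simp only [norm_zero, integral_zero]
    positivity
  · have hn1 : 0 < |n₁| := abs_pos.mpr h1
    have hsum : 0 < |n₁| + |n₂| + |n₃| := by positivity
    have hbd : ∀ Y ∈ Ioi (0 : ℝ), ‖kerFun r c n₁ n₂ n₃ Y‖
        ≤ 64 * (3 * |r - 2| + 6) * K ^ 3 * (|n₁| * |n₂| * |n₃|)
          * dex (decS c) (|n₁| + |n₂| + |n₃|) Y := by
      intro Y hY
      have hY' : 0 ≤ Y := (mem_Ioi.mp hY).le
      refine (norm_cubicForm_le (r - 2) (hmode n₁ Y hY').2 (hmode n₂ Y hY').2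
        (hmode n₃ Y hY').2).trans (le_of_eq ?_)
      have : dex (decS c) (|n₁| + |n₂| + |n₃|) Y
          = dex (decS c) n₁ Y * dex (decS c) n₂ Y * dex (decS c) n₃ Y := by
        simp only [dex, ← Real.exp_add, abs_of_pos hsum]; congr 1; ring
      rw [this]; ring
    have hint : IntegrableOn (fun Y => 64 * (3 * |r - 2| + 6) * K ^ 3 * (|n₁| * |n₂| * |n₃|)
          * dex (decS c) (|n₁| + |n₂| + |n₃|) Y) (Ioi 0) :=
      (integrableOn_dex ha hsum.ne').const_mul _
    have hI : IntegrableOn (kerFun r c n₁ n₂ n₃) (Ioi 0) :=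
      Integrable.mono' hint (continuous_kerFun n₁ n₂ n₃).aestronglyMeasurable
        ((ae_restrict_iff' measurableSet_Ioi).mpr (Filter.Eventually.of_forall hbd))
    refine ⟨hI, (setIntegral_mono_on hI.norm hint measurableSet_Ioi hbd).trans ?_⟩
    rw [integral_const_mul, integral_dex ha hsum.ne', abs_of_pos hsum]
    rw [mul_one_div, div_le_iff₀ (by positivity)]
    calc 64 * (3 * |r - 2| + 6) * K ^ 3 * (|n₁| * |n₂| * |n₃|)
        ≤ 64 * (3 * |r - 2| + 6) * K ^ 3 * ((|n₁| + |n₂| + |n₃|) * |n₂| * |n₃|) := by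
          have h2 := abs_nonneg n₂
          have h3 := abs_nonneg n₃
          gcongr
          linarith
      _ = _ := by field_simp

theorem norm_ker_le {K : ℝ} (hK : ∀ n₁ n₂ n₃ : ℝ,
    IntegrableOn (kerFun r c n₁ n₂ n₃) (Ioi 0) ∧
    ∫ Y in Ioi (0 : ℝ), ‖kerFun r c n₁ n₂ n₃ Y‖ ≤ K * |n₂| * |n₃|) (n₁ n₂ n₃ : ℝ) :
    ‖ker r c n₁ n₂ n₃‖ ≤ K * |n₂| * |n₃| :=
  (norm_integral_le_integral_norm _).trans (hK n₁ n₂ n₃).2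

/-- The term n' = 0 excluded from the sum is zero anyway, because the Rayleigh gradient vanishes at
frequency zero. -/
theorem bilinTerm_ker (u v : ℝ → ℂ) (n m : ℤ) : bilinTerm (ker r c) u v n m
    = ker r c (-n) (n - m) m * fc (n - m) u * fc m v := by
  unfold bilinTerm
  split_ifs with h
  · subst h
    have : ker r c (-n) (n - (0 : ℤ)) (0 : ℤ) = 0 := by simp [ker, kerFun_zero_right]
    rw [this]; simp
  · rfl

/-- The kernel costs one derivative on each of u and v, after which the coefficients still decay
like the summable weights. -/
theorem IsRayleigh.exists_norm_bilinTerm_le (h : IsRayleigh r c) {u v : ℝ → ℂ}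
    (hu : SmoothPer u) (hv : SmoothPer v) : ∃ K, 0 ≤ K ∧ ∀ n m : ℤ,
      ‖bilinTerm (ker r c) u v n m‖ ≤ K * (wt (n - m) * wt m) := by
  obtain ⟨K, hK0, hK⟩ := h.exists_kerFun_bound
  obtain ⟨A, hA0, hA⟩ := hu.exists_abs_mul_norm_fc_le
  obtain ⟨B, hB0, hB⟩ := hv.exists_abs_mul_norm_fc_le
  refine ⟨K * A * B, by positivity, fun n m => ?_⟩
  rw [bilinTerm_ker, norm_mul, norm_mul]
  have h1 := norm_ker_le hK (-n) (n - m) m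
  have h2 := hA (n - m)
  have h3 := hB m
  push_cast at h2
  calc _ ≤ K * |(n : ℝ) - m| * |(m : ℝ)| * ‖fc (n - m) u‖ * ‖fc m v‖ := by gcongr
    _ = K * ((|(n : ℝ) - m| * ‖fc (n - m) u‖) * (|(m : ℝ)| * ‖fc m v‖)) := by ring
    _ ≤ K * ((A * wt (n - m)) * (B * wt m)) := by
      have h4 := mul_le_mul h2 h3 (by positivity) (mul_nonneg hA0 (wt_nonneg (n - m)))
      exact mul_le_mul_of_nonneg_left h4 hK0
    _ = _ := by ring

theorem summable_wt_conv : Summable fun z : ℤ × ℤ => wt (z.1 - z.2) * wt z.2 := by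
  have h : Summable fun z : ℤ × ℤ => wt z.1 * wt z.2 :=
    Summable.mul_of_nonneg summable_wt summable_wt wt_nonneg wt_nonneg
  have hinj : Function.Injective fun z : ℤ × ℤ => (z.1 - z.2, z.2) := by
    rintro ⟨a, b⟩ ⟨a', b'⟩ h
    simp only [Prod.mk.injEq] at h ⊢
    omega
  have h2 := h.comp_injective hinj
  simp only [Function.comp_def] at h2
  exact h2

theorem IsRayleigh.summable_bilin (h : IsRayleigh r c) (c₀ : ℝ) {u v : ℝ → ℂ}
    (hu : SmoothPer u) (hv : SmoothPer v) :
    (∀ n, Summable (bilinTerm (ker r c) u v n)) ∧ Summable (bilinCoeff (ker r c) c₀ u v) := by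
  obtain ⟨K, hK0, hK⟩ := h.exists_norm_bilinTerm_le hu hv
  have hrow : ∀ n, Summable fun m => K * (wt (n - m) * wt m) := fun n =>
    (summable_wt_conv.prod_factor n).mul_left K
  refine ⟨fun n => Summable.of_norm_bounded (hrow n) (hK n), ?_⟩
  have hs : Summable fun n => ∑' m, K * (wt (n - m) * wt m) := (summable_wt_conv.mul_left K).prod
  exact Summable.mul_left _ (Summable.of_norm_bounded hs fun n =>
    tsum_of_norm_bounded (hrow n).hasSum (hK n))

/-- Changing the sign of n and of the summation index conjugates the kernel and both coefficients;
hence 𝓑 of real functions is real. -/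
theorem bilinCoeff_conj (c₀ : ℝ) {u v : ℝ → ℂ} (hu : ∀ n, fc (-n) u = conj (fc n u))
    (hv : ∀ n, fc (-n) v = conj (fc n v)) (n : ℤ) :
    bilinCoeff (ker r c) c₀ u v (-n) = conj (bilinCoeff (ker r c) c₀ u v n) := by
  have hterm : ∀ m, bilinTerm (ker r c) u v (-n) (-m) = conj (bilinTerm (ker r c) u v n m) := by
    intro m
    have e1 : (-((-n : ℤ) : ℝ)) = -(-(n : ℝ)) := by push_cast; ring
    have e2 : ((-n : ℤ) : ℝ) - ((-m : ℤ) : ℝ) = -((n : ℝ) - m) := by push_cast; ring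
    have e3 : ((-m : ℤ) : ℝ) = -(m : ℝ) := by push_cast; ring
    have e4 : -n - -m = -(n - m) := by ring
    rw [bilinTerm_ker, bilinTerm_ker, map_mul, map_mul, ← ker_neg, ← hv, ← hu, e1, e2, e3, e4]
  have hsum : ∑' m, bilinTerm (ker r c) u v (-n) m = conj (∑' m, bilinTerm (ker r c) u v n m) := by
    rw [Complex.conj_tsum, ← (Equiv.neg ℤ).tsum_eq (bilinTerm (ker r c) u v (-n))]
    exact tsum_congr hterm
  have hconst : conj (-(1 / (4 * Real.pi * c₀) : ℂ)) = -(1 / (4 * Real.pi * c₀) : ℂ) := by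
    simp [map_ofNat]
  simp only [bilinCoeff, map_mul, hconst, hsum]

end

/-! ## The solvability functional -/

/-- Continuous functions on the half line of polynomial growth. -/
def Temperate (H : ℝ → ℂ) : Prop :=
  ContinuousOn H (Ici 0) ∧ ∃ C : ℝ, ∃ k : ℕ, 0 ≤ C ∧ ∀ s, 0 ≤ s → ‖H s‖ ≤ C * (1 + s) ^ k

theorem Temperate.add {H G : ℝ → ℂ} (hH : Temperate H) (hG : Temperate G) :
    Temperate (fun s => H s + G s) := by
  obtain ⟨h1, C, k, hC, hb⟩ := hH
  obtain ⟨h2, C', k', hC', hb'⟩ := hG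
  refine ⟨h1.add h2, C + C', k + k', by positivity, fun s hs => (norm_add_le _ _).trans ?_⟩
  have e : (1 : ℝ) ≤ 1 + s := by linarith
  have e1 : (1 + s) ^ k ≤ (1 + s) ^ (k + k') := pow_le_pow_right₀ e (Nat.le_add_right _ _)
  have e2 : (1 + s) ^ k' ≤ (1 + s) ^ (k + k') := pow_le_pow_right₀ e (Nat.le_add_left _ _)
  rw [add_mul]
  exact add_le_add ((hb s hs).trans (mul_le_mul_of_nonneg_left e1 hC))
    ((hb' s hs).trans (mul_le_mul_of_nonneg_left e2 hC'))

theorem Temperate.const_mul {H : ℝ → ℂ} (hH : Temperate H) (a : ℂ) :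
    Temperate (fun s => a * H s) := by
  obtain ⟨h1, C, k, hC, hb⟩ := hH
  refine ⟨continuousOn_const.mul h1, ‖a‖ * C, k, by positivity, fun s hs => ?_⟩
  rw [norm_mul, mul_assoc]
  exact mul_le_mul_of_nonneg_left (hb s hs) (norm_nonneg a)

/-- Half of the decay rate absorbs the polynomial, by t^k/k! ≤ e^t with t = (|ν|a/2)(1+s). -/
theorem integrableOn_dex_mul_pow {a ν : ℝ} (ha : 0 < a) (hν : ν ≠ 0) (k : ℕ) :
    IntegrableOn (fun s => dex a ν s * (1 + s) ^ k) (Ioi 0) := by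
  have hb : 0 < |ν| * a := mul_pos (abs_pos.mpr hν) ha
  have hε : 0 < |ν| * a / 2 := by positivity
  have hint : IntegrableOn (fun s => (k.factorial / (|ν| * a / 2) ^ k * Real.exp (|ν| * a / 2))
      * dex (a / 2) ν s) (Ioi 0) := (integrableOn_dex (half_pos ha) hν).const_mul _
  refine Integrable.mono' hint
    ((continuous_dex a ν).mul (by fun_prop)).aestronglyMeasurable
    ((ae_restrict_iff' measurableSet_Ioi).mpr (Filter.Eventually.of_forall fun s hs => ?_))
  have hs' : 0 ≤ s := (mem_Ioi.mp hs).le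
  rw [norm_mul, Real.norm_of_nonneg (dex_pos _ _ _).le, Real.norm_of_nonneg (by positivity)]
  have h1 := Real.pow_div_factorial_le_exp (|ν| * a / 2 * (1 + s)) (by positivity) k
  rw [mul_pow, div_le_iff₀ (by positivity)] at h1
  have h2 : (1 + s) ^ k ≤ k.factorial / (|ν| * a / 2) ^ k * Real.exp (|ν| * a / 2 * (1 + s)) := by
    rw [div_mul_eq_mul_div, le_div_iff₀ (by positivity)]
    linarith
  calc dex a ν s * (1 + s) ^ k
      ≤ dex a ν s * (k.factorial / (|ν| * a / 2) ^ k * Real.exp (|ν| * a / 2 * (1 + s))) :=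
        mul_le_mul_of_nonneg_left h2 (dex_pos _ _ _).le
    _ = _ := by
      have e : dex a ν s * Real.exp (|ν| * a / 2 * (1 + s))
          = Real.exp (|ν| * a / 2) * dex (a / 2) ν s := by
        simp only [dex, ← Real.exp_add]; congr 1; ring
      linear_combination (k.factorial / (|ν| * a / 2) ^ k) * e

theorem Temperate.integrableOn_mul {H g : ℝ → ℂ} (hH : Temperate H) (hg : Continuous g)
    {K a ν : ℝ} (ha : 0 < a) (hν : ν ≠ 0) (hK : ∀ s, 0 ≤ s → ‖g s‖ ≤ K * dex a ν s) :
    IntegrableOn (fun s => g s * H s) (Ioi 0) := by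
  obtain ⟨h1, C, k, hC, hb⟩ := hH
  refine Integrable.mono' ((integrableOn_dex_mul_pow ha hν k).const_mul (K * C))
    ((hg.continuousOn.mul (h1.mono Ioi_subset_Ici_self)).aestronglyMeasurable measurableSet_Ioi)
    ((ae_restrict_iff' measurableSet_Ioi).mpr (Filter.Eventually.of_forall fun s hs => ?_))
  have hs' : 0 ≤ s := (mem_Ioi.mp hs).le
  rw [norm_mul]
  calc ‖g s‖ * ‖H s‖ ≤ (K * dex a ν s) * (C * (1 + s) ^ k) :=
        mul_le_mul (hK s hs') (hb s hs') (norm_nonneg _) ((norm_nonneg _).trans (hK s hs'))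
    _ = _ := by ring

section

variable {T r c : ℝ}

theorem IsRayleigh.integrableOn_rmode_mul (h : IsRayleigh r c) {H : ℝ → ℂ} (hH : Temperate H)
    {ν : ℝ} (hν : ν ≠ 0) (i : Fin 2) : IntegrableOn (fun s => rmode r c ν s i * H s) (Ioi 0) := by
  obtain ⟨K, _, hK⟩ := h.exists_norm_mode_le
  exact hH.integrableOn_mul (continuous_rmode ν i) h.decS_pos hν fun s hs => (hK ν s hs).1 i

theorem IsRayleigh.integrableOn_gradMode_mul (h : IsRayleigh r c) {H : ℝ → ℂ} (hH : Temperate H)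
    {ν : ℝ} (hν : ν ≠ 0) (i j : Fin 2) :
    IntegrableOn (fun s => gradMode r c ν s i j * H s) (Ioi 0) := by
  obtain ⟨K, _, hK⟩ := h.exists_norm_mode_le
  exact hH.integrableOn_mul (continuous_gradMode ν i j) h.decS_pos hν fun s hs => (hK ν s hs).2 i j

/-- The pairing of boundary and interior sources with the Rayleigh mode of frequency `-n`. -/
def pairing (r c : ℝ) (n : ℤ) (h : Fin 2 → ℂ) (H : Fin 2 → ℝ → ℂ) : ℂ :=
  ∑ i, rmode r c (-n) 0 i * h i - ∫ s in Ioi (0 : ℝ), ∑ i, rmode r c (-n) s i * H i s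

theorem IsRayleigh.pairing_sub (hR : IsRayleigh r c) {n : ℤ} (hn : n ≠ 0) (h h' : Fin 2 → ℂ)
    {H H' : Fin 2 → ℝ → ℂ} (hH : ∀ i, Temperate (H i)) (hH' : ∀ i, Temperate (H' i)) :
    pairing r c n h H - pairing r c n h' H'
      = pairing r c n (fun i => h i - h' i) (fun i s => H i s - H' i s) := by
  have hn' : -(n : ℝ) ≠ 0 := neg_ne_zero.mpr (by exact_mod_cast hn)
  have e : ∫ s in Ioi (0 : ℝ), ∑ i, rmode r c (-n) s i * (H i s - H' i s)
      = (∫ s in Ioi (0 : ℝ), ∑ i, rmode r c (-n) s i * H i s)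
        - ∫ s in Ioi (0 : ℝ), ∑ i, rmode r c (-n) s i * H' i s := by
    rw [← integral_sub (integrable_finsetSum _ fun i _ => hR.integrableOn_rmode_mul (hH i) hn' i)
      (integrable_finsetSum _ fun i _ => hR.integrableOn_rmode_mul (hH' i) hn' i)]
    simp only [mul_sub, Finset.sum_sub_distrib]
  simp only [pairing]
  rw [e]
  simp only [mul_sub, Finset.sum_sub_distrib]
  ring

theorem pairing_conj (n : ℤ) (h : Fin 2 → ℂ) (H : Fin 2 → ℝ → ℂ) :
    pairing r c (-n) (fun i => conj (h i)) (fun i s => conj (H i s))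
      = conj (pairing r c n h H) := by
  have e : ∀ s i, rmode r c (-((-n : ℤ) : ℝ)) s i = conj (rmode r c (-n) s i) := by
    intro s i
    rw [← rmode_neg]; push_cast; rfl
  simp only [pairing, e, ← map_mul, ← map_sum, map_sub]
  congr 1
  exact integral_conj

/-- K does not depend on n: for integers n ≠ 0 the mode decays at least as fast as the exponential
of frequency one, against which (1+s)^k is integrable. Decay of the sources in n therefore passes to
the pairing. -/
theorem IsRayleigh.exists_norm_pairing_le (hR : IsRayleigh r c) (k : ℕ) : ∃ K, 0 ≤ K ∧
    ∀ (n : ℤ), n ≠ 0 → ∀ (h : Fin 2 → ℂ) (H : Fin 2 → ℝ → ℂ) (B : ℝ), 0 ≤ B → (∀ i, ‖h i‖ ≤ B) →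
      (∀ i s, 0 ≤ s → ‖H i s‖ ≤ B * (1 + s) ^ k) → ‖pairing r c n h H‖ ≤ K * B := by
  obtain ⟨K, hK0, hK⟩ := hR.exists_norm_mode_le
  have hint := integrableOn_dex_mul_pow hR.decS_pos one_ne_zero k
  have hI : 0 ≤ ∫ s in Ioi (0 : ℝ), dex (decS c) 1 s * (1 + s) ^ k :=
    setIntegral_nonneg measurableSet_Ioi fun s hs => by
      have := dex_pos (decS c) 1 s
      have hs' : (0 : ℝ) < s := hs
      positivity
  refine ⟨2 * K + 2 * K * ∫ s in Ioi (0 : ℝ), dex (decS c) 1 s * (1 + s) ^ k, by positivity, ?_⟩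
  intro n hn h H B hB hh hH
  have hs2 : ∀ (f : Fin 2 → ℂ) (M : ℝ), (∀ i, ‖f i‖ ≤ M) → ‖∑ i, f i‖ ≤ 2 * M := by
    intro f M hf
    refine (norm_sum_le _ _).trans ((Finset.sum_le_sum fun i _ => hf i).trans ?_)
    simp
  have h1 : ‖∑ i, rmode r c (-n) 0 i * h i‖ ≤ 2 * (K * B) := by
    refine hs2 _ _ fun i => ?_
    rw [norm_mul]
    have := (hK (-n) 0 le_rfl).1 i
    rw [dex_zero, mul_one] at this
    exact mul_le_mul this (hh i) (norm_nonneg _) hK0.le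
  have h2 : ‖∫ s in Ioi (0 : ℝ), ∑ i, rmode r c (-n) s i * H i s‖
      ≤ ∫ s in Ioi (0 : ℝ), 2 * K * B * (dex (decS c) 1 s * (1 + s) ^ k) := by
    refine norm_integral_le_of_norm_le (hint.const_mul _)
      ((ae_restrict_iff' measurableSet_Ioi).mpr (Filter.Eventually.of_forall fun s hs => ?_))
    have hs' : 0 ≤ s := (mem_Ioi.mp hs).le
    have hdex : dex (decS c) (-n) s ≤ dex (decS c) 1 s := by
      refine Real.exp_le_exp.mpr (neg_le_neg ?_)
      have hn1 : (1 : ℝ) ≤ |(n : ℝ)| := by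
        have : 1 ≤ |n| := Int.one_le_abs hn
        exact_mod_cast this
      rw [abs_neg, abs_one]
      have := hR.decS_pos
      gcongr
    rw [show 2 * K * B * (dex (decS c) 1 s * (1 + s) ^ k)
      = 2 * ((K * dex (decS c) 1 s) * (B * (1 + s) ^ k)) by ring]
    refine hs2 _ _ fun i => ?_
    rw [norm_mul]
    exact mul_le_mul (((hK (-n) s hs').1 i).trans (mul_le_mul_of_nonneg_left hdex hK0.le))
      (hH i s hs') (norm_nonneg _) (mul_nonneg hK0.le (dex_pos _ _ _).le)
  rw [integral_const_mul] at h2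
  unfold pairing
  refine (norm_sub_le _ _).trans ((add_le_add h1 h2).trans (le_of_eq ?_))
  ring

/-! ### The solvability condition -/

/-- For these j the defining integral runs from 0 to Y and is empty at the boundary, so only the two
integrals over the half line reach the solvability condition. -/
theorem tau_eq_zero {U : ℕ → Profile} {k : ℕ} {n : ℤ} {j : Fin 4} (t x : ℝ)
    (hj : (0 < n ∧ j < 2) ∨ (n < 0 ∧ 2 ≤ j)) : tau T r c U k n j t x 0 = 0 := by
  simp [tau, if_pos hj]

theorem tau_eq {U : ℕ → Profile} {k : ℕ} {n : ℤ} {j : Fin 4} (t x : ℝ)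
    (hj : ¬((0 < n ∧ j < 2) ∨ (n < 0 ∧ 2 ≤ j))) : tau T r c U (k + 1) n j t x 0
      = -∫ s in Ioi (0 : ℝ), Complex.exp (Complex.I * n * om r c j * ((0 : ℝ) - s)) *
        srcComp r c n j (fun i => srcMod T r c U k n i t x s) := by
  simp only [tau, if_neg hj, Nat.add_sub_cancel]

theorem srcComp_linear (n : ℤ) (j : Fin 4) : ∃ A B : ℂ, ∀ f : Fin 2 → ℂ,
    srcComp r c n j f = A * f 0 + B * f 1 := by
  unfold srcComp
  by_cases hj : j = 0 ∨ j = 2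
  · refine ⟨om r c j / (2 * Complex.I * om r c j * c ^ 2 * n),
      -(1 / (2 * Complex.I * om r c j * c ^ 2 * n)), fun f => ?_⟩
    simp only [if_pos hj]; ring
  · refine ⟨-(1 / (2 * Complex.I * om r c j * c ^ 2 * n)),
      -(om r c j / (2 * Complex.I * om r c j * c ^ 2 * n)), fun f => ?_⟩
    simp only [if_neg hj]; ring

theorem temperate_srcComp (n : ℤ) (j : Fin 4) {H : Fin 2 → ℝ → ℂ} (hH : ∀ i, Temperate (H i)) :
    Temperate (fun s => srcComp r c n j (fun i => H i s)) := by
  obtain ⟨A, B, hAB⟩ := srcComp_linear (r := r) (c := c) n j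
  simp only [hAB]
  exact ((hH 0).const_mul A).add ((hH 1).const_mul B)

/-- The action of the boundary operator and the cokernel on an outgoing eigenvector. -/
def bdCoef (r c : ℝ) (n : ℤ) (j : Fin 4) : ℂ := coker r c n ⬝ᵥ (bdMat r n *ᵥ Rvec r c n j)

theorem bdCoef_eq (n : ℤ) (j : Fin 4) : bdCoef r c n j
    = coker r c n 0 * (Complex.I * n * Rvec r c n j 1 + Rvec r c n j 2)
      + coker r c n 1 * ((r - 2) * (Complex.I * n) * Rvec r c n j 0 + r * Rvec r c n j 3) := by
  simp [bdCoef, bdMat, Matrix.mulVec, dotProduct, Fin.sum_univ_succ]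

theorem om_apply (r c : ℝ) : om r c 0 = Complex.I * decS c ∧ om r c 1 = Complex.I * decP r c ∧
    om r c 2 = -(Complex.I * decS c) ∧ om r c 3 = -(Complex.I * decP r c) := ⟨rfl, rfl, rfl, rfl⟩

/-- The cokernel applied to the outgoing parts is the pairing with the Rayleigh mode. -/
theorem IsRayleigh.pairing_pointwise (h : IsRayleigh r c) {n : ℤ} (hn : n ≠ 0) {σ : ℝ}
    (hσ : σ ^ 2 = 1) (hσn : (SignType.sign (n : ℝ) : ℝ) = σ) (hσc : coker r c n
      = ![(qR r c : ℂ), Complex.I * σ * decP r c]) {j j' : Fin 4} (hj : j = 0 ∨ j = 2)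
    (hj' : ¬(j' = 0 ∨ j' = 2)) (hoj : om r c j = -(Complex.I * σ * decS c))
    (hoj' : om r c j' = -(Complex.I * σ * decP r c)) (f : Fin 2 → ℂ) (s : ℝ) :
    bdCoef r c n j * (Complex.exp (Complex.I * n * om r c j * ((0 : ℝ) - s)) * srcComp r c n j f)
    + bdCoef r c n j' * (Complex.exp (Complex.I * n * om r c j' * ((0 : ℝ) - s))
      * srcComp r c n j' f)
      = 1 / (1 - qR r c) * ∑ i, rmode r c (-n) s i * f i := by
  have hS := h.decS_sq
  have hP := h.decP_sq
  have hq := h.q_sq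
  have hR := h.rayleigh
  have h1q := h.one_sub_q
  have ha0 := h.decS_pos.ne'
  have hb0 := h.decP_pos.ne'
  have hc0 := h.pos.ne'
  have habs : σ * n = |(n : ℝ)| := by rw [← hσn, sign_mul_self']
  have hsgn : (SignType.sign (-(n : ℝ)) : ℝ) = -σ := by 
    rw [Left.sign_neg, SignType.coe_neg, hσn]
  have hexp : ∀ a : ℝ, Complex.exp (Complex.I * n * -(Complex.I * σ * a) * ((0 : ℝ) - s))
      = (dex a n s : ℂ) := by
    intro a
    rw [dex, ← habs, Complex.ofReal_exp]
    congr 1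
    push_cast
    linear_combination (n * σ * a * s : ℂ) * Complex.I_sq
  simp only [Fin.sum_univ_two, rmode_apply_zero, rmode_apply_one, hsgn, dex_neg]
  generalize decS c = a at *
  generalize decP r c = b at *
  generalize qR r c = q at *
  have hσ0 : σ ≠ 0 := by rintro rfl; simp at hσ
  have hn0 : (n : ℂ) ≠ 0 := by exact_mod_cast hn
  have hσC : (σ : ℂ) ^ 2 = 1 := by exact_mod_cast hσ
  have hSC : (a : ℂ) ^ 2 = 1 - c ^ 2 := by exact_mod_cast hS
  have hPC : (r : ℂ) * b ^ 2 = r - c ^ 2 := by exact_mod_cast hP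
  have hqC : (q : ℂ) ^ 2 = a * b := by exact_mod_cast hq
  have hRC : 2 - (c : ℂ) ^ 2 = 2 * q := by exact_mod_cast hR
  have hI := Complex.I_sq
  -- Here the Rayleigh relation 2 - c² = 2q and q² = ab (a and b being the two decay rates) reduce
  -- the boundary coefficient of the shear vector to a monomial; `k2` does the same for the pressure
  -- vector.
  have k1 : bdCoef r c n j = 4 * Complex.I * n * q ^ 2 := by
    rw [bdCoef_eq, hσc]
    simp only [Rvec, if_pos hj, hoj, Matrix.cons_val_zero, Matrix.cons_val_one, Matrix.cons_val]
    linear_combination (-(Complex.I * n * σ ^ 2 * (a ^ 2 * q + 2 * a * b))) * hI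
      + Complex.I * n * (a ^ 2 * q + 2 * a * b) * hσC + Complex.I * n * q * hSC
      + Complex.I * n * q * hRC - 2 * Complex.I * n * hqC
  have k2 : bdCoef r c n j' = -(4 * Complex.I * n * q * (Complex.I * σ * b)) := by
    rw [bdCoef_eq, hσc]
    simp only [Rvec, if_neg hj', hoj', Matrix.cons_val_zero, Matrix.cons_val_one, Matrix.cons_val]
    linear_combination (Complex.I * n * (Complex.I * σ * b) * r * σ ^ 2 * b ^ 2) * hI
      - Complex.I * n * (Complex.I * σ * b) * r * b ^ 2 * hσC
      - Complex.I * n * (Complex.I * σ * b) * hPC - Complex.I * n * (Complex.I * σ * b) * hRC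
  rw [k1, k2, hoj, hoj', hexp, hexp]
  simp only [srcComp, if_pos hj, if_neg hj', hoj, hoj']
  have hcC : (c : ℂ) ^ 2 ≠ 0 := pow_ne_zero 2 (by exact_mod_cast hc0)
  have haC : (a : ℂ) ≠ 0 := by exact_mod_cast ha0
  have hbC : (b : ℂ) ≠ 0 := by exact_mod_cast hb0
  have hσ0' : (σ : ℂ) ≠ 0 := by exact_mod_cast hσ0
  have h1qC : (1 : ℂ) - q = c ^ 2 / 2 := by exact_mod_cast h1q
  have hY : ∀ z : ℂ, z ≠ 0 → 2 * Complex.I * -(Complex.I * σ * z) * (c : ℂ) ^ 2 * n ≠ 0 := by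
    intro z hz
    have := Complex.I_ne_zero
    exact mul_ne_zero (mul_ne_zero (mul_ne_zero (mul_ne_zero two_ne_zero this)
      (neg_ne_zero.mpr (mul_ne_zero (mul_ne_zero this hσ0') hz))) hcC) hn0
  have t1 : 4 * Complex.I * n * q ^ 2 * ((-(Complex.I * σ * a) * f 0 - f 1)
      / (2 * Complex.I * -(Complex.I * σ * a) * (c : ℂ) ^ 2 * n))
      = 2 * (q ^ 2 * f 0 - Complex.I * σ * b * f 1) / c ^ 2 := by
    rw [← mul_div_assoc, div_eq_div_iff (hY _ haC) hcC]
    linear_combination (f 1 * (-(4 * Complex.I * n * c ^ 2))) * (hqC + a * b * σ ^ 2 * hI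
      - a * b * hσC)
  have t2 : -(4 * Complex.I * n * q * (Complex.I * σ * b)) * (-(f 0 + -(Complex.I * σ * b) * f 1)
      / (2 * Complex.I * -(Complex.I * σ * b) * (c : ℂ) ^ 2 * n))
      = 2 * (-(q * f 0) + Complex.I * σ * b * q * f 1) / c ^ 2 := by
    rw [← mul_div_assoc, div_eq_div_iff (hY _ hbC) hcC]
    ring
  rw [h1qC]
  push_cast
  linear_combination (dex a n s : ℂ) * t1 + (dex b n s : ℂ) * t2

/-- The solvability condition in terms of the pairing with the Rayleigh mode. -/
theorem IsRayleigh.coker_bdRhs (h : IsRayleigh r c) {F : Fin 2 → (Fin 3 → ℝ) → ℝ}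
    {U : ℕ → Profile} {k : ℕ} {n : ℤ} (hn : n ≠ 0) (t x : ℝ)
    (hH : ∀ i, Temperate (srcMod T r c U k n i t x)) :
    coker r c n ⬝ᵥ bdRhs T r c F U (k + 1) n t x
      = -(1 / (1 - qR r c)) * pairing r c n (fun i => mode n (srcBd T r F U k i) t x 0 0)
          (fun i => srcMod T r c U k n i t x) := by
  obtain ⟨o1, o2, o3, o4⟩ := om_apply r c
  have hlin : coker r c n ⬝ᵥ bdRhs T r c F U (k + 1) n t x
      = ∑ i, coker r c n i * mode n (srcBd T r F U k i) t x 0 0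
        - ∑ j, bdCoef r c n j * tau T r c U (k + 1) n j t x 0 := by
    rw [bdRhs, dotProduct_sub, Nat.add_sub_cancel]
    congr 1
    rw [UpTilde, Matrix.mulVec_sum, dotProduct_sum]
    refine Finset.sum_congr rfl fun j _ => ?_
    rw [Matrix.mulVec_smul, dotProduct_smul, smul_eq_mul, mul_comm]
    rfl
  -- The row ℓ_n is -1/(1-q) times the boundary value of the Rayleigh mode of frequency -n.
  have hcoker : ∀ σ : ℝ, (SignType.sign (n : ℝ) : ℝ) = σ →
      coker r c n = ![(qR r c : ℂ), Complex.I * σ * decP r c] →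
      ∑ i, coker r c n i * mode n (srcBd T r F U k i) t x 0 0 = -(1 / (1 - qR r c))
        * ∑ i, rmode r c (-n) 0 i * mode n (srcBd T r F U k i) t x 0 0 := by
    intro σ hσ hc
    have h1 : (1 : ℂ) - qR r c ≠ 0 := by exact_mod_cast h.one_sub_q_pos.ne'
    simp only [hc, Fin.sum_univ_two, rmode_apply_zero, rmode_apply_one, dex_zero, Left.sign_neg,
      SignType.coe_neg, hσ, Matrix.cons_val_zero, Matrix.cons_val_one]
    push_cast
    field_simp
    ring
  have hint : ∀ j (a : ℝ), 0 < a → om r c j = -(Complex.I * (SignType.sign (n : ℝ) : ℝ) * a) →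
      IntegrableOn (fun s : ℝ => Complex.exp (Complex.I * n * om r c j * ((0 : ℝ) - s))
        * srcComp r c n j (fun i => srcMod T r c U k n i t x s)) (Ioi 0) := by
    intro j a ha ho
    refine (temperate_srcComp n j hH).integrableOn_mul (K := 1) (by fun_prop) ha
      (ν := n) (by exact_mod_cast hn) fun s hs => le_of_eq ?_
    have habs := sign_mul_self' (n : ℝ)
    have e : Complex.I * n * om r c j * ((0 : ℝ) - s) = ((-(|(n : ℝ)| * a * s) : ℝ) : ℂ) := by
      rw [ho, ← habs]
      push_cast
      linear_combination (n * (SignType.sign (n : ℝ) : ℝ) * a * s : ℂ) * Complex.I_sq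
    rw [e, ← Complex.ofReal_exp, Complex.norm_real, Real.norm_of_nonneg (Real.exp_pos _).le,
      one_mul, dex]
  -- Both signs of n are treated together: σ = sgn n, and j, j' are the shear and pressure indices
  -- whose integrals run over the half line, that is 0, 1 for n < 0 and 2, 3 for n > 0.
  have main : ∀ (σ : ℝ) (j j' : Fin 4), σ ^ 2 = 1 → (SignType.sign (n : ℝ) : ℝ) = σ →
      coker r c n = ![(qR r c : ℂ), Complex.I * σ * decP r c] → (j = 0 ∨ j = 2) →
      ¬(j' = 0 ∨ j' = 2) → om r c j = -(Complex.I * σ * decS c) →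
      om r c j' = -(Complex.I * σ * decP r c) →
      ¬((0 < n ∧ j < 2) ∨ (n < 0 ∧ 2 ≤ j)) → ¬((0 < n ∧ j' < 2) ∨ (n < 0 ∧ 2 ≤ j')) →
      ∑ j, bdCoef r c n j * tau T r c U (k + 1) n j t x 0
        = bdCoef r c n j * tau T r c U (k + 1) n j t x 0
          + bdCoef r c n j' * tau T r c U (k + 1) n j' t x 0 →
      coker r c n ⬝ᵥ bdRhs T r c F U (k + 1) n t x
      = -(1 / (1 - qR r c)) * pairing r c n (fun i => mode n (srcBd T r F U k i) t x 0 0)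
          (fun i => srcMod T r c U k n i t x) := by
    intro σ j j' hσ hσn hσc hj hj' hoj hoj' hcj hcj' hsum
    have i1 := (hint j _ h.decS_pos (by rw [hσn, hoj])).const_mul (bdCoef r c n j)
    have i2 := (hint j' _ h.decP_pos (by rw [hσn, hoj'])).const_mul (bdCoef r c n j')
    rw [hlin, hsum, hcoker σ hσn hσc, tau_eq t x hcj, tau_eq t x hcj', mul_neg, mul_neg,
      ← integral_const_mul, ← integral_const_mul, ← neg_add, ← integral_add i1 i2]
    simp only [h.pairing_pointwise hn hσ hσn hσc hj hj' hoj hoj']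
    rw [integral_const_mul, pairing]
    ring
  rcases lt_or_gt_of_ne hn with hneg | hpos
  · have hs : (SignType.sign (n : ℝ) : ℝ) = -1 := by
      rw [sign_neg (by exact_mod_cast hneg)]; simp
    refine main (-1) 0 1 (by norm_num) hs ?_ (by decide) (by decide) (by rw [o1]; push_cast; ring)
      (by rw [o2]; push_cast; ring) (by simp [hneg.le]) (by simp [hneg.le]) ?_
    · rw [coker, if_neg (by omega), o2]
      simp
    · rw [Fin.sum_univ_four, tau_eq_zero (j := 2) t x (Or.inr ⟨hneg, le_rfl⟩),
        tau_eq_zero (j := 3) t x (Or.inr ⟨hneg, by decide⟩)]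
      ring
  · have hs : (SignType.sign (n : ℝ) : ℝ) = 1 := by
      rw [sign_pos (by exact_mod_cast hpos)]; simp
    refine main 1 2 3 (by norm_num) hs ?_ (by decide) (by decide) (by rw [o3]; push_cast; ring)
      (by rw [o4]; push_cast; ring) (by simp [hpos.le]) ?_ ?_
    · rw [coker, if_pos hpos, o2]
      simp
    · rintro (⟨-, h3⟩ | ⟨h3, -⟩)
      · exact absurd h3 (by decide)
      · omega
    · rw [Fin.sum_univ_four, tau_eq_zero (j := 0) t x (Or.inl ⟨hpos, by decide⟩),
        tau_eq_zero (j := 1) t x (Or.inl ⟨hpos, by decide⟩)]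
      ring

end

/-! ## Fourier modes of the leading part of the sources -/

section

variable {T : ℝ}

theorem mode_congr {f g : (Fin 5 → ℝ) → ℝ} (h : EqOn f g (univ.pi (domAll T))) {t x y Y : ℝ}
    (ht : t ∈ Icc 0 T) (hy : 0 ≤ y) (hY : 0 ≤ Y) (n : ℤ) :
    mode n f t x y Y = mode n g t x y Y :=
  fc_congr n fun θ => by rw [h (mem_domAll ht hy hY)]

theorem IsReg.mode_add (hT : 0 < T) {f g : (Fin 5 → ℝ) → ℝ} (hf : IsReg T f) (hg : IsReg T g)
    {t x y Y : ℝ} (ht : t ∈ Icc 0 T) (hy : 0 ≤ y) (hY : 0 ≤ Y) (n : ℤ) :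
    mode n (fun p => f p + g p) t x y Y = mode n f t x y Y + mode n g t x y Y := by
  simp only [mode_eq_modeAt n _ t x y 0 Y]
  exact hf.per.modeAt_add (perBox_domAll hT) hg.per (mem_domAll ht hy hY) n

theorem IsReg.mode_sub (hT : 0 < T) {f g : (Fin 5 → ℝ) → ℝ} (hf : IsReg T f) (hg : IsReg T g)
    {t x y Y : ℝ} (ht : t ∈ Icc 0 T) (hy : 0 ≤ y) (hY : 0 ≤ Y) (n : ℤ) :
    mode n (fun p => f p - g p) t x y Y = mode n f t x y Y - mode n g t x y Y := by
  simp only [mode_eq_modeAt n _ t x y 0 Y]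
  exact hf.per.modeAt_sub (perBox_domAll hT) hg.per (mem_domAll ht hy hY) n

theorem mode_const_mul (a : ℝ) (f : (Fin 5 → ℝ) → ℝ) (t x y Y : ℝ) (n : ℤ) :
    mode n (fun p => a * f p) t x y Y = a * mode n f t x y Y := by
  simp only [mode_eq_modeAt n _ t x y 0 Y]
  exact modeAt_const_mul a f _ n

theorem mode_neg (f : (Fin 5 → ℝ) → ℝ) (t x y Y : ℝ) (n : ℤ) :
    mode n (fun p => -f p) t x y Y = -mode n f t x y Y := by
  simp only [mode_eq_modeAt n _ t x y 0 Y]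
  exact modeAt_neg f _ n

theorem IsReg.mode_sum (hT : 0 < T) {ι : Type*} (s : Finset ι) {f : ι → (Fin 5 → ℝ) → ℝ}
    (hf : ∀ i, IsReg T (f i)) {t x y Y : ℝ} (ht : t ∈ Icc 0 T) (hy : 0 ≤ y) (hY : 0 ≤ Y) (n : ℤ) :
    mode n (fun p => ∑ i ∈ s, f i p) t x y Y = ∑ i ∈ s, mode n (f i) t x y Y := by
  classical
  induction s using Finset.induction_on with
  | empty => simp [mode, fc]
  | insert a s ha ih =>
    simp only [Finset.sum_insert ha]
    rw [(hf a).mode_add hT (IsReg.sum hT s fun i _ => hf i) ht hy hY, ih]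

theorem IsReg.mode_pd_three (hT : 0 < T) {f : (Fin 5 → ℝ) → ℝ} (hf : IsReg T f)
    {t x y Y : ℝ} (ht : t ∈ Icc 0 T) (hy : 0 ≤ y) (hY : 0 ≤ Y) (n : ℤ) :
    mode n (RayleighWave.pd (domAll T) 3 f) t x y Y = Complex.I * n * mode n f t x y Y := by
  simp only [mode_eq_modeAt n _ t x y 0 Y]
  exact hf.per.modeAt_pd_self (perBox_domAll hT) (mem_domAll ht hy hY) n

/-- A known form of the mode on all Y ≥ 0 determines its Y-derivative, by uniqueness of one-sided
derivatives, also at Y = 0. The companions for y, t and x work in the same way. -/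
theorem IsReg.mode_pd_four (hT : 0 < T) {f : (Fin 5 → ℝ) → ℝ} (hf : IsReg T f)
    {t x y Y : ℝ} (ht : t ∈ Icc 0 T) (hy : 0 ≤ y) (hY : 0 ≤ Y) (n : ℤ) {φ : ℝ → ℂ} {φ' : ℂ}
    (hφ : ∀ s, 0 ≤ s → mode n f t x y s = φ s) (hd : HasDerivAt φ φ' Y) :
    mode n (RayleighWave.pd (domAll T) 4 f) t x y Y = φ' := by
  have h := hf.hasDerivWithinAt_mode hT ht hy hY (x := x) n
  exact (uniqueDiffOn_Ici 0 Y hY).eq_deriv _ h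
    (hd.hasDerivWithinAt.congr (fun s hs => hφ s hs) (hφ Y hY))

theorem IsReg.mode_pd_two (hT : 0 < T) {f : (Fin 5 → ℝ) → ℝ} (hf : IsReg T f)
    {t x y Y : ℝ} (ht : t ∈ Icc 0 T) (hy : 0 ≤ y) (hY : 0 ≤ Y) (n : ℤ) {κ : ℂ}
    (hφ : ∀ s, 0 ≤ s → mode n f t x s Y = κ) :
    mode n (RayleighWave.pd (domAll T) 2 f) t x y Y = 0 := by
  have h := hf.per.hasDerivWithinAt_modeAt (perBox_domAll hT)
    (mem_domAll (x := x) (θ := 0) ht hy hY) (i := 2) (by decide) n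
  rw [← mode_eq_modeAt] at h
  have e : ∀ s, modeAt 3 n f (Function.update ![t, x, y, 0, Y] 2 s) = mode n f t x s Y := by
    intro s
    rw [mode_eq_modeAt n f t x s 0 Y]
    congr 1
    ext i; fin_cases i <;> rfl
  simp only [e] at h
  refine (uniqueDiffOn_Ici 0 y hy).eq_deriv _ h ?_
  exact (hasDerivWithinAt_const y (Ici 0) κ).congr (fun s hs => hφ s hs) (hφ y hy)

/-- If in t the mode is a Fourier coefficient of β times a constant, the t-derivative falls on β. -/
theorem IsReg.mode_pd_zero (hT : 0 < T) {f : (Fin 5 → ℝ) → ℝ} (hf : IsReg T f)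
    {β : (Fin 3 → ℝ) → ℝ} (hβ : SmoothPerOn (domBd T) 2 β)
    {t x y Y : ℝ} (ht : t ∈ Icc 0 T) (hy : 0 ≤ y) (hY : 0 ≤ Y) (n : ℤ) {κ : ℂ}
    (hφ : ∀ s ∈ Icc 0 T, mode n f s x y Y = fc n (slice β s x) * κ) :
    mode n (RayleighWave.pd (domAll T) 0 f) t x y Y
      = fc n (slice (RayleighWave.pd (domBd T) 0 β) t x) * κ := by
  have h := hf.per.hasDerivWithinAt_modeAt (perBox_domAll hT)
    (mem_domAll (x := x) (θ := 0) ht hy hY) (i := 0) (by decide) n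
  have h' := (hβ.hasDerivWithinAt_modeAt (perBox_domBd hT)
    (mem_domBd (x := x) (θ := 0) ht) (i := 0) (by decide) n).mul_const κ
  rw [← mode_eq_modeAt] at h
  rw [← fc_slice_eq_modeAt] at h'
  have e : ∀ s, modeAt 3 n f (Function.update ![t, x, y, 0, Y] 0 s) = mode n f s x y Y := by
    intro s
    rw [mode_eq_modeAt n f s x y 0 Y]
    congr 1
    ext i; fin_cases i <;> rfl
  have e' : ∀ s, modeAt 2 n β (Function.update ![t, x, 0] 0 s) = fc n (slice β s x) := by
    intro s
    rw [fc_slice_eq_modeAt n β s x 0]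
    congr 1
    ext i; fin_cases i <;> rfl
  simp only [e] at h
  simp only [e'] at h'
  exact (uniqueDiffOn_Icc hT t ht).eq_deriv _ h (h'.congr (fun s hs => hφ s hs) (hφ t ht))

theorem IsReg.mode_pd_one (hT : 0 < T) {f : (Fin 5 → ℝ) → ℝ} (hf : IsReg T f)
    {β : (Fin 3 → ℝ) → ℝ} (hβ : SmoothPerOn (domBd T) 2 β)
    {t x y Y : ℝ} (ht : t ∈ Icc 0 T) (hy : 0 ≤ y) (hY : 0 ≤ Y) (n : ℤ) {κ : ℂ}
    (hφ : ∀ s, mode n f t s y Y = fc n (slice β t s) * κ) :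
    mode n (RayleighWave.pd (domAll T) 1 f) t x y Y
      = fc n (slice (RayleighWave.pd (domBd T) 1 β) t x) * κ := by
  have h := hf.per.hasDerivWithinAt_modeAt (perBox_domAll hT)
    (mem_domAll (x := x) (θ := 0) ht hy hY) (i := 1) (by decide) n
  have h' := (hβ.hasDerivWithinAt_modeAt (perBox_domBd hT)
    (mem_domBd (x := x) (θ := 0) ht) (i := 1) (by decide) n).mul_const κ
  rw [← mode_eq_modeAt] at h
  rw [← fc_slice_eq_modeAt] at h'
  have e : ∀ s, modeAt 3 n f (Function.update ![t, x, y, 0, Y] 1 s) = mode n f t s y Y := by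
    intro s
    rw [mode_eq_modeAt n f t s y 0 Y]
    congr 1
    ext i; fin_cases i <;> rfl
  have e' : ∀ s, modeAt 2 n β (Function.update ![t, x, 0] 1 s) = fc n (slice β t s) := by
    intro s
    rw [fc_slice_eq_modeAt n β t s 0]
    congr 1
    ext i; fin_cases i <;> rfl
  simp only [e] at h
  simp only [e'] at h'
  exact (uniqueDiffOn_univ x (mem_univ x)).eq_deriv _ h
    (h'.congr (fun s _ => hφ s) (hφ x))

/-- The temperate functions that come from regular functions. -/
theorem IsReg.temperate_mode (hT : 0 < T) {f : (Fin 5 → ℝ) → ℝ} (hf : IsReg T f)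
    {t x y : ℝ} (ht : t ∈ Icc 0 T) (hy : 0 ≤ y) (n : ℤ) :
    Temperate (fun s => mode n f t x y s) := by
  obtain ⟨C, hC0, hC⟩ := hf.exists_norm_mode_le hT ht hy (x := x)
  refine ⟨hf.continuousOn_mode hT ht hy n, C * wt n, 0, mul_nonneg hC0 (wt_nonneg n),
    fun s hs => ?_⟩
  rw [pow_zero, mul_one]
  exact hC n s hs

theorem smoothPer_slice (hT : 0 < T) {β : (Fin 3 → ℝ) → ℝ} (hβ : SmoothPerOn (domBd T) 2 β)
    {t x : ℝ} (ht : t ∈ Icc 0 T) : SmoothPer (slice β t x) := by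
  constructor
  · have h : ContDiff ℝ ∞ fun θ : ℝ => β ![t, x, θ] := by
      rw [← contDiffOn_univ]
      refine hβ.smooth.comp (t := univ.pi (domBd T)) ?_ fun θ _ => mem_domBd ht
      refine (contDiff_pi.mpr fun i => ?_).contDiffOn
      fin_cases i
      · exact contDiff_const
      · exact contDiff_const
      · exact contDiff_id
    exact Complex.ofRealCLM.contDiff.comp h
  · intro θ
    have := hβ.periodic (perBox_domBd hT) (mem_domBd (x := x) (θ := 0) ht) θ
    have e : ∀ s, Function.update ![t, x, 0] 2 s = ![t, x, s] := by
      intro s; ext i; fin_cases i <;> rfl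
    simp only [e] at this
    exact this

end

/-! ### Modes of the operators and stresses on superpositions of Rayleigh modes -/

section

variable {T r c : ℝ}

/-- Profiles whose oscillating modes are Rayleigh modes with the amplitude `β`. -/
structure RayleighModes (T r c : ℝ) (D : Profile) (β : (Fin 3 → ℝ) → ℝ) : Prop where
  reg : RegProfile T D
  amp : SmoothPerOn (domBd T) 2 β
  osc : ∀ n : ℤ, n ≠ 0 → ∀ t ∈ Icc 0 T, ∀ x y Y : ℝ, 0 ≤ y → 0 ≤ Y → ∀ i,
    mode n (D.eval i) t x y Y = fc n (slice β t x) * rmode r c n Y i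
  mean : ∀ t ∈ Icc 0 T, ∀ x y : ℝ, 0 ≤ y → ∀ i, ∃ κ : ℂ, ∀ Y, 0 ≤ Y →
    mode 0 (D.eval i) t x y Y = κ

/-- The formula includes n = 0: the mean has no fast derivatives, and the Rayleigh gradient of
frequency zero vanishes. -/
theorem RayleighModes.mode_grad (hT : 0 < T) {D : Profile} {β : (Fin 3 → ℝ) → ℝ}
    (h : RayleighModes T r c D β) {t x y Y : ℝ} (ht : t ∈ Icc 0 T) (hy : 0 ≤ y) (hY : 0 ≤ Y)
    (n : ℤ) (i j : Fin 2) :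
    mode n (fun p => grad T 1 D p i j) t x y Y = fc n (slice β t x) * gradMode r c n Y i j := by
  by_cases hn : n = 0
  · subst hn
    rw [Int.cast_zero, gradMode_zero_freq, Matrix.zero_apply, mul_zero]
    revert j
    rw [Fin.forall_fin_two]
    constructor
    · refine ((h.reg i).mode_pd_three hT ht hy hY 0).trans ?_
      simp
    · obtain ⟨κ, hκ⟩ := h.mean t ht x y hy i
      exact (h.reg i).mode_pd_four hT ht hy hY 0 hκ (hasDerivAt_const Y κ)
  · revert j
    rw [Fin.forall_fin_two]
    constructor
    · refine ((h.reg i).mode_pd_three hT ht hy hY n).trans ?_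
      rw [h.osc n hn t ht x y Y hy hY i, gradMode_col_zero]
      push_cast; ring
    · exact (h.reg i).mode_pd_four hT ht hy hY n
        (fun s hs => h.osc n hn t ht x y s hy hs i) ((hasDerivAt_rmode _ Y i).const_mul _)

/-- The oscillating modes do not depend on the slow variable y, so the mixed derivatives ∂_{yθ} and
∂_{yY} contribute nothing. -/
theorem RayleighModes.mode_opLfs (hT : 0 < T) {D : Profile} {β : (Fin 3 → ℝ) → ℝ}
    (h : RayleighModes T r c D β) {t x y Y : ℝ} (ht : t ∈ Icc 0 T) (hy : 0 ≤ y) (hY : 0 ≤ Y)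
    {n : ℤ} (hn : n ≠ 0) (i : Fin 2) :
    mode n (opLfs T r c D i) t x y Y
      = -2 * c * (fc n (slice (pd (domBd T) 0 β) t x) * (Complex.I * n * rmode r c n Y i))
        - ((![2 * r, 2] i : ℝ) : ℂ)
          * (fc n (slice (pd (domBd T) 1 β) t x) * (Complex.I * n * rmode r c n Y i))
        - (r - 1) * (fc n (slice (pd (domBd T) 1 β) t x) * gradMode r c n Y (1 - i) 1) := by
  have h3 : ∀ i, ∀ t ∈ Icc 0 T, ∀ x y, 0 ≤ y → mode n (pd (domAll T) 3 (D.eval i)) t x y Y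
      = fc n (slice β t x) * (Complex.I * n * rmode r c n Y i) := by
    intro i t ht x y hy
    rw [(h.reg i).mode_pd_three hT ht hy hY n, h.osc n hn t ht x y Y hy hY i]; ring
  have h4 : ∀ i, ∀ t ∈ Icc 0 T, ∀ x y, 0 ≤ y → mode n (pd (domAll T) 4 (D.eval i)) t x y Y
      = fc n (slice β t x) * gradMode r c n Y i 1 := by
    intro i t ht x y hy
    exact h.mode_grad hT ht hy hY n i 1
  have k1 : mode n (pd2 T 0 3 D i) t x y Y = _ :=
    ((h.reg i).pd hT 3).mode_pd_zero hT h.amp ht hy hY n fun s hs => h3 i s hs x y hy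
  have k2 : mode n (pd2 T 1 3 D i) t x y Y = _ :=
    ((h.reg i).pd hT 3).mode_pd_one hT h.amp ht hy hY n fun s => h3 i t ht s y hy
  have k3 : mode n (pd2 T 1 4 D (1 - i)) t x y Y = _ :=
    ((h.reg (1 - i)).pd hT 4).mode_pd_one hT h.amp ht hy hY n fun s => h4 (1 - i) t ht s y hy
  have k4 : mode n (pd2 T 2 3 D (1 - i)) t x y Y = 0 :=
    ((h.reg (1 - i)).pd hT 3).mode_pd_two hT ht hy hY n fun s hs => h3 (1 - i) t ht x s hs
  have k5 : mode n (pd2 T 2 4 D i) t x y Y = 0 :=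
    ((h.reg i).pd hT 4).mode_pd_two hT ht hy hY n fun s hs => h4 i t ht x s hs
  have r1 := (h.reg.pd2 hT 0 3 i).const_mul hT (-2 * c)
  have r2 := (h.reg.pd2 hT 1 3 i).const_mul hT (![2 * r, 2] i)
  have r3 := ((h.reg.pd2 hT 1 4 (1 - i)).add hT (h.reg.pd2 hT 2 3 (1 - i))).const_mul hT (r - 1)
  have r4 := (h.reg.pd2 hT 2 4 i).const_mul hT (![2, 2 * r] i)
  have e : mode n (opLfs T r c D i) t x y Y = _ :=
    ((r1.sub hT r2).sub hT r3).mode_sub hT r4 ht hy hY n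
  rw [e, (r1.sub hT r2).mode_sub hT r3 ht hy hY, r1.mode_sub hT r2 ht hy hY]
  simp only [mode_const_mul]
  rw [(h.reg.pd2 hT 1 4 (1 - i)).mode_add hT (h.reg.pd2 hT 2 3 (1 - i)) ht hy hY, k1, k2, k3, k4,
    k5]
  push_cast
  ring

theorem RayleighModes.mode_opls (hT : 0 < T) {D : Profile} {β : (Fin 3 → ℝ) → ℝ}
    (h : RayleighModes T r c D β) {t x y Y : ℝ} (ht : t ∈ Icc 0 T) (hy : 0 ≤ y) (hY : 0 ≤ Y)
    {n : ℤ} (hn : n ≠ 0) (i : Fin 2) :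
    mode n (opls T r D i) t x y Y
      = ((![1, r - 2] i : ℝ) : ℂ)
        * (fc n (slice (pd (domBd T) 1 β) t x) * rmode r c n Y (1 - i)) := by
  have k1 := (h.reg (1 - i)).mode_pd_one hT h.amp (x := x) ht hy hY n
    fun s => h.osc n hn t ht s y Y hy hY (1 - i)
  have k2 := (h.reg i).mode_pd_two hT (x := x) ht hy hY n
    fun s hs => h.osc n hn t ht x s Y hs hY i
  have e : mode n (opls T r D i) t x y Y = _ := 
    (((h.reg (1 - i)).pd hT 1).const_mul hT (![1, r - 2] i)).mode_add hT
    (((h.reg i).pd hT 2).const_mul hT (![1, r] i)) ht hy hY n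
  rw [e]
  simp only [mode_const_mul]
  rw [k1, k2]
  ring

/-! ### The quadratic part -/

theorem hasSum_of_eq {ι : Type*} {f g : ι → ℂ} {a : ℂ} (h : HasSum f a) (e : ∀ i, g i = f i) :
    HasSum g a := (funext e : g = f) ▸ h

/-- The stress is a bilinear contraction of two gradients, so its modes are convolutions of the
gradient modes. -/
theorem RayleighModes.hasSum_mode_crossQ (hT : 0 < T) {P D : Profile} {α β : (Fin 3 → ℝ) → ℝ}
    (hP : RayleighModes T r c P α) (hD : RayleighModes T r c D β) {t x y Y : ℝ}
    (ht : t ∈ Icc 0 T) (hy : 0 ≤ y) (hY : 0 ≤ Y) (n : ℤ) (i j : Fin 2) :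
    HasSum (fun m : ℤ => ∑ a, ∑ b, ∑ k, ∑ l, (coefQ (r - 2) i j a b k l : ℂ)
      * ((fc (n - m) (slice α t x) * gradMode r c (n - m) Y a b)
        * (fc m (slice β t x) * gradMode r c m Y k l)))
      (mode n (crossQ T r P D i j) t x y Y) := by
  have hreg : ∀ a b k l, IsReg T (fun p => coefQ (r - 2) i j a b k l
      * (grad T 1 P p a b * grad T 1 D p k l)) := fun a b k l =>
    ((hP.reg.grad hT 1 a b).mul hT (hD.reg.grad hT 1 k l)).const_mul hT _
  have e : mode n (crossQ T r P D i j) t x y Y = ∑ a, ∑ b, ∑ k, ∑ l,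
      (coefQ (r - 2) i j a b k l : ℂ)
        * mode n (fun p => grad T 1 P p a b * grad T 1 D p k l) t x y Y := by
    have e0 : crossQ T r P D i j = fun p => ∑ a, ∑ b, ∑ k, ∑ l,
      coefQ (r - 2) i j a b k l * (grad T 1 P p a b * grad T 1 D p k l) :=
      funext fun p => crossQ_eq T r P D i j p
    rw [e0, IsReg.mode_sum hT _ (fun a => IsReg.sum hT _ fun b _ => IsReg.sum hT _ fun k _ =>
      IsReg.sum hT _ fun l _ => hreg a b k l) ht hy hY]
    refine Finset.sum_congr rfl fun a _ => ?_
    rw [IsReg.mode_sum hT _ (fun b => IsReg.sum hT _ fun k _ =>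
      IsReg.sum hT _ fun l _ => hreg a b k l) ht hy hY]
    refine Finset.sum_congr rfl fun b _ => ?_
    rw [IsReg.mode_sum hT _ (fun k => IsReg.sum hT _ fun l _ => hreg a b k l) ht hy hY]
    refine Finset.sum_congr rfl fun k _ => ?_
    rw [IsReg.mode_sum hT _ (fun l => hreg a b k l) ht hy hY]
    refine Finset.sum_congr rfl fun l _ => ?_
    rw [mode_const_mul]
  rw [e]
  refine hasSum_sum fun a _ => hasSum_sum fun b _ => hasSum_sum fun k _ => hasSum_sum fun l _ => ?_
  refine HasSum.mul_left _ ?_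
  have hs := (hP.reg.grad hT 1 a b).per.hasSum_modeAt_mul (perBox_domAll hT)
    (hD.reg.grad hT 1 k l).per (mem_domAll (x := x) (θ := 0) ht hy hY) n
  simp only [← mode_eq_modeAt] at hs
  refine hasSum_of_eq hs fun m => ?_
  rw [hP.mode_grad hT ht hy hY, hD.mode_grad hT ht hy hY]
  push_cast
  rfl

end

/-! ## The pairing of the leading part of the sources -/

section

variable {T r c : ℝ}

theorem tendsto_zero_of_le_dex {f : ℝ → ℂ} {K a ν : ℝ} (ha : 0 < a) (hν : ν ≠ 0)
    (hf : ∀ s, 0 ≤ s → ‖f s‖ ≤ K * dex a ν s) :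
    Filter.Tendsto f Filter.atTop (nhds 0) := by
  have h1 : Filter.Tendsto (fun s => K * dex a ν s) Filter.atTop (nhds 0) := by
    have h2 : Filter.Tendsto (dex a ν) Filter.atTop (nhds 0) :=
      Real.tendsto_exp_neg_atTop_nhds_zero.comp
        (Filter.tendsto_id.const_mul_atTop (mul_pos (abs_pos.mpr hν) ha))
    simpa using h2.const_mul K
  refine squeeze_zero_norm' ?_ h1
  filter_upwards [Filter.eventually_ge_atTop 0] with s hs using hf s hs

/-- Integration by parts against the Rayleigh mode. -/
theorem IsRayleigh.integral_rmode_mul_deriv (h : IsRayleigh r c) {ν : ℝ} (hν : ν ≠ 0)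
    (i : Fin 2) {Q Q' : ℝ → ℂ} {C : ℝ} (hC : ∀ s, 0 ≤ s → ‖Q s‖ ≤ C) (hQ' : Temperate Q')
    (hd : ∀ s, 0 ≤ s → HasDerivWithinAt Q (Q' s) (Ici 0) s) :
    ∫ s in Ioi (0 : ℝ), rmode r c ν s i * Q' s
      = -(rmode r c ν 0 i * Q 0) - ∫ s in Ioi (0 : ℝ), gradMode r c ν s i 1 * Q s := by
  obtain ⟨K, hK0, hK⟩ := h.exists_norm_mode_le
  have hcont : ContinuousOn Q (Ici 0) := fun s hs => (hd s hs).continuousWithinAt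
  have hC0 : 0 ≤ C := (norm_nonneg _).trans (hC 0 le_rfl)
  have hQ : Temperate Q := ⟨hcont, C, 0, hC0, fun s hs => by rw [pow_zero, mul_one]; exact hC s hs⟩
  have i1 := h.integrableOn_gradMode_mul hQ hν i 1
  have i2 := h.integrableOn_rmode_mul hQ' hν i
  have key := integral_Ioi_of_hasDerivAt_of_tendsto (a := 0)
    (f := fun s => rmode r c ν s i * Q s)
    (f' := fun s => gradMode r c ν s i 1 * Q s + rmode r c ν s i * Q' s) (m := 0)
    (((continuous_rmode ν i).continuousOn.mul hcont) 0 self_mem_Ici)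
    (fun s hs => (hasDerivAt_rmode ν s i).mul
      ((hd s (mem_Ioi.mp hs).le).hasDerivAt (Ici_mem_nhds hs)))
    (i1.add i2) (tendsto_zero_of_le_dex (K := K * C) h.decS_pos hν fun s hs => by
      rw [norm_mul, mul_right_comm]
      exact mul_le_mul ((hK ν s hs).1 i) (hC s hs) (norm_nonneg _)
        (mul_nonneg hK0.le (dex_pos _ _ _).le))
  rw [integral_add i1 i2] at key
  linear_combination key

/-- The divergence theorem: the boundary term of the integration by parts in Y cancels the boundary
source, the θ-derivative moves onto the mode as its first gradient column, and only the bulk work of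
the stress remains. -/
theorem IsRayleigh.pairing_divergence (h : IsRayleigh r c) {n : ℤ} (hn : n ≠ 0)
    {Q : Fin 2 → Fin 2 → ℝ → ℂ} {Q' : Fin 2 → ℝ → ℂ} {C : ℝ}
    (hC : ∀ i j s, 0 ≤ s → ‖Q i j s‖ ≤ C) (hQ0 : ∀ i, ContinuousOn (Q i 0) (Ici 0))
    (hQ' : ∀ i, Temperate (Q' i))
    (hd : ∀ i s, 0 ≤ s → HasDerivWithinAt (Q i 1) (Q' i s) (Ici 0) s) :
    pairing r c n (fun i => Q i 1 0) (fun i s => -(Complex.I * n * Q i 0 s + Q' i s))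
      = -∫ s in Ioi (0 : ℝ), ∑ i, ∑ j, gradMode r c (-n) s i j * Q i j s := by
  have hν : -(n : ℝ) ≠ 0 := neg_ne_zero.mpr (by exact_mod_cast hn)
  have hC0 : 0 ≤ C := (norm_nonneg _).trans (hC 0 0 0 le_rfl)
  have t0 : ∀ i j, ContinuousOn (Q i j) (Ici 0) → Temperate (Q i j) := fun i j hc =>
    ⟨hc, C, 0, hC0, fun s hs => by rw [pow_zero, mul_one]; exact hC i j s hs⟩
  have t1 : ∀ i, Temperate (Q i 1) := fun i => t0 i 1 fun s hs => (hd i s hs).continuousWithinAt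
  have j0 := fun i => h.integrableOn_gradMode_mul (t0 i 0 (hQ0 i)) hν i 0
  have j1 := fun i => h.integrableOn_gradMode_mul (t1 i) hν i 1
  have j2 := fun i => h.integrableOn_rmode_mul (hQ' i) hν i
  have jj : ∀ i j, IntegrableOn (fun s => gradMode r c (-n) s i j * Q i j s) (Ioi 0) :=
    fun i => Fin.forall_fin_two.mpr ⟨j0 i, j1 i⟩
  have e1 : ∀ s, ∑ i, rmode r c (-n) s i * -(Complex.I * n * Q i 0 s + Q' i s)
      = ∑ i, (gradMode r c (-n) s i 0 * Q i 0 s - rmode r c (-n) s i * Q' i s) := by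
    intro s
    refine Finset.sum_congr rfl fun i _ => ?_
    rw [gradMode_col_zero]; push_cast; ring
  simp only [pairing, e1]
  rw [integral_finsetSum (f := fun i s => gradMode r c (-n) s i 0 * Q i 0 s
      - rmode r c (-n) s i * Q' i s) _ fun i _ => (j0 i).sub (j2 i),
    integral_finsetSum _ fun i _ => integrable_finsetSum _ fun j _ => jj i j]
  · rw [← Finset.sum_sub_distrib, ← Finset.sum_neg_distrib]
    refine Finset.sum_congr rfl fun i _ => ?_
    rw [integral_sub (j0 i) (j2 i), integral_finsetSum, Fin.sum_univ_two,
      h.integral_rmode_mul_deriv hν i (hC i 1) (hQ' i) (hd i)]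
    · ring
    · exact fun j _ => jj i j

/-- The convolution over modes is contracted with the third Rayleigh gradient, which gives the
kernel's integrand pointwise; the sum is then exchanged with the integral over Y. -/
theorem RayleighModes.integral_crossQ (hR : IsRayleigh r c) (hT : 0 < T) {P D : Profile}
    {α β : (Fin 3 → ℝ) → ℝ} (hP : RayleighModes T r c P α) (hD : RayleighModes T r c D β)
    {t x : ℝ} (ht : t ∈ Icc 0 T) (n : ℤ) :
    ∫ s in Ioi (0 : ℝ), ∑ i, ∑ j, gradMode r c (-n) s i j
        * mode n (crossQ T r P D i j) t x 0 s
      = ∑' m, bilinTerm (ker r c) (slice α t x) (slice β t x) n m := by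
  obtain ⟨K, hK0, hK⟩ := hR.exists_kerFun_bound
  have hu := smoothPer_slice hT hP.amp (x := x) ht
  have hv := smoothPer_slice hT hD.amp (x := x) ht
  obtain ⟨A, hA0, hA⟩ := hu.exists_abs_mul_norm_fc_le
  obtain ⟨B, hB0, hB⟩ := hv.exists_abs_mul_norm_fc_le
  have hpt : ∀ s ∈ Ioi (0 : ℝ), HasSum (fun m : ℤ => fc (n - m) (slice α t x)
      * fc m (slice β t x) * kerFun r c (-n) (n - m) m s)
      (∑ i, ∑ j, gradMode r c (-n) s i j * mode n (crossQ T r P D i j) t x 0 s) := by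
    intro s hs
    have hsum := hasSum_sum (s := Finset.univ) fun i _ => hasSum_sum (s := Finset.univ) fun j _ =>
      (hP.hasSum_mode_crossQ hT hD (x := x) ht le_rfl (mem_Ioi.mp hs).le n i j).mul_left
        (gradMode r c (-n) s i j)
    refine hasSum_of_eq hsum fun m => ?_
    simp only [kerFun, cubicForm, Finset.mul_sum]
    refine Finset.sum_congr rfl fun i _ => Finset.sum_congr rfl fun j _ =>
      Finset.sum_congr rfl fun a _ => Finset.sum_congr rfl fun b _ =>
      Finset.sum_congr rfl fun k _ => Finset.sum_congr rfl fun l _ => ?_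
    ring
  rw [setIntegral_congr_fun measurableSet_Ioi fun s hs => (hpt s hs).tsum_eq.symm]
  refine (HasSum.tsum_eq ?_).symm
  have hint := hasSum_integral_of_summable_integral_norm (μ := volume.restrict (Ioi (0 : ℝ)))
    (F := fun (m : ℤ) s => fc (n - m) (slice α t x)
      * fc m (slice β t x) * kerFun r c (-n) (n - m) m s)
    (fun m => (hK _ _ _).1.const_mul _) ?_
  · refine hasSum_of_eq hint fun m => ?_
    rw [integral_const_mul, bilinTerm_ker, ker]
    ring
  -- The exchange needs summable integrals of norms: the kernel bound costs a factor |n - m||m|,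
  -- which the smooth amplitudes absorb.
  · refine Summable.of_nonneg_of_le (fun m => integral_nonneg fun s => norm_nonneg _) (fun m => ?_)
      ((summable_wt_conv.prod_factor n).mul_left (K * A * B))
    simp only [norm_mul]
    rw [integral_const_mul]
    have h1 := (hK (-n) (n - m) m).2
    have h2 := hA (n - m)
    have h3 := hB m
    push_cast at h2
    calc _ ≤ ‖fc (n - m) (slice α t x)‖ * ‖fc m (slice β t x)‖ * (K * |(n : ℝ) - m| * |(m : ℝ)|) :=
          mul_le_mul_of_nonneg_left h1 (by positivity)
      _ = K * ((|(n : ℝ) - m| * ‖fc (n - m) (slice α t x)‖)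
          * (|(m : ℝ)| * ‖fc m (slice β t x)‖)) := by ring
      _ ≤ K * ((A * wt (n - m)) * (B * wt m)) := by
        have h4 := mul_le_mul h2 h3 (by positivity) (mul_nonneg hA0 (wt_nonneg (n - m)))
        exact mul_le_mul_of_nonneg_left h4 hK0
      _ = _ := by ring

/-! ### The linear part -/

/-- The `L²` norm of the Rayleigh mode of frequency one. -/
def massR (r c : ℝ) : ℝ :=
  qR r c ^ 2 * (qR r c ^ 2 / (2 * decS c) - 2 * qR r c / (decS c + decP r c) + 1 / (2 * decP r c))
  + decP r c ^ 2
    * (1 / (2 * decS c) - 2 * qR r c / (decS c + decP r c) + qR r c ^ 2 / (2 * decP r c))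

theorem IsRayleigh.massR_pos (h : IsRayleigh r c) : 0 < massR r c := by
  have ha := h.decS_pos
  have hb := h.decP_pos
  have hab := h.decS_lt
  have hq := h.q_pos
  have hqs := h.q_sq
  unfold massR
  generalize decS c = a at *
  generalize decP r c = b at *
  generalize qR r c = q at *
  -- The strict arithmetic-geometric inequality, as q² = ab and a < b.
  have hq2 : 2 * q < a + b := by
    nlinarith [mul_pos (sub_pos.mpr hab) (sub_pos.mpr hab)]
  have hX : 0 < q ^ 2 / (2 * a) - 2 * q / (a + b) + 1 / (2 * b) := by
    have e : q ^ 2 / (2 * a) - 2 * q / (a + b) + 1 / (2 * b)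
        = ((b ^ 2 + 1) * (a + b) - 4 * q * b) / (2 * b * (a + b)) := by
      rw [hqs]; field_simp; ring
    rw [e]
    refine div_pos ?_ (by positivity)
    nlinarith [mul_pos hb (sub_pos.mpr hq2), sq_nonneg (b - 1), mul_nonneg (sq_nonneg (b - 1))
      (add_pos ha hb).le]
  have hZ : 0 < 1 / (2 * a) - 2 * q / (a + b) + q ^ 2 / (2 * b) := by
    have e : 1 / (2 * a) - 2 * q / (a + b) + q ^ 2 / (2 * b)
        = ((a ^ 2 + 1) * (a + b) - 4 * q * a) / (2 * a * (a + b)) := by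
      rw [hqs]; field_simp; ring
    rw [e]
    refine div_pos ?_ (by positivity)
    nlinarith [mul_pos ha (sub_pos.mpr hq2), mul_nonneg (sq_nonneg (a - 1))
      (add_pos ha hb).le]
  positivity

/-- The transport velocity of the amplitude is the Rayleigh speed. -/
theorem IsRayleigh.group_velocity (h : IsRayleigh r c) :
    decP r c * qR r c * (1 - qR r c) ^ 2 * (3 - r)
      - 2 * (r * (qR r c ^ 2 * (qR r c ^ 2 / (2 * decS c) - 2 * qR r c / (decS c + decP r c)
          + 1 / (2 * decP r c)))
        + decP r c ^ 2
          * (1 / (2 * decS c) - 2 * qR r c / (decS c + decP r c) + qR r c ^ 2 / (2 * decP r c)))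
      - (r - 1) * (qR r c * decP r c * (decS c - decP r c) * (1 - qR r c ^ 2))
        / (decS c + decP r c)
      = -2 * c ^ 2 * massR r c := by
  have ha := h.decS_pos
  have hb := h.decP_pos
  have hqs := h.q_sq
  have h1 := h.decS_sq
  have h2 := h.decP_sq
  have h3 := h.rayleigh
  unfold massR
  generalize decS c = a at *
  generalize decP r c = b at *
  generalize qR r c = q at *
  -- With 1/(a + b) named `w` and the factors X, Z known through b²X and a²Z, the identity becomes
  -- affine in `w` with polynomial coefficients.
  obtain ⟨w, hw⟩ : ∃ w, w = 1 / (a + b) := ⟨_, rfl⟩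
  have hw1 : w * (a + b) = 1 := by rw [hw]; field_simp
  obtain ⟨X, hX⟩ : ∃ X, X = q ^ 2 / (2 * a) - 2 * q / (a + b) + 1 / (2 * b) := ⟨_, rfl⟩
  obtain ⟨Z, hZ⟩ : ∃ Z, Z = 1 / (2 * a) - 2 * q / (a + b) + q ^ 2 / (2 * b) := ⟨_, rfl⟩
  have hX1 : b ^ 2 * X = b * (b ^ 2 + 1) / 2 - 2 * q * b ^ 2 * w := by
    rw [hX, hw, hqs]; field_simp; ring
  have hZ1 : a ^ 2 * Z = a * (a ^ 2 + 1) / 2 - 2 * q * a ^ 2 * w := by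
    rw [hZ, hw, hqs]; field_simp; ring
  have hJ : (r - 1) * (q * b * (a - b) * (1 - q ^ 2)) / (a + b)
      = (r - 1) * (q * b * (a - b) * (1 - q ^ 2)) * w := by
    rw [hw, mul_one_div]
  rw [hJ, ← hX, ← hZ]
  have k1 : a ^ 2 = 2 * q - 1 := by linarith
  have k2 : r * b ^ 2 = r - 2 + 2 * q := by linarith
  -- `P0` is minus the part free of `w`. Multiplied by a + b the claim is `key`, which holds modulo
  -- a² = 2q - 1, rb² = r - 2 + 2q and q² = ab.
  obtain ⟨P0, hP0⟩ : ∃ P0, P0 = r * b * q ^ 2 * (b ^ 2 + 1) + a * b ^ 2 * (1 + a ^ 2)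
      - b * q * (1 - q) ^ 2 * (3 - r) := ⟨_, rfl⟩
  have key : (a + b) * P0 + (-4 * r * b ^ 2 * q ^ 3 - 4 * a ^ 2 * b ^ 2 * q
      + (r - 1) * q * b * (a - b) * (1 - q ^ 2)) = 0 := by
    rw [hP0]
    linear_combination b * q * (((a + b) * q - 2 * b) * k1 + ((a + b) * q - 2 * a) * k2
      - 2 * (a + b * r) * hqs) - ((a + b) * b * (1 + a ^ 2) - 4 * a * b * q) * hqs
  linear_combination 2 * q ^ 2 * X * h2 + 2 * b ^ 2 * Z * h1 - 2 * r * q ^ 2 * hX1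
    - 2 * b ^ 2 * hZ1 - w * key + P0 * hw1 + hP0

/-- The pairing of the linear parts of the sources with the Rayleigh mode. -/
theorem RayleighModes.pairing_linear (hR : IsRayleigh r c) (hT : 0 < T) {D : Profile}
    {β : (Fin 3 → ℝ) → ℝ} (hD : RayleighModes T r c D β) {t x : ℝ} (ht : t ∈ Icc 0 T)
    {n : ℤ} (hn : n ≠ 0) :
    pairing r c n (fun i => -mode n (opls T r D i) t x 0 0)
        (fun i s => -mode n (opLfs T r c D i) t x 0 s)
      = -2 * c * Complex.I * (SignType.sign (n : ℝ) : ℝ) * massR r c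
        * (fc n (slice (pd (domBd T) 0 β) t x) + c * fc n (slice (pd (domBd T) 1 β) t x)) := by
  have hν : (n : ℝ) ≠ 0 := by exact_mod_cast hn
  obtain ⟨γ₀, h0⟩ : ∃ γ, γ = fc n (slice (pd (domBd T) 0 β) t x) := ⟨_, rfl⟩
  obtain ⟨γ₁, h1⟩ : ∃ γ, γ = fc n (slice (pd (domBd T) 1 β) t x) := ⟨_, rfl⟩
  obtain ⟨σ, hσ⟩ : ∃ σ : ℝ, σ = (SignType.sign (n : ℝ) : ℝ) := ⟨_, rfl⟩
  have hσ1 : σ * |(n : ℝ)| = n := by rw [hσ, sign_mul_abs]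
  have hν' : |(n : ℝ)| ≠ 0 := abs_ne_zero.mpr hν
  have hσ2 : σ ^ 2 = 1 := by
    have : σ ^ 2 * |(n : ℝ)| ^ 2 = 1 * |(n : ℝ)| ^ 2 := by rw [← mul_pow, hσ1, sq_abs, one_mul]
    exact mul_right_cancel₀ (pow_ne_zero 2 hν') this
  have hgv := hR.group_velocity
  have ha := hR.decS_pos
  have hb := hR.decP_pos
  have hM : massR r c = qR r c ^ 2 * (qR r c ^ 2 / (2 * decS c)
      - 2 * qR r c / (decS c + decP r c) + 1 / (2 * decP r c)) + decP r c ^ 2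
    * (1 / (2 * decS c) - 2 * qR r c / (decS c + decP r c) + qR r c ^ 2 / (2 * decP r c)) := rfl
  obtain ⟨q, hq⟩ : ∃ q, q = qR r c := ⟨_, rfl⟩
  obtain ⟨a, ha'⟩ : ∃ a, a = decS c := ⟨_, rfl⟩
  obtain ⟨b, hb'⟩ : ∃ b, b = decP r c := ⟨_, rfl⟩
  rw [← hq, ← ha', ← hb'] at hgv hM
  rw [← ha'] at ha
  rw [← hb'] at hb
  have hI := Complex.I_sq
  have hσC : (σ : ℂ) ^ 2 = 1 := by exact_mod_cast hσ2
  have hσ1C : (σ : ℂ) * (|(n : ℝ)| : ℝ) = n := by exact_mod_cast hσ1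
  -- the coefficients of the three exponentials in the integrand
  let eSS : ℂ := -2 * Complex.I * (c * γ₀ * (q ^ 4 + b ^ 2) + γ₁ * (r * q ^ 4 + b ^ 2))
  let eSP : ℂ := 4 * Complex.I * (c * γ₀ * (q ^ 3 + b ^ 2 * q) + γ₁ * (r * q ^ 3 + b ^ 2 * q))
    - Complex.I * (r - 1) * γ₁ * (q * b * (a - b) * (1 - q ^ 2))
  let ePP : ℂ := -2 * Complex.I * (c * γ₀ * (q ^ 2 + b ^ 2 * q ^ 2)
    + γ₁ * (r * q ^ 2 + b ^ 2 * q ^ 2))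
  have hpt : ∀ s ∈ Ioi (0 : ℝ), ∑ i, rmode r c (-n) s i * -mode n (opLfs T r c D i) t x 0 s
      = -(n * eSS) * (dex (a + a) n s : ℂ) - (n * eSP) * (dex (a + b) n s : ℂ)
        - (n * ePP) * (dex (b + b) n s : ℂ) := by
    intro s hs
    have hs' := (mem_Ioi.mp hs).le
    simp only [hD.mode_opLfs hT ht le_rfl hs' hn, Fin.sum_univ_two, Fin.isValue, sub_zero,
      sub_self, rmode_neg, gradMode_apply_zero_one, gradMode_apply_one_one, rmode_apply_zero,
      rmode_apply_one, ← h0, ← h1, ← hσ, ← hq, ← ha', ← hb', ← dex_mul, map_mul,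
      Complex.conj_ofReal, Complex.conj_I, Matrix.cons_val_zero, Matrix.cons_val_one, eSS, eSP, ePP]
    generalize dex a n s = S
    generalize dex b n s = P
    push_cast
    generalize ((|(n : ℝ)| : ℝ) : ℂ) = N at *
    linear_combination (-(Complex.I * (n * σ ^ 2 * (b * (S - q * P)) ^ 2
        * (2 * c * γ₀ + 2 * γ₁)))) * hI
      + Complex.I * n * (b * (S - q * P)) ^ 2 * (2 * c * γ₀ + 2 * γ₁) * hσC
      + Complex.I * (b * (S - q * P)) * (r - 1) * γ₁ * (q * (q * a * S - b * P)) * hσ1C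
  -- Each exponential integrates to 1/(|n|k), so the factor n from the θ-derivative leaves only sgn
  -- n.
  have hdex : ∀ k : ℝ, 0 < k → IntegrableOn (fun s => (dex k n s : ℂ)) (Ioi 0) ∧
      n * ∫ s in Ioi (0 : ℝ), (dex k n s : ℂ) = σ * (1 / k) := by
    intro k hk
    refine ⟨(integrableOn_dex hk hν).ofReal, ?_⟩
    have h0 : ∫ s in Ioi (0 : ℝ), (dex k n s : ℂ) = ((∫ s in Ioi (0 : ℝ), dex k n s : ℝ) : ℂ) :=
      integral_ofReal
    rw [h0, integral_dex hk hν, ← hσ1C]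
    have h1 : ((|(n : ℝ)| : ℝ) : ℂ) ≠ 0 := by exact_mod_cast hν'
    have h2 : (k : ℂ) ≠ 0 := by exact_mod_cast hk.ne'
    push_cast
    field_simp
  obtain ⟨iSS, vSS⟩ := hdex (a + a) (add_pos ha ha)
  obtain ⟨iSP, vSP⟩ := hdex (a + b) (add_pos ha hb)
  obtain ⟨iPP, vPP⟩ := hdex (b + b) (add_pos hb hb)
  have hint : ∫ s in Ioi (0 : ℝ), ∑ i, rmode r c (-n) s i * -mode n (opLfs T r c D i) t x 0 s
      = -(σ * (1 / (a + a) * eSS + 1 / (a + b) * eSP + 1 / (b + b) * ePP)) := by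
    have j1 := iSS.const_mul (-(n * eSS))
    have j2 := iSP.const_mul (n * eSP)
    have j3 := iPP.const_mul (n * ePP)
    have e1 := integral_sub (j1.sub j2) j3
    have e2 := integral_sub j1 j2
    simp only [Pi.sub_apply] at e1
    rw [setIntegral_congr_fun measurableSet_Ioi hpt, e1, e2,
      integral_const_mul, integral_const_mul, integral_const_mul]
    push_cast at vSS vSP vPP
    linear_combination (-eSS) * vSS - eSP * vSP - ePP * vPP
  have hbd : ∑ i, rmode r c (-n) 0 i * -mode n (opls T r D i) t x 0 0
      = Complex.I * σ * γ₁ * (b * q * (1 - q) ^ 2 * (3 - r)) := by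
    simp only [hD.mode_opls hT ht le_rfl le_rfl hn, Fin.sum_univ_two, Fin.isValue, sub_zero,
      sub_self, rmode_neg, rmode_apply_zero, rmode_apply_one, ← h1, ← hσ, ← hq, ← hb', dex_zero,
      map_mul, Complex.conj_ofReal, Complex.conj_I, Matrix.cons_val_zero, Matrix.cons_val_one]
    push_cast
    ring
  have hgvC := congrArg (fun z : ℝ => (z : ℂ)) hgv
  rw [hM] at hgvC ⊢
  rw [pairing, hint, hbd, ← hσ, ← h0, ← h1]
  have haC : (a : ℂ) ≠ 0 := by exact_mod_cast ha.ne'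
  have hbC : (b : ℂ) ≠ 0 := by exact_mod_cast hb.ne'
  have habC : (a : ℂ) + b ≠ 0 := by exact_mod_cast (add_pos ha hb).ne'
  simp only [eSS, eSP, ePP]
  push_cast at hgvC ⊢
  -- The terms with ∂_t agree by the form of `massR`; those with ∂_x are the group velocity
  -- identity.
  linear_combination Complex.I * σ * γ₁ * hgvC

/-! ### Both parts -/

theorem pairing_congr {n : ℤ} {h h' : Fin 2 → ℂ} {H H' : Fin 2 → ℝ → ℂ} (e : ∀ i, h i = h' i)
    (E : ∀ i s, 0 ≤ s → H i s = H' i s) : pairing r c n h H = pairing r c n h' H' := by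
  unfold pairing
  congr 1
  · exact Finset.sum_congr rfl fun i _ => by rw [e]
  · exact setIntegral_congr_fun measurableSet_Ioi fun s hs =>
      Finset.sum_congr rfl fun i _ => by rw [E i s (mem_Ioi.mp hs).le]

theorem pairing_const_mul (n : ℤ) (a : ℂ) (h : Fin 2 → ℂ) (H : Fin 2 → ℝ → ℂ) :
    pairing r c n (fun i => a * h i) (fun i s => a * H i s) = a * pairing r c n h H := by
  simp only [pairing, mul_left_comm _ a, ← Finset.mul_sum]
  rw [integral_const_mul, mul_sub]

/-- The pairing of the leading part of the sources with the Rayleigh mode. -/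
theorem RayleighModes.pairing_lin (hR : IsRayleigh r c) (hT : 0 < T) {P D : Profile}
    {α β : (Fin 3 → ℝ) → ℝ} (hP : RayleighModes T r c P α) (hD : RayleighModes T r c D β)
    (a : ℝ) {t x : ℝ} (ht : t ∈ Icc 0 T) {n : ℤ} (hn : n ≠ 0) :
    pairing r c n (fun i => mode n (linBd T r P D a i) t x 0 0)
        (fun i s => mode n (linInt T r c P D a i) t x 0 s)
      = -2 * c * Complex.I * (SignType.sign (n : ℝ) : ℝ) * massR r c
        * (fc n (slice (pd (domBd T) 0 β) t x) + c * fc n (slice (pd (domBd T) 1 β) t x))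
        + a * ∑' m, bilinTerm (ker r c) (slice α t x) (slice β t x) n m := by
  have hQ := fun i j => isReg_crossQ (r := r) hT hP.reg hD.reg i j
  have hd0 := fun i => (hQ i 0).pd hT 3
  have hd1 := fun i => (hQ i 1).pd hT 4
  have hLfs := fun i => hD.reg.opLfs (r := r) (c := c) hT i
  have hls := fun i => hD.reg.opls (r := r) hT i
  have e1 : ∀ i, mode n (linBd T r P D a i) t x 0 0
      = -mode n (opls T r D i) t x 0 0 - a * mode n (crossQ T r P D i 1) t x 0 0 := by
    intro i
    have e : mode n (linBd T r P D a i) t x 0 0 = _ :=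
      ((hls i).neg hT).mode_sub hT ((hQ i 1).const_mul hT a) ht le_rfl le_rfl n
    rw [e, mode_neg, mode_const_mul]
  have e2 : ∀ i s, 0 ≤ s → mode n (linInt T r c P D a i) t x 0 s
      = -mode n (opLfs T r c D i) t x 0 s
        - a * -(Complex.I * n * mode n (crossQ T r P D i 0) t x 0 s
          + mode n (pd (domAll T) 4 (crossQ T r P D i 1)) t x 0 s) := by
    intro i s hs
    have e0 : linInt T r c P D a i = fun p => -opLfs T r c D i p
        + a * (pd (domAll T) 3 (crossQ T r P D i 0) p
          + pd (domAll T) 4 (crossQ T r P D i 1) p) := by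
      funext p
      rw [linInt, Fin.sum_univ_two]
      rfl
    rw [e0, ((hLfs i).neg hT).mode_add hT (((hd0 i).add hT (hd1 i)).const_mul hT a) ht le_rfl hs,
      mode_neg, mode_const_mul, (hd0 i).mode_add hT (hd1 i) ht le_rfl hs,
      (hQ i 0).mode_pd_three hT ht le_rfl hs]
    ring
  have tQ := fun i j => (hQ i j).temperate_mode hT (x := x) ht le_rfl n
  have td := fun i => (hd1 i).temperate_mode hT (x := x) ht le_rfl n
  have tL : ∀ i, Temperate (fun s => -mode n (opLfs T r c D i) t x 0 s) := fun i => by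
    simpa using ((hLfs i).temperate_mode hT (x := x) ht le_rfl n).const_mul (-1)
  have tdiv : ∀ i, Temperate (fun s => a * -(Complex.I * n * mode n (crossQ T r P D i 0) t x 0 s
      + mode n (pd (domAll T) 4 (crossQ T r P D i 1)) t x 0 s)) := fun i => by
    simpa using ((((tQ i 0).const_mul (Complex.I * n)).add (td i)).const_mul (-1)).const_mul a
  obtain ⟨C, hC⟩ : ∃ C, ∀ i j s, 0 ≤ s → ‖mode n (crossQ T r P D i j) t x 0 s‖ ≤ C := by
    choose C hC0 hC using fun i j => (hQ i j).exists_norm_mode_le hT (x := x) ht le_rfl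
    refine ⟨∑ i, ∑ j, C i j * wt n, fun i j s hs => (hC i j n s hs).trans ?_⟩
    have hnn := fun i j => mul_nonneg (hC0 i j) (wt_nonneg n)
    exact (Finset.single_le_sum (f := fun j => C i j * wt n) (fun j _ => hnn i j)
      (Finset.mem_univ j)).trans (Finset.single_le_sum (f := fun i => ∑ j, C i j * wt n)
      (fun i _ => Finset.sum_nonneg fun j _ => hnn i j) (Finset.mem_univ i))
  have hdiv := hR.pairing_divergence hn (Q := fun i j s => mode n (crossQ T r P D i j) t x 0 s)
    hC (fun i => (hQ i 0).continuousOn_mode hT ht le_rfl n) td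
    (fun i s hs => (hQ i 1).hasDerivWithinAt_mode hT ht le_rfl hs n)
  rw [pairing_congr e1 e2, ← hR.pairing_sub hn _ _ tL tdiv, hD.pairing_linear hR hT ht hn,
    pairing_const_mul, hdiv, hP.integral_crossQ hR hT hD ht n]
  ring

end

/-! ## Consequences of the structure of the profiles -/

section

variable {T r c : ℝ} {F F' : Fin 2 → (Fin 3 → ℝ) → ℝ} {U V : ℕ → Profile}

theorem pd2_zero (i j : Fin 5) (a : Fin 2) (p : Fin 5 → ℝ) : pd2 T i j 0 a p = 0 := by
  have : pd (domAll T) j ((0 : Profile).eval a) = fun _ => 0 := by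
    funext p; rw [Profile.eval_zero, pd_const]
  rw [pd2, this, pd_const]

theorem srcInt_zero (m : ℕ) (i : Fin 2) : srcInt T r c (fun _ => 0) m i = fun _ => 0 := by
  funext p
  simp only [srcInt, opLfs, opLss, pd2_zero, grad_zero, stressQ_zero_left, stressC_zero_left,
    Matrix.zero_apply, pd_const, Finset.sum_const_zero]
  ring

theorem srcBdPart_zero (m : ℕ) (i : Fin 2) : srcBdPart T r (fun _ => 0) m i = fun _ => 0 := by
  funext p
  simp only [srcBdPart, opls, quadBd, cubBd, Profile.eval_zero, pd_const, grad_zero,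
    stressQ_zero_left, stressC_zero_left, Matrix.zero_apply, Finset.sum_const_zero]
  ring

theorem mode_zero_fun (n : ℤ) (t x y Y : ℝ) : mode n (fun _ => 0) t x y Y = 0 := by
  simp [mode, fc_zero_fun]

theorem pd_iterate_zero (j : ℕ) :
    (pd (domAll T) 2)^[j] (fun _ => (0 : ℝ)) = fun _ => 0 := by
  induction j with
  | zero => rfl
  | succ j ih =>
    rw [Function.iterate_succ_apply', ih]
    funext p
    exact pd_const _ _ _

theorem srcMod_zero (m : ℕ) (n : ℤ) (i : Fin 2) (t x Y : ℝ) :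
    srcMod T r c (fun _ => 0) m n i t x Y = 0 := by
  unfold srcMod
  refine Finset.sum_eq_zero fun j _ => ?_
  have : ∀ Y, decaying n (fun _ => 0) Y = 0 := by
    intro Y
    have h : Filter.limUnder Filter.atTop (fun _ : ℝ => (0 : ℂ)) = 0 :=
      tendsto_const_nhds.limUnder_eq
    simp only [decaying, h]
    split_ifs <;> simp
  simp only [srcInt_zero, pd_iterate_zero, mode_zero_fun, this]
  split_ifs <;> simp

/-- The value is a chosen preimage of 0 orthogonal to the kernel. The first row of the matrix and
the orthogonality relation force it to vanish, because q² + b² > 0 with b = `decP r c`. -/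
theorem lopInv_zero (h : IsRayleigh r c) : lopInv r c 0 = 0 := by
  have hex : ∃ σ : Fin 2 → ℂ,
      σ ⬝ᵥ star ![om r c 1, -(qR r c : ℂ)] = 0 ∧ lop r c *ᵥ σ = 0 := ⟨0, by simp, by simp⟩
  rw [lopInv, dif_pos hex]
  obtain ⟨h1, h2⟩ := hex.choose_spec
  generalize hex.choose = σ at *
  have h3 := congrFun h2 0
  obtain ⟨-, o2, -, -⟩ := om_apply r c
  simp only [dotProduct, Fin.sum_univ_two, o2, Pi.star_apply, Matrix.cons_val_zero,
    Matrix.cons_val_one, lop, Matrix.mulVec, Matrix.of_apply, Pi.zero_apply, RCLike.star_def,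
    map_mul, map_neg, Complex.conj_ofReal, Complex.conj_I] at h1 h3
  have hR : 2 - (c : ℂ) ^ 2 = 2 * qR r c := by exact_mod_cast h.rayleigh
  have hq := h.q_pos
  have hne : ((qR r c : ℂ) ^ 2 + (decP r c : ℂ) ^ 2) ≠ 0 := by
    have : 0 < qR r c ^ 2 + decP r c ^ 2 := by positivity
    exact_mod_cast this.ne'
  have hqC : (qR r c : ℂ) ≠ 0 := by exact_mod_cast hq.ne'
  have e0 : σ 0 = 0 := by
    have : ((qR r c : ℂ) ^ 2 + (decP r c : ℂ) ^ 2) * σ 0 = 0 := by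
      rw [hR] at h3
      linear_combination (qR r c : ℂ) / 2 * h3 + Complex.I * decP r c * h1
        + (decP r c : ℂ) ^ 2 * σ 0 * Complex.I_sq
    exact (mul_eq_zero.mp this).resolve_left hne
  have e1 : σ 1 = 0 := by
    rw [e0] at h1
    have : (qR r c : ℂ) * σ 1 = 0 := by linear_combination -h1
    exact (mul_eq_zero.mp this).resolve_left hqC
  funext i
  revert i
  rw [Fin.forall_fin_two]
  exact ⟨e0, e1⟩

theorem srcBd_of_ne (F : Fin 2 → (Fin 3 → ℝ) → ℝ) (U : ℕ → Profile) {m : ℕ} (hm : m ≠ 2)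
    (i : Fin 2) : srcBd T r F U m i = srcBdPart T r U m i := by
  funext p
  rw [srcBd_eq, if_neg hm, add_zero]

theorem srcBd_congr (h0 : ∀ j < 2, U j = 0) (h0' : ∀ j < 2, V j = 0) {m : ℕ}
    (h : ∀ j ≤ m, U j = V j) (hF : m = 2 → F = F') : srcBd T r F U m = srcBd T r F' V m := by
  funext i p
  rw [srcBd_eq, srcBd_eq, srcBdPart_congr h0 h0' h]
  by_cases hm : m = 2
  · rw [if_pos hm, if_pos hm, hF hm]
  · rw [if_neg hm, if_neg hm]

/-! ### How the pieces of a profile depend on the lower levels -/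

section

variable {k : ℕ}

theorem Uzero_congr (hM : srcMod T r c U (k - 1) = srcMod T r c V (k - 1)) :
    Uzero T r c U k = Uzero T r c V k := by
  funext t x Y i; simp only [Uzero, hM]

theorem tau_congr (hM : srcMod T r c U (k - 1) = srcMod T r c V (k - 1)) :
    tau T r c U k = tau T r c V k := by
  funext n j t x Y; simp only [tau, hM]

theorem Up_congr (hM : srcMod T r c U (k - 1) = srcMod T r c V (k - 1)) :
    Up T r c U k = Up T r c V k := by
  funext n t x Y; simp only [Up, tau_congr hM]

theorem bdRhs_congr (hM : srcMod T r c U (k - 1) = srcMod T r c V (k - 1))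
    (hB : srcBd T r F U (k - 1) = srcBd T r F' V (k - 1)) :
    bdRhs T r c F U k = bdRhs T r c F' V k := by
  funext n t x; simp only [bdRhs, UpTilde, tau_congr hM, hB]

theorem Uh_congr (hM : srcMod T r c U (k - 1) = srcMod T r c V (k - 1))
    (hB : srcBd T r F U (k - 1) = srcBd T r F' V (k - 1)) :
    Uh T r c F U k = Uh T r c F' V k := by
  funext n t x Y; simp only [Uh, UhPos, bdRhs_congr hM hB]

/-- The condition on the amplitude depends on the boundary forcing only at the third level. -/
theorem HasAmplitude.congr_forcing {α : (Fin 3 → ℝ) → ℝ}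
    (h : HasAmplitude T r c F U k α) (hF : k = 3 → F = F') : HasAmplitude T r c F' U k α := by
  have hB : srcBd T r F U (k - 1) = srcBd T r F' U (k - 1) := by
    by_cases hk : k - 1 = 2
    · rw [hF (by omega)]
    · funext i; rw [srcBd_of_ne F U hk, srcBd_of_ne F' U hk]
  intro t ht x Y hY i
  rw [← Uh_congr rfl hB]
  exact h t ht x Y hY i

theorem profile_mode_eval (hT : 0 < T) {W : Profile} (hW : InS T W) {t x y Y : ℝ}
    (ht : t ∈ Icc 0 T) (hY : 0 ≤ Y) (n : ℤ) (i : Fin 2) :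
    mode n (W.eval i) t x y Y = (if n = 0 then (W.low i ![t, x, y] : ℂ) else 0)
      + fc n (fun θ => (W.surf i ![t, x, θ, Y] : ℂ)) := by
  have hc : Continuous fun θ => (W.surf i ![t, x, θ, Y] : ℂ) := by
    have := (isReg_of_surf hT (hW i).2).per.continuous (perBox_domAll hT)
      (mem_domAll (x := x) (y := 0) (θ := 0) ht le_rfl hY)
    simp only [update_domAll_three] at this
    exact this
  have e : mode n (W.eval i) t x y Y = fc n (fun θ => (W.low i ![t, x, y] : ℂ)
      + (W.surf i ![t, x, θ, Y] : ℂ)) := fc_congr n fun θ => by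
    simp only [Profile.eval]; push_cast; rfl
  rw [e, fc_add continuous_const hc]
  split_ifs with hn
  · rw [hn, fc_zero_const]
  · rw [fc_const _ hn]

/-- The leading profile is a superposition of Rayleigh modes. -/
theorem HasAmplitude.rayleighModes_two (hR : IsRayleigh r c) (hT : 0 < T)
    (h0 : ∀ j < 2, U j = 0) {α : (Fin 3 → ℝ) → ℝ} (hU : InS T (U 2)) (hα : IsAmplitude T α)
    (h : HasAmplitude T r c F U 2 α) : RayleighModes T r c (U 2) α := by
  -- The sources of level one involve only U_0 and U_1, so they are those of the zero sequence; the
  -- particular and homogeneous pieces of U_2 and its decaying mean therefore vanish.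
  have hM : srcMod T r c U (2 - 1) = srcMod T r c (fun _ => 0) (2 - 1) :=
    srcMod_congr h0 (fun _ _ => rfl) fun j hj => h0 j (by omega)
  have hB : srcBd T r F U (2 - 1) = srcBd T r F (fun _ => 0) (2 - 1) :=
    srcBd_congr h0 (fun _ _ => rfl) (fun j hj => h0 j (by omega)) fun _ => rfl
  have htau : ∀ n j t x Y, tau T r c (fun _ => 0) 2 n j t x Y = 0 := by
    intro n j t x Y
    have : ∀ s : ℝ, srcComp r c n j (fun i => srcMod T r c (fun _ => 0) (2 - 1) n i t x s) = 0 := by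
      intro s
      simp only [srcMod_zero, srcComp]
      simp
    simp only [tau, this, mul_zero, intervalIntegral.integral_zero, integral_zero, neg_zero,
      ite_self]
  have hUp : ∀ n t x Y, Up T r c U 2 n t x Y = 0 := by
    intro n t x Y
    rw [Up_congr hM]
    simp only [Up, htau, zero_smul, Finset.sum_const_zero]
  have hbd : ∀ n t x, bdRhs T r c F U 2 n t x = 0 := by
    intro n t x
    rw [bdRhs_congr hM hB]
    have h1 : UpTilde T r c (fun _ => 0) 2 n t x 0 = 0 := by
      simp only [UpTilde, htau, zero_smul, Finset.sum_const_zero]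
    funext i
    simp only [bdRhs, h1, Matrix.mulVec_zero, sub_zero]
    rw [srcBd_of_ne _ _ (by norm_num), srcBdPart_zero, mode_zero_fun]
    rfl
  have hUh : ∀ n t x Y, Uh T r c F U 2 n t x Y = 0 := by
    intro n t x Y
    have : ∀ n Y, UhPos T r c F U 2 n t x Y = 0 := by
      intro n Y
      simp only [UhPos, hbd, lopInv_zero hR, smul_zero, Pi.zero_apply, zero_mul, zero_smul,
        add_zero]
    simp only [Uh, this, star_zero, ite_self]
  refine ⟨fun i => hU.isReg_eval hT i, hα.1.smoothPerOn, ?_, ?_⟩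
  · intro n hn t ht x y Y hy hY i
    rw [profile_mode_eval hT hU ht hY, if_neg hn, zero_add, (h t ht x Y hY i).2 n hn, hUp, hUh,
      rhat_eq hR hn]
    simp
  · intro t ht x y hy i
    refine ⟨((U 2).low i ![t, x, y] : ℂ), fun Y hY => ?_⟩
    rw [profile_mode_eval hT hU ht hY, if_pos rfl, (h t ht x Y hY i).1, Uzero_congr hM]
    simp only [Uzero, srcMod_zero, integral_zero, mul_zero, add_zero]

theorem slice_sub (α β : (Fin 3 → ℝ) → ℝ) (t x : ℝ) :
    slice (fun p => α p - β p) t x = fun θ => slice α t x θ - slice β t x θ := by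
  funext θ; simp [slice]

/-- Profiles of the same level over the same lower levels differ by Rayleigh modes. -/
theorem HasAmplitude.rayleighModes_diff (hR : IsRayleigh r c) (hT : 0 < T)
    (h0 : ∀ j < 2, U j = 0) (h0' : ∀ j < 2, V j = 0) (hk : 3 ≤ k) (hUV : ∀ j < k, U j = V j)
    (hF : k = 3 → F = F') {α β : (Fin 3 → ℝ) → ℝ} (hU : InS T (U k)) (hV : InS T (V k))
    (hα : IsAmplitude T α) (hβ : IsAmplitude T β) (h : HasAmplitude T r c F U k α)
    (h' : HasAmplitude T r c F' V k β) :
    RayleighModes T r c ((U k).diff (V k)) (fun p => α p - β p) := by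
  -- All pieces other than the amplitude part and the non-decaying part come from the sources of
  -- level k - 1, which U and V share. The forcing enters these only if k - 1 = 2.
  have hM : srcMod T r c U (k - 1) = srcMod T r c V (k - 1) :=
    srcMod_congr h0 h0' fun j hj => hUV j (by omega)
  have hB : srcBd T r F U (k - 1) = srcBd T r F' V (k - 1) :=
    srcBd_congr h0 h0' (fun j hj => hUV j (by omega)) fun e => hF (by omega)
  have rU : RegProfile T (U k) := fun i => hU.isReg_eval hT i
  have rV : RegProfile T (V k) := fun i => hV.isReg_eval hT i
  have hmode : ∀ n, ∀ t ∈ Icc 0 T, ∀ x y Y : ℝ, 0 ≤ y → 0 ≤ Y → ∀ i,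
      mode n (((U k).diff (V k)).eval i) t x y Y
        = mode n ((U k).eval i) t x y Y - mode n ((V k).eval i) t x y Y := by
    intro n t ht x y Y hy hY i
    rw [Profile.eval_diff]
    exact (rU i).mode_sub hT (rV i) ht hy hY n
  have sα := hα.1.smoothPerOn
  have sβ := hβ.1.smoothPerOn
  refine ⟨rU.diff hT rV, ⟨sα.smooth.sub sβ.smooth, fun p hp => ?_⟩, ?_, ?_⟩
  · simp only [sα.per p hp, sβ.per p hp]
  · intro n hn t ht x y Y hy hY i
    rw [hmode n t ht x y Y hy hY, profile_mode_eval hT hU ht hY, profile_mode_eval hT hV ht hY,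
      (h t ht x Y hY i).2 n hn, (h' t ht x Y hY i).2 n hn, Up_congr hM, Uh_congr hM hB,
      rhat_eq hR hn, slice_sub, fc_sub (smoothPer_slice hT sα ht).continuous
        (smoothPer_slice hT sβ ht).continuous]
    simp only [if_neg hn]
    ring
  · intro t ht x y hy i
    refine ⟨((U k).low i ![t, x, y] : ℂ) - ((V k).low i ![t, x, y] : ℂ), fun Y hY => ?_⟩
    rw [hmode 0 t ht x y Y hy hY, profile_mode_eval hT hU ht hY, profile_mode_eval hT hV ht hY,
      if_pos rfl, if_pos rfl, (h t ht x Y hY i).1, (h' t ht x Y hY i).1, Uzero_congr hM]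
    ring

end

/-! ### The modified interior source -/

/-- Levels above m do not enter, so the sequence may be truncated to zero there and regularity is
needed only up to m. -/
theorem isReg_srcInt_of_le (hT : 0 < T) (h0 : ∀ j < 2, U j = 0) {m : ℕ}
    (hU : ∀ j ≤ m, RegProfile T (U j)) (i : Fin 2) : IsReg T (srcInt T r c U m i) := by
  have e : srcInt T r c U m = srcInt T r c (fun j => if j ≤ m then U j else 0) m := by
    refine srcInt_congr h0 (fun j hj => ?_) fun j hj => (if_pos hj).symm
    rw [h0 j hj, ite_self]
  rw [e]
  refine isReg_srcInt hT (fun j => ?_) m i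
  split_ifs with hj
  · exact hU j hj
  · exact regProfile_zero

theorem isReg_srcBdPart_of_le (hT : 0 < T) (h0 : ∀ j < 2, U j = 0) {m : ℕ}
    (hU : ∀ j ≤ m, RegProfile T (U j)) (i : Fin 2) : IsReg T (srcBdPart T r U m i) := by
  have e : srcBdPart T r U m = srcBdPart T r (fun j => if j ≤ m then U j else 0) m := by
    refine srcBdPart_congr h0 (fun j hj => ?_) fun j hj => (if_pos hj).symm
    rw [h0 j hj, ite_self]
  rw [e]
  refine isReg_srcBdPart hT (fun j => ?_) m i
  split_ifs with hj
  · exact hU j hj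
  · exact regProfile_zero

theorem decaying_of_ne {n : ℤ} (hn : n ≠ 0) (φ : ℝ → ℂ) : decaying n φ = φ := by
  funext Y; simp [decaying, hn]

theorem srcMod_eq {n : ℤ} (hn : n ≠ 0) (m : ℕ) (i : Fin 2) (t x Y : ℝ) :
    srcMod T r c U m n i t x Y = ∑ j ∈ Finset.range (m + 1), if j = 0 ∨ j + 5 ≤ m then
      ((Y : ℂ) ^ j / (j.factorial : ℂ)) *
        mode n ((pd (domAll T) 2)^[j] (srcInt T r c U (m - j) i)) t x 0 Y else 0 := by
  simp only [srcMod, decaying_of_ne hn]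

theorem isReg_taylor (hT : 0 < T) (h0 : ∀ j < 2, U j = 0) {m : ℕ}
    (hU : ∀ j ≤ m, RegProfile T (U j)) (i : Fin 2) (j : ℕ) :
    IsReg T ((pd (domAll T) 2)^[j] (srcInt T r c U (m - j) i)) :=
  (isReg_srcInt_of_le hT h0 (fun j' hj' => hU j' (hj'.trans (Nat.sub_le m j))) i).iterate_pd hT 2 j

/-- The Taylor factors Y^j cause polynomial growth, of degree at most m; the constant is uniform in
n up to the summable weight. -/
theorem exists_norm_srcMod_le (hT : 0 < T) (h0 : ∀ j < 2, U j = 0) {m : ℕ}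
    (hU : ∀ j ≤ m, RegProfile T (U j)) {t : ℝ} (ht : t ∈ Icc 0 T) (x : ℝ) (i : Fin 2) :
    ∃ C, 0 ≤ C ∧ ∀ n : ℤ, n ≠ 0 → ∀ s, 0 ≤ s →
      ‖srcMod T r c U m n i t x s‖ ≤ C * wt n * (1 + s) ^ m := by
  choose C hC0 hC using fun j =>
    (isReg_taylor (r := r) (c := c) hT h0 hU i j).exists_norm_mode_le hT (x := x) ht le_rfl
  refine ⟨∑ j ∈ Finset.range (m + 1), C j, Finset.sum_nonneg fun j _ => hC0 j, ?_⟩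
  intro n hn s hs
  rw [srcMod_eq hn, Finset.sum_mul, Finset.sum_mul]
  refine (norm_sum_le _ _).trans (Finset.sum_le_sum fun j hj => ?_)
  have hnn : 0 ≤ C j * wt n := mul_nonneg (hC0 j) (wt_nonneg n)
  split_ifs with h
  · rw [norm_mul, norm_div, norm_pow, Complex.norm_real, Real.norm_of_nonneg hs,
      Complex.norm_natCast, mul_comm]
    refine mul_le_mul (hC j n s hs) ?_ (by positivity) hnn
    have hf : (1 : ℝ) ≤ j.factorial := by exact_mod_cast Nat.succ_le_of_lt j.factorial_pos
    calc s ^ j / j.factorial ≤ s ^ j := div_le_self (by positivity) hf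
      _ ≤ (1 + s) ^ j := pow_le_pow_left₀ hs (by linarith) j
      _ ≤ (1 + s) ^ m := pow_le_pow_right₀ (by linarith) (by
        rw [Finset.mem_range] at hj; omega)
  · rw [norm_zero]; positivity

theorem temperate_srcMod (hT : 0 < T) (h0 : ∀ j < 2, U j = 0) {m : ℕ}
    (hU : ∀ j ≤ m, RegProfile T (U j)) {t : ℝ} (ht : t ∈ Icc 0 T) (x : ℝ) {n : ℤ} (hn : n ≠ 0)
    (i : Fin 2) : Temperate (srcMod T r c U m n i t x) := by
  obtain ⟨C, hC0, hC⟩ := exists_norm_srcMod_le (r := r) (c := c) hT h0 hU ht x i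
  refine ⟨?_, C * wt n, m, mul_nonneg hC0 (wt_nonneg n), fun s hs => hC n hn s hs⟩
  have e : srcMod T r c U m n i t x = fun Y : ℝ => ∑ j ∈ Finset.range (m + 1),
      if j = 0 ∨ j + 5 ≤ m then ((Y : ℂ) ^ j / (j.factorial : ℂ)) *
        mode n ((pd (domAll T) 2)^[j] (srcInt T r c U (m - j) i)) t x 0 Y else 0 :=
    funext fun Y => srcMod_eq hn m i t x Y
  rw [e]
  refine continuousOn_finsetSum _ fun j _ => ?_
  split_ifs
  · refine ContinuousOn.mul (by fun_prop)
      ((isReg_taylor hT h0 hU i j).continuousOn_mode hT ht le_rfl n)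
  · exact continuousOn_const

theorem mode_neg_index (n : ℤ) (f : (Fin 5 → ℝ) → ℝ) (t x y Y : ℝ) :
    mode (-n) f t x y Y = conj (mode n f t x y Y) := fc_neg_ofReal _ n

theorem srcMod_neg {n : ℤ} (hn : n ≠ 0) (m : ℕ) (i : Fin 2) (t x Y : ℝ) :
    srcMod T r c U m (-n) i t x Y = conj (srcMod T r c U m n i t x Y) := by
  rw [srcMod_eq hn, srcMod_eq (neg_ne_zero.mpr hn), map_sum]
  refine Finset.sum_congr rfl fun j _ => ?_
  split_ifs
  · rw [mode_neg_index, map_mul, map_div₀, map_pow, Complex.conj_ofReal, Complex.conj_natCast]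
  · rw [map_zero]

/-- Taylor terms with j ≥ 1 would need j + 5 ≤ 2. -/
theorem srcMod_two {n : ℤ} (hn : n ≠ 0) (i : Fin 2) (t x Y : ℝ) :
    srcMod T r c U 2 n i t x Y = mode n (srcInt T r c U 2 i) t x 0 Y := by
  rw [srcMod_eq hn, Finset.sum_eq_single 0]
  · simp
  · intro j _ hj
    rw [if_neg (by omega)]
  · simp

/-- Taylor terms with j ≥ 1 use sources of level k - j < k, the same for U and V; only j = 0
survives. -/
theorem srcMod_sub {k : ℕ} (h0 : ∀ j < 2, U j = 0) (h0' : ∀ j < 2, V j = 0)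
    (hUV : ∀ j < k, U j = V j) {n : ℤ} (hn : n ≠ 0) (i : Fin 2) (t x Y : ℝ) :
    srcMod T r c U k n i t x Y - srcMod T r c V k n i t x Y
      = mode n (srcInt T r c U k i) t x 0 Y - mode n (srcInt T r c V k i) t x 0 Y := by
  rw [srcMod_eq hn, srcMod_eq hn, Finset.sum_range_succ', Finset.sum_range_succ']
  have e : ∀ j, srcInt T r c U (k - (j + 1)) = srcInt T r c V (k - (j + 1)) ∨ k = 0 := by
    intro j
    by_cases hk : k = 0
    · exact Or.inr hk
    · exact Or.inl (srcInt_congr h0 h0' fun a ha => hUV a (by omega))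
  by_cases hk : k = 0
  · subst hk; simp
  · simp only [fun j => (e j).resolve_right hk]
    simp

end

/-! ## The amplitude equations -/

section

variable {T r c : ℝ} {F F' : Fin 2 → (Fin 3 → ℝ) → ℝ} {U V : ℕ → Profile}

/-- The constant in the definition of the bilinear multiplier. -/
def constR (r c : ℝ) : ℝ := c * massR r c / Real.pi

theorem IsRayleigh.constR_ne_zero (h : IsRayleigh r c) : constR r c ≠ 0 :=
  (div_pos (mul_pos h.pos h.massR_pos) Real.pi_pos).ne'

/-- The factor between the left side of the amplitude equation and the pairing. -/
def symbolR (r c : ℝ) (n : ℤ) : ℂ := -2 * c * Complex.I * (SignType.sign (n : ℝ) : ℝ) * massR r c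

theorem sign_cast (n : ℤ) : ((SignType.sign (n : ℝ) : ℝ) : ℂ) = (n.sign : ℂ) := by
  rcases lt_trichotomy n 0 with h | h | h
  · rw [sign_neg (by exact_mod_cast h), Int.sign_eq_neg_one_of_neg h]; simp
  · subst h; simp
  · rw [sign_pos (by exact_mod_cast h), Int.sign_eq_one_of_pos h]; simp

theorem abs_sign {n : ℤ} (hn : n ≠ 0) : |(SignType.sign (n : ℝ) : ℝ)| = 1 := by
  rcases lt_or_gt_of_ne hn with h | h
  · rw [sign_neg (by exact_mod_cast h)]; simp
  · rw [sign_pos (by exact_mod_cast h)]; simp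

theorem IsRayleigh.norm_symbolR (h : IsRayleigh r c) {n : ℤ} (hn : n ≠ 0) :
    ‖symbolR r c n‖ = 2 * c * massR r c := by
  simp only [symbolR, norm_mul, Complex.norm_I, Complex.norm_real, Real.norm_eq_abs, norm_neg,
    abs_sign hn, abs_of_pos h.pos, abs_of_pos h.massR_pos]
  simp

theorem IsRayleigh.symbolR_ne_zero (h : IsRayleigh r c) {n : ℤ} (hn : n ≠ 0) :
    symbolR r c n ≠ 0 := by
  rw [← norm_pos_iff, h.norm_symbolR hn]
  have := h.pos
  have := h.massR_pos
  positivity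

theorem symbolR_neg (n : ℤ) : symbolR r c (-n) = conj (symbolR r c n) := by
  simp only [symbolR, map_mul, map_neg, Complex.conj_I, Complex.conj_ofReal, Int.cast_neg,
    Left.sign_neg, SignType.coe_neg, Complex.ofReal_neg, map_ofNat]
  ring

/-- The Fourier coefficients of `∂_t α + c ∂_x α + m 𝓗(𝓑(α₂, α))`. -/
def ampCoef (T r c m : ℝ) (α₂ α : (Fin 3 → ℝ) → ℝ) (t x : ℝ) (n : ℤ) : ℂ :=
  fc n (slice (pd (domBd T) 0 α) t x) + c * fc n (slice (pd (domBd T) 1 α) t x)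
    + m * (-Complex.I * (n.sign : ℂ)
      * bilinCoeff (ker r c) (constR r c) (slice α₂ t x) (slice α t x) n)

/-- The constant c_0 = cM/π is chosen for this: -2ic sgn(n) M times 2a·i sgn(n)/(4πc_0) equals a. In
particular a = 1/2 gives the multiplier coefficient 1 and a = 1 gives 2. -/
theorem IsRayleigh.symbolR_mul_ampCoef (h : IsRayleigh r c) (a : ℝ)
    (α₂ α : (Fin 3 → ℝ) → ℝ) (t x : ℝ) {n : ℤ} (hn : n ≠ 0) :
    symbolR r c n * ampCoef T r c (2 * a) α₂ α t x n
      = symbolR r c n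
        * (fc n (slice (pd (domBd T) 0 α) t x) + c * fc n (slice (pd (domBd T) 1 α) t x))
        + a * ∑' m, bilinTerm (ker r c) (slice α₂ t x) (slice α t x) n m := by
  have hσ : ((SignType.sign (n : ℝ) : ℝ) : ℂ) ^ 2 = 1 := by
    have := abs_sign hn
    rw [← Complex.ofReal_pow, ← sq_abs, this]; simp
  have hc : (c : ℂ) ≠ 0 := by exact_mod_cast h.pos.ne'
  have hM : (massR r c : ℂ) ≠ 0 := by exact_mod_cast h.massR_pos.ne'
  have hpi : (Real.pi : ℂ) ≠ 0 := by exact_mod_cast Real.pi_ne_zero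
  have e : 1 / (4 * Real.pi * (constR r c : ℂ)) = 1 / (4 * (c * massR r c)) := by
    rw [constR]; push_cast; field_simp
  have e2 : (c : ℂ) * massR r c * (1 / (4 * (c * massR r c))) = 1 / 4 := by field_simp
  rw [ampCoef, ← sign_cast, symbolR, bilinCoeff, e]
  generalize ∑' m, bilinTerm (ker r c) (slice α₂ t x) (slice α t x) n m = S
  generalize ((SignType.sign (n : ℝ) : ℝ) : ℂ) = σ at *
  generalize (1 : ℂ) / (4 * (c * massR r c)) = w at *
  push_cast
  linear_combination (-4 * a * S * σ ^ 2 * Complex.I ^ 2) * e2 - a * S * σ ^ 2 * Complex.I_sq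
    + a * S * hσ

theorem RayleighModes.pairing_eq (hR : IsRayleigh r c) (hT : 0 < T) {P D : Profile}
    {α β : (Fin 3 → ℝ) → ℝ} (hP : RayleighModes T r c P α) (hD : RayleighModes T r c D β)
    (a : ℝ) {t x : ℝ} (ht : t ∈ Icc 0 T) {n : ℤ} (hn : n ≠ 0) :
    pairing r c n (fun i => mode n (linBd T r P D a i) t x 0 0)
        (fun i s => mode n (linInt T r c P D a i) t x 0 s)
      = symbolR r c n * ampCoef T r c (2 * a) α β t x n := by
  rw [hP.pairing_lin hR hT hD a ht hn, hR.symbolR_mul_ampCoef a α β t x hn, symbolR]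

/-! ### The solvability condition as a sequence of equations -/

/-- The pairing of all sources of level `k` with the Rayleigh mode. -/
def residual (T r c : ℝ) (F : Fin 2 → (Fin 3 → ℝ) → ℝ) (U : ℕ → Profile) (k : ℕ) (t x : ℝ)
    (n : ℤ) : ℂ :=
  pairing r c n (fun i => mode n (srcBd T r F U k i) t x 0 0)
    (fun i => srcMod T r c U k n i t x)

/-- The constant -1/(1-q) relating the cokernel condition to the pairing is nonzero. -/
theorem IsRayleigh.solvable_iff (h : IsRayleigh r c) (hT : 0 < T) (h0 : ∀ j < 2, U j = 0) {k : ℕ}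
    (hU : ∀ j ≤ k, RegProfile T (U j)) : Solvable T r c F U k ↔
      ∀ t ∈ Icc 0 T, ∀ x : ℝ, ∀ n : ℤ, n ≠ 0 → residual T r c F U k t x n = 0 := by
  unfold Solvable
  refine forall₂_congr fun t ht => forall_congr' fun x => forall₂_congr fun n hn => ?_
  have hq : -(1 / (1 - qR r c) : ℂ) ≠ 0 := by
    have : (1 : ℂ) - qR r c ≠ 0 := by exact_mod_cast h.one_sub_q_pos.ne'
    exact neg_ne_zero.mpr (one_div_ne_zero this)
  rw [h.coker_bdRhs hn t x fun i => temperate_srcMod hT h0 hU ht x hn i, mul_eq_zero,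
    or_iff_right hq]
  rfl

theorem mode_srcBd (hT : 0 < T) (h0 : ∀ j < 2, U j = 0) {k : ℕ}
    (hU : ∀ j ≤ k, RegProfile T (U j)) (hF : ∀ i, InBd T (F i)) {t : ℝ} (ht : t ∈ Icc 0 T) (x : ℝ)
    (n : ℤ) (i : Fin 2) : mode n (srcBd T r F U k i) t x 0 0
      = mode n (srcBdPart T r U k i) t x 0 0 + if k = 2 then fc n (slice (F i) t x) else 0 := by
  by_cases hk : k = 2
  · rw [if_pos hk]
    have h1 := (isReg_srcBdPart_of_le (r := r) hT h0 hU i).per.continuous (perBox_domAll hT)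
      (mem_domAll (x := x) (θ := 0) ht (le_refl (0 : ℝ)) (le_refl (0 : ℝ)))
    simp only [update_domAll_three] at h1
    have h2 := (smoothPer_slice hT (hF i).smoothPerOn (x := x) ht).continuous
    have e := fc_add h1 h2 n
    refine Eq.trans (fc_congr n fun θ => ?_) e
    rw [srcBd_eq, if_pos hk]
    push_cast
    rfl
  · rw [if_neg hk, add_zero, srcBd_of_ne F U hk]

theorem residual_neg (k : ℕ) (t x : ℝ) {n : ℤ} (hn : n ≠ 0) :
    residual T r c F U k t x (-n) = conj (residual T r c F U k t x n) := by
  unfold residual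
  rw [← pairing_conj]
  congr 1
  · funext i; exact mode_neg_index n _ _ _ _ _
  · funext i s; exact srcMod_neg hn k i t x s

/-- For k ≠ 2 the forcing is absent and all sources are regular, so the residual has summable
coefficients and defines a function of θ. -/
theorem IsRayleigh.exists_norm_residual_le (h : IsRayleigh r c) (hT : 0 < T)
    (h0 : ∀ j < 2, U j = 0) {k : ℕ} (hk : k ≠ 2) (hU : ∀ j ≤ k, RegProfile T (U j))
    {t : ℝ} (ht : t ∈ Icc 0 T) (x : ℝ) :
    ∃ C, 0 ≤ C ∧ ∀ n : ℤ, n ≠ 0 → ‖residual T r c F U k t x n‖ ≤ C * wt n := by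
  choose A hA0 hA using fun i =>
    (isReg_srcBdPart_of_le (r := r) hT h0 hU i).exists_norm_mode_le hT (x := x) ht le_rfl
  choose B hB0 hB using fun i => exists_norm_srcMod_le (r := r) (c := c) hT h0 hU ht x i
  obtain ⟨K, hK0, hK⟩ := h.exists_norm_pairing_le k
  have hS : 0 ≤ ∑ i, (A i + B i) := Finset.sum_nonneg fun i _ => add_nonneg (hA0 i) (hB0 i)
  have hle : ∀ i, A i + B i ≤ ∑ i, (A i + B i) := fun i =>
    Finset.single_le_sum (f := fun i => A i + B i) (fun i _ => add_nonneg (hA0 i) (hB0 i))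
      (Finset.mem_univ i)
  refine ⟨K * ∑ i, (A i + B i), mul_nonneg hK0 hS, fun n hn => ?_⟩
  have hw := wt_nonneg n
  rw [mul_assoc]
  refine hK n hn _ _ _ (mul_nonneg hS hw) (fun i => ?_) fun i s hs => ?_
  · rw [srcBd_of_ne F U hk]
    exact (hA i n 0 le_rfl).trans (mul_le_mul_of_nonneg_right
      ((le_add_of_nonneg_right (hB0 i)).trans (hle i)) hw)
  · exact (hB i n hn s hs).trans (mul_le_mul_of_nonneg_right (mul_le_mul_of_nonneg_right
      ((le_add_of_nonneg_left (hA0 i)).trans (hle i)) hw) (by positivity))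

/-- The contribution of the boundary forcing to the solvability condition of level two. -/
def forcing (r c : ℝ) (F : Fin 2 → (Fin 3 → ℝ) → ℝ) (t x : ℝ) (n : ℤ) : ℂ :=
  ∑ i, rmode r c (-n) 0 i * fc n (slice (F i) t x)

/-- The leading terms with a = 1/2 are the entire source here, and the forcing adds its own boundary
pairing. -/
theorem residual_two (hR : IsRayleigh r c) (hT : 0 < T) (h0 : ∀ j < 2, U j = 0)
    {α : (Fin 3 → ℝ) → ℝ} (hα : RayleighModes T r c (U 2) α) (hF : ∀ i, InBd T (F i)) {t : ℝ}
    (ht : t ∈ Icc 0 T) (x : ℝ) {n : ℤ} (hn : n ≠ 0) :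
    residual T r c F U 2 t x n
      = symbolR r c n * ampCoef T r c 1 α α t x n + forcing r c F t x n := by
  have hU : ∀ j ≤ 2, RegProfile T (U j) := by
    intro j hj
    rcases Nat.lt_or_eq_of_le hj with h | h
    · rw [h0 j h]; exact regProfile_zero
    · rw [h]; exact hα.reg
  have key := hα.pairing_eq hR hT hα (1 / 2) (x := x) ht hn
  rw [show (2 : ℝ) * (1 / 2) = 1 by norm_num] at key
  rw [← key, residual]
  have e1 : ∀ i, mode n (srcBd T r F U 2 i) t x 0 0
      = mode n (linBd T r (U 2) (U 2) (1 / 2) i) t x 0 0 + fc n (slice (F i) t x) := by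
    intro i
    rw [mode_srcBd hT h0 hU hF ht, if_pos rfl]
    congr 1
    exact congrArg (fun f => mode n f t x 0 0) (funext fun p => srcBdPart_two h0 i p)
  have e2 : ∀ i s, 0 ≤ s → srcMod T r c U 2 n i t x s
      = mode n (linInt T r c (U 2) (U 2) (1 / 2) i) t x 0 s := by
    intro i s hs
    rw [srcMod_two hn]
    exact mode_congr (srcInt_two hT h0 hα.reg i) ht le_rfl hs n
  rw [pairing_congr e1 e2]
  simp only [pairing, forcing, mul_add, Finset.sum_add_distrib]
  ring

/-- By linearity of the pairing only the terms containing U_k - V_k remain, with a = 1. Different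
forcings are allowed, as forcing is absent from sources of level k ≥ 3. -/
theorem residual_sub (hR : IsRayleigh r c) (hT : 0 < T) (h0 : ∀ j < 2, U j = 0)
    (h0' : ∀ j < 2, V j = 0) {k : ℕ} (hk : 3 ≤ k) (hUV : ∀ j < k, U j = V j)
    (hU : ∀ j ≤ k, RegProfile T (U j)) (hV : RegProfile T (V k))
    {α β : (Fin 3 → ℝ) → ℝ} (hα : RayleighModes T r c (U 2) α)
    (hβ : RayleighModes T r c ((U k).diff (V k)) β) {t : ℝ}
    (ht : t ∈ Icc 0 T) (x : ℝ) {n : ℤ} (hn : n ≠ 0) :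
    residual T r c F U k t x n - residual T r c F' V k t x n
      = symbolR r c n * ampCoef T r c 2 α β t x n := by
  have hV' : ∀ j ≤ k, RegProfile T (V j) := by
    intro j hj
    rcases Nat.lt_or_eq_of_le hj with h | h
    · rw [← hUV j h]; exact hU j hj
    · rw [h]; exact hV
  have key := hα.pairing_eq hR hT hβ 1 (x := x) ht hn
  rw [mul_one] at key
  rw [← key, residual, residual, hR.pairing_sub hn _ _
    (fun i => temperate_srcMod hT h0 hU ht x hn i) fun i => temperate_srcMod hT h0' hV' ht x hn i]
  refine pairing_congr (fun i => ?_) fun i s hs => ?_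
  · rw [srcBd_of_ne F U (by omega), srcBd_of_ne F' V (by omega),
      ← (isReg_srcBdPart_of_le hT h0 hU i).mode_sub hT (isReg_srcBdPart_of_le hT h0' hV' i) ht
        le_rfl le_rfl]
    exact mode_congr (srcBdPart_sub hT h0 h0' hk hUV (hU k le_rfl) hV i) ht le_rfl le_rfl n
  · rw [srcMod_sub h0 h0' hUV hn, ← (isReg_srcInt_of_le hT h0 hU i).mode_sub hT
      (isReg_srcInt_of_le hT h0' hV' i) ht le_rfl hs]
    exact mode_congr (srcInt_sub hT h0 h0' hk hUV (hU 2 (by omega)) (hU k le_rfl) hV i) ht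
      le_rfl hs n

/-! ### Properties of the coefficients -/

theorem slice_neg_index (α : (Fin 3 → ℝ) → ℝ) (t x : ℝ) (n : ℤ) :
    fc (-n) (slice α t x) = conj (fc n (slice α t x)) := fc_neg_ofReal _ n

theorem ampCoef_neg (m : ℝ) (α₂ α : (Fin 3 → ℝ) → ℝ) (t x : ℝ) (n : ℤ) :
    ampCoef T r c m α₂ α t x (-n) = conj (ampCoef T r c m α₂ α t x n) := by
  simp only [ampCoef, map_add, map_mul, map_neg, Complex.conj_ofReal, Complex.conj_I,
    slice_neg_index, bilinCoeff_conj _ (slice_neg_index α₂ t x) (slice_neg_index α t x),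
    Int.sign_neg, Int.cast_neg, map_intCast]
  ring

theorem IsRayleigh.summable_ampCoef (h : IsRayleigh r c) (hT : 0 < T) (m : ℝ)
    {α₂ α : (Fin 3 → ℝ) → ℝ} (hα₂ : SmoothPerOn (domBd T) 2 α₂) (hα : SmoothPerOn (domBd T) 2 α)
    {t : ℝ} (ht : t ∈ Icc 0 T) (x : ℝ) : Summable (ampCoef T r c m α₂ α t x) := by
  have s0 := (smoothPer_slice hT (hα.pd (perBox_domBd hT) 0) (x := x) ht).summable_fc
  have s1 := (smoothPer_slice hT (hα.pd (perBox_domBd hT) 1) (x := x) ht).summable_fc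
  have s2 := (h.summable_bilin (constR r c) (smoothPer_slice hT hα₂ (x := x) ht)
    (smoothPer_slice hT hα (x := x) ht)).2
  refine (s0.add (s1.mul_left _)).add (Summable.mul_left _ ?_)
  refine Summable.of_norm_bounded s2.norm fun n => ?_
  rw [norm_mul, norm_mul, norm_neg, Complex.norm_I, one_mul]
  refine mul_le_of_le_one_left (norm_nonneg _) ?_
  rcases lt_trichotomy n 0 with hn | hn | hn
  · rw [Int.sign_eq_neg_one_of_neg hn]; simp
  · subst hn; simp
  · rw [Int.sign_eq_one_of_pos hn]; simp

theorem IsRayleigh.ampCoef_sub (h : IsRayleigh r c) (hT : 0 < T) (m : ℝ)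
    {α₂ α β : (Fin 3 → ℝ) → ℝ} (hα₂ : SmoothPerOn (domBd T) 2 α₂)
    (hα : SmoothPerOn (domBd T) 2 α) (hβ : SmoothPerOn (domBd T) 2 β)
    {t : ℝ} (ht : t ∈ Icc 0 T) (x : ℝ) (n : ℤ) :
    ampCoef T r c m α₂ (fun p => α p - β p) t x n
      = ampCoef T r c m α₂ α t x n - ampCoef T r c m α₂ β t x n := by
  have hD := perBox_domBd hT
  have sl : ∀ {γ}, SmoothPerOn (domBd T) 2 γ → SmoothPer (slice γ t x) := fun hγ =>
    smoothPer_slice hT hγ ht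
  have e : ∀ i, fc n (slice (pd (domBd T) i (fun p => α p - β p)) t x)
      = fc n (slice (pd (domBd T) i α) t x) - fc n (slice (pd (domBd T) i β) t x) := by
    intro i
    rw [← fc_sub (sl (hα.pd hD i)).continuous (sl (hβ.pd hD i)).continuous]
    refine fc_congr n fun θ => ?_
    simp only [slice]
    rw [pd_sub hD.uniq hα.smooth hβ.smooth i (mem_domBd ht)]
    push_cast; rfl
  have hsα := (h.summable_bilin (constR r c) (sl hα₂) (sl hα)).1 n
  have hsβ := (h.summable_bilin (constR r c) (sl hα₂) (sl hβ)).1 n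
  have e2 : bilinCoeff (ker r c) (constR r c) (slice α₂ t x) (slice (fun p => α p - β p) t x) n
      = bilinCoeff (ker r c) (constR r c) (slice α₂ t x) (slice α t x) n
        - bilinCoeff (ker r c) (constR r c) (slice α₂ t x) (slice β t x) n := by
    simp only [bilinCoeff]
    rw [← mul_sub, ← hsα.tsum_sub hsβ]
    congr 1
    refine tsum_congr fun m => ?_
    rw [bilinTerm_ker, bilinTerm_ker, bilinTerm_ker, slice_sub,
      fc_sub (sl hα).continuous (sl hβ).continuous]
    ring
  simp only [ampCoef, e, e2]
  ring

/-- Differentiating the mean-zero condition in t and x. The equation thus has no content at n = 0,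
in accordance with solvability being required only for n ≠ 0. -/
theorem IsAmplitude.fc_zero_pd (hT : 0 < T) {α : (Fin 3 → ℝ) → ℝ} (hα : IsAmplitude T α)
    {t : ℝ} (ht : t ∈ Icc 0 T) (x : ℝ) : fc 0 (slice (pd (domBd T) 0 α) t x) = 0 ∧
      fc 0 (slice (pd (domBd T) 1 α) t x) = 0 := by
  have hD := perBox_domBd hT
  have hs := hα.1.smoothPerOn
  constructor
  · have h := hs.hasDerivWithinAt_modeAt hD (mem_domBd (x := x) (θ := 0) ht) (i := 0) (by decide) 0
    rw [← fc_slice_eq_modeAt] at h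
    have e : ∀ s, modeAt 2 0 α (Function.update ![t, x, 0] 0 s) = fc 0 (slice α s x) := by
      intro s
      rw [fc_slice_eq_modeAt 0 α s x 0]
      congr 1
      ext i; fin_cases i <;> rfl
    simp only [e] at h
    exact (uniqueDiffOn_Icc hT t ht).eq_deriv _ h ((hasDerivWithinAt_const t (Icc 0 T) (0 : ℂ)).congr
      (fun s hs => hα.2 s hs x) (hα.2 t ht x))
  · have h := hs.hasDerivWithinAt_modeAt hD (mem_domBd (x := x) (θ := 0) ht) (i := 1) (by decide) 0
    rw [← fc_slice_eq_modeAt] at h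
    have e : ∀ s, modeAt 2 0 α (Function.update ![t, x, 0] 1 s) = fc 0 (slice α t s) := by
      intro s
      rw [fc_slice_eq_modeAt 0 α t s 0]
      congr 1
      ext i; fin_cases i <;> rfl
    simp only [e] at h
    exact (uniqueDiffOn_univ x (mem_univ x)).eq_deriv _ h
      ((hasDerivWithinAt_const x univ (0 : ℂ)).congr (fun s _ => hα.2 t ht s) (hα.2 t ht x))

theorem IsAmplitude.ampCoef_zero (hT : 0 < T) {α : (Fin 3 → ℝ) → ℝ} (hα : IsAmplitude T α)
    (m : ℝ) (α₂ : (Fin 3 → ℝ) → ℝ) {t : ℝ} (ht : t ∈ Icc 0 T) (x : ℝ) :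
    ampCoef T r c m α₂ α t x 0 = 0 := by
  obtain ⟨h0, h1⟩ := hα.fc_zero_pd hT ht x
  simp [ampCoef, h0, h1]

/-- The real part of a Fourier series. -/
def fourierRe (N : ℤ → ℂ) (θ : ℝ) : ℝ := (∑' n, N n * ex n θ).re

theorem summable_mul_ex {N : ℤ → ℂ} (hN : Summable N) (θ : ℝ) :
    Summable fun n => N n * ex n θ :=
  Summable.of_norm_bounded hN.norm fun n => by rw [norm_mul, norm_ex, mul_one]

theorem coe_fourierRe {N : ℤ → ℂ} (hN : ∀ n, N (-n) = conj (N n)) (θ : ℝ) :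
    (fourierRe N θ : ℂ) = ∑' n, N n * ex n θ := by
  refine Complex.conj_eq_iff_re.mp ?_
  rw [Complex.conj_tsum, ← (Equiv.neg ℤ).tsum_eq (fun n => N n * ex n θ)]
  refine tsum_congr fun n => ?_
  rw [map_mul, conj_ex, ← hN]
  rfl

/-- The amplitude equation holds if and only if all its Fourier coefficients agree. -/
theorem IsRayleigh.amplitude_equation_iff (h : IsRayleigh r c) (hT : 0 < T) (m : ℝ)
    {α₂ α : (Fin 3 → ℝ) → ℝ} (hα₂ : IsAmplitude T α₂) (hα : IsAmplitude T α)
    {t : ℝ} (ht : t ∈ Icc 0 T) (x : ℝ) {N : ℤ → ℂ} (hN : Summable N) (hN0 : N 0 = 0)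
    (hNc : ∀ n, N (-n) = conj (N n)) :
    (∀ n, n ≠ 0 → ampCoef T r c m α₂ α t x n = N n) ↔
    ∀ θ : ℝ, ((pd (domBd T) 0 α ![t, x, θ] + c * pd (domBd T) 1 α ![t, x, θ] : ℝ) : ℂ)
      + m * hilbert (bilin (ker r c) (constR r c) (slice α₂ t x) (slice α t x)) θ
      = (fourierRe N θ : ℂ) := by
  have hD := perBox_domBd hT
  have hs₂ := hα₂.1.smoothPerOn
  have hs := hα.1.smoothPerOn
  have s0 := smoothPer_slice hT (hs.pd hD 0) (x := x) ht
  have s1 := smoothPer_slice hT (hs.pd hD 1) (x := x) ht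
  have s2 := (h.summable_bilin (constR r c) (smoothPer_slice hT hs₂ (x := x) ht)
    (smoothPer_slice hT hs (x := x) ht)).2
  have hA := h.summable_ampCoef hT m hs₂ hs ht x
  have hfc : ∀ n, fc n (bilin (ker r c) (constR r c) (slice α₂ t x) (slice α t x))
      = bilinCoeff (ker r c) (constR r c) (slice α₂ t x) (slice α t x) n := fc_hasSum s2
  have hlhs : ∀ θ : ℝ, ((pd (domBd T) 0 α ![t, x, θ] + c * pd (domBd T) 1 α ![t, x, θ] : ℝ) : ℂ)
      + m * hilbert (bilin (ker r c) (constR r c) (slice α₂ t x) (slice α t x)) θ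
      = ∑' n, ampCoef T r c m α₂ α t x n * ex n θ := by
    intro θ
    have e0 := s0.hasSum_fc θ
    have e1 := (s1.hasSum_fc θ).mul_left (c : ℂ)
    have e01 := e0.add e1
    have e2 := (summable_mul_ex hA θ).hasSum.sub e01
    have e3 : hilbert (bilin (ker r c) (constR r c) (slice α₂ t x) (slice α t x)) θ
        = ∑' n, -Complex.I * (n.sign : ℂ)
          * bilinCoeff (ker r c) (constR r c) (slice α₂ t x) (slice α t x) n * ex n θ := by
      simp only [hilbert, hfc, ex]
    have e4 : (m : ℂ) * hilbert (bilin (ker r c) (constR r c) (slice α₂ t x) (slice α t x)) θ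
        = ∑' n, ampCoef T r c m α₂ α t x n * ex n θ
          - (slice (pd (domBd T) 0 α) t x θ + c * slice (pd (domBd T) 1 α) t x θ) := by
      rw [← e2.tsum_eq, e3, ← tsum_mul_left]
      refine tsum_congr fun n => ?_
      rw [ampCoef]; ring
    rw [e4]
    simp only [slice]
    push_cast
    ring
  simp only [hlhs, coe_fourierRe hNc]
  constructor
  · intro hn θ
    refine tsum_congr fun n => ?_
    by_cases h0 : n = 0
    · rw [h0, hα.ampCoef_zero hT m α₂ ht x, hN0]
    · rw [hn n h0]
  -- Both sides are absolutely convergent series, so equality of the functions gives back equality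
  -- of coefficients.
  · intro hθ n _
    rw [← fc_hasSum hA n, ← fc_hasSum hN n]
    exact fc_congr n hθ

end

section

variable {T r c : ℝ} {F F' : Fin 2 → (Fin 3 → ℝ) → ℝ} {U V : ℕ → Profile} {k : ℕ}

/-! ### The right sides of the amplitude equations -/

/-- The Fourier coefficients of the right side of the equation for the leading amplitude. -/
def forcingCoef (r c : ℝ) (F : Fin 2 → (Fin 3 → ℝ) → ℝ) (t x : ℝ) (n : ℤ) : ℂ :=
  if n = 0 then 0 else -(forcing r c F t x n / symbolR r c n)

theorem forcingCoef_neg (t x : ℝ) (n : ℤ) :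
    forcingCoef r c F t x (-n) = conj (forcingCoef r c F t x n) := by
  have e : ∀ i, rmode r c (-((-n : ℤ) : ℝ)) 0 i = conj (rmode r c (-n) 0 i) := by
    intro i
    rw [← rmode_neg]; push_cast; rfl
  have e2 : forcing r c F t x (-n) = conj (forcing r c F t x n) := by
    simp only [forcing, e, slice_neg_index, map_sum, map_mul]
  simp only [forcingCoef, neg_eq_zero]
  split_ifs with hn
  · rw [map_zero]
  · rw [e2, symbolR_neg, map_neg, map_div₀]

/-- Coefficients that are controlled by a multiple of the symbol are summable. -/
theorem IsRayleigh.summable_div_symbolR (h : IsRayleigh r c) {N : ℤ → ℂ} {C : ℝ}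
    (hN : ∀ n, n ≠ 0 → ‖N n‖ ≤ C * wt n) :
    Summable fun n => if n = 0 then 0 else N n / symbolR r c n := by
  have hpos : 0 < 2 * c * massR r c := mul_pos (mul_pos two_pos h.pos) h.massR_pos
  refine Summable.of_norm_bounded (summable_wt.mul_left (|C| / (2 * c * massR r c))) fun n => ?_
  have hw := wt_nonneg n
  split_ifs with hn
  · rw [norm_zero]; positivity
  · rw [norm_div, h.norm_symbolR hn, div_mul_eq_mul_div]
    exact div_le_div_of_nonneg_right ((hN n hn).trans
      (mul_le_mul_of_nonneg_right (le_abs_self C) hw)) hpos.le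

theorem IsRayleigh.summable_forcingCoef (h : IsRayleigh r c) (hT : 0 < T)
    (hF : ∀ i, InBd T (F i)) {t : ℝ} (ht : t ∈ Icc 0 T) (x : ℝ) :
    Summable (forcingCoef r c F t x) := by
  obtain ⟨K, hK0, hK⟩ := h.exists_norm_mode_le
  choose C hC0 hC using fun i =>
    (smoothPer_slice hT (hF i).smoothPerOn (x := x) ht).exists_norm_fc_le
  have hb : ∀ n : ℤ, n ≠ 0 → ‖forcing r c F t x n‖ ≤ (∑ i, K * C i) * wt n := by
    intro n _
    rw [Finset.sum_mul]
    refine (norm_sum_le _ _).trans (Finset.sum_le_sum fun i _ => ?_)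
    have h1 := (hK (-n) 0 le_rfl).1 i
    rw [dex_zero, mul_one] at h1
    rw [norm_mul, mul_assoc]
    exact mul_le_mul h1 (hC i n) (norm_nonneg _) hK0.le
  have hs := (h.summable_div_symbolR hb).neg
  refine hs.congr fun n => ?_
  simp only [forcingCoef]
  split_ifs <;> simp

/-- A profile of level `k` over the lower levels of `U`, together with its amplitudes of level
two and `k`. -/
structure IsReference (T r c : ℝ) (F : Fin 2 → (Fin 3 → ℝ) → ℝ) (U : ℕ → Profile) (k : ℕ)
    (V : ℕ → Profile) (β₂ β : (Fin 3 → ℝ) → ℝ) : Prop where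
  eq : ∀ j < k, U j = V j
  mem : InS T (V k)
  amp_two : IsAmplitude T β₂
  amp : IsAmplitude T β
  has_two : HasAmplitude T r c F V 2 β₂
  has : HasAmplitude T r c F V k β

theorem IsReference.congr (hUU : ∀ j < k, U j = V j) (hF : k = 3 → F = F') {W : ℕ → Profile}
    {β₂ β : (Fin 3 → ℝ) → ℝ} (h : IsReference T r c F U k W β₂ β) :
    IsReference T r c F' V k W β₂ β :=
  ⟨fun j hj => (hUU j hj).symm.trans (h.eq j hj), h.mem, h.amp_two, h.amp,
    h.has_two.congr_forcing fun e => absurd e (by norm_num), h.has.congr_forcing hF⟩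

/-- The Fourier coefficients of the right side of the equation for the amplitude of level `k`,
computed from a reference profile. -/
def refCoef (T r c : ℝ) (k : ℕ) (V : ℕ → Profile) (β₂ β : (Fin 3 → ℝ) → ℝ) (t x : ℝ) (n : ℤ) : ℂ :=
  ampCoef T r c 2 β₂ β t x n
    - if n = 0 then 0 else residual T r c 0 V k t x n / symbolR r c n

theorem refCoef_neg {β₂ β : (Fin 3 → ℝ) → ℝ} (t x : ℝ) (n : ℤ) :
    refCoef T r c k V β₂ β t x (-n) = conj (refCoef T r c k V β₂ β t x n) := by
  simp only [refCoef, neg_eq_zero, map_sub, ampCoef_neg]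
  split_ifs with hn
  · rw [map_zero]
  · rw [residual_neg k t x hn, symbolR_neg, map_div₀]

open Classical in
/-- The function whose Fourier coefficients are computed from a choice of a reference. -/
def choiceSide (T r c : ℝ) (k : ℕ)
    (R : (ℕ → Profile) × ((Fin 3 → ℝ) → ℝ) × ((Fin 3 → ℝ) → ℝ) → Prop) (p : Fin 3 → ℝ) : ℝ :=
  if h : ∃ W, R W then
    fourierRe (refCoef T r c k h.choose.1 h.choose.2.1 h.choose.2.2 (p 0) (p 1)) (p 2)
  else 0

/-- The right side of the equation for the amplitude of level `k`. -/
def rightSide (T r c : ℝ) (k : ℕ) (F : Fin 2 → (Fin 3 → ℝ) → ℝ) (U : ℕ → Profile) :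
    (Fin 3 → ℝ) → ℝ :=
  choiceSide T r c k fun W => IsReference T r c F U k W.1 W.2.1 W.2.2

/-- The predicates describing admissible references are equal, so the choice made from them is
literally the same. This is how dependence on the lower levels alone survives the use of choice. -/
theorem rightSide_congr (hUU : ∀ j < k, U j = V j) (hF : k = 3 → F = F') :
    rightSide T r c k F U = rightSide T r c k F' V := by
  have e : (fun R : (ℕ → Profile) × ((Fin 3 → ℝ) → ℝ) × ((Fin 3 → ℝ) → ℝ) =>
      IsReference T r c F U k R.1 R.2.1 R.2.2)
      = fun R => IsReference T r c F' V k R.1 R.2.1 R.2.2 := by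
    funext R
    exact propext ⟨IsReference.congr hUU hF,
      IsReference.congr (fun j hj => (hUU j hj).symm) fun h => (hF h).symm⟩
  rw [rightSide, rightSide, e]

theorem exists_rightSide_eq {β₂ β : (Fin 3 → ℝ) → ℝ} (h : IsReference T r c F U k V β₂ β) :
    ∃ W γ₂ γ, IsReference T r c F U k W γ₂ γ ∧ ∀ t x θ,
      rightSide T r c k F U ![t, x, θ] = fourierRe (refCoef T r c k W γ₂ γ t x) θ := by
  have hex : ∃ R : (ℕ → Profile) × ((Fin 3 → ℝ) → ℝ) × ((Fin 3 → ℝ) → ℝ),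
    IsReference T r c F U k R.1 R.2.1 R.2.2 := ⟨(V, β₂, β), h⟩
  refine ⟨hex.choose.1, hex.choose.2.1, hex.choose.2.2, hex.choose_spec, fun t x θ => ?_⟩
  rw [rightSide, choiceSide, dif_pos hex]
  rfl

/-- The profile determines its amplitude, since the first component of r̂ at Y = 0 is q(q - 1) ≠ 0.
It is needed because a chosen reference carries its own amplitude of level two. -/
theorem RayleighModes.fc_eq (h : IsRayleigh r c) {P : Profile} {α β : (Fin 3 → ℝ) → ℝ}
    (hα : RayleighModes T r c P α) (hβ : RayleighModes T r c P β) {t : ℝ} (ht : t ∈ Icc 0 T)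
    (x : ℝ) {n : ℤ} (hn : n ≠ 0) : fc n (slice α t x) = fc n (slice β t x) := by
  have e := (hα.osc n hn t ht x 0 0 le_rfl le_rfl 0).symm.trans
    (hβ.osc n hn t ht x 0 0 le_rfl le_rfl 0)
  refine mul_right_cancel₀ ?_ e
  rw [rmode_apply_zero, dex_zero, dex_zero, mul_one]
  have h1 := h.q_pos
  have h2 := h.one_sub_q_pos
  exact_mod_cast (mul_neg_of_pos_of_neg h1 (by linarith)).ne

theorem ampCoef_congr_left {m : ℝ} {α β γ : (Fin 3 → ℝ) → ℝ} {t x : ℝ}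
    (h : ∀ n, fc n (slice α t x) = fc n (slice β t x)) (n : ℤ) :
    ampCoef T r c m α γ t x n = ampCoef T r c m β γ t x n := by
  simp only [ampCoef, bilinCoeff, bilinTerm_ker, h]

theorem IsRayleigh.solvable_two_iff (hR : IsRayleigh r c) (hT : 0 < T) (hF : ∀ i, InBd T (F i))
    (h0 : ∀ j < 2, U j = 0) (hU : InS T (U 2)) {α : (Fin 3 → ℝ) → ℝ} (hα : IsAmplitude T α)
    (h : HasAmplitude T r c F U 2 α) : Solvable T r c F U 2 ↔
      ∀ t ∈ Icc 0 T, ∀ x θ : ℝ,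
        ((pd (domBd T) 0 α ![t, x, θ] + c * pd (domBd T) 1 α ![t, x, θ] : ℝ) : ℂ)
          + hilbert (bilin (ker r c) (constR r c) (slice α t x) (slice α t x)) θ
          = (fourierRe (forcingCoef r c F t x) θ : ℂ) := by
  have hmodes := h.rayleighModes_two hR hT h0 hU hα
  have hreg : ∀ j ≤ 2, RegProfile T (U j) := by
    intro j hj
    rcases Nat.lt_or_eq_of_le hj with h | h
    · rw [h0 j h]; exact regProfile_zero
    · rw [h]; exact hmodes.reg
  rw [hR.solvable_iff hT h0 hreg]
  refine forall₂_congr fun t ht => forall_congr' fun x => ?_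
  have key := hR.amplitude_equation_iff hT 1 hα hα ht x (hR.summable_forcingCoef hT hF ht x)
    (if_pos rfl) (forcingCoef_neg t x)
  simp only [Complex.ofReal_one, one_mul] at key
  rw [← key]
  refine forall₂_congr fun n hn => ?_
  have hs := hR.symbolR_ne_zero hn
  rw [residual_two hR hT h0 hmodes hF ht x hn, forcingCoef, if_neg hn, add_eq_zero_iff_eq_neg,
    ← neg_div, eq_div_iff hs, mul_comm]

/-- The residuals of U and of the reference V differ by the symbol times the difference of their
equation coefficients. Hence the residual of U vanishes exactly when its coefficients equal those in
`refCoef`, which depend on V alone. -/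
theorem IsRayleigh.solvable_iff_rightSide (hR : IsRayleigh r c) (hT : 0 < T) (hk : 3 ≤ k)
    (h0 : ∀ j < 2, U j = 0) (hU : ∀ j, 2 ≤ j → j ≤ k → InS T (U j))
    {α₂ α : (Fin 3 → ℝ) → ℝ} (hα₂ : IsAmplitude T α₂) (hα : IsAmplitude T α)
    (h₂ : HasAmplitude T r c F U 2 α₂) (h : HasAmplitude T r c F U k α) :
    Solvable T r c F U k ↔ ∀ t ∈ Icc 0 T, ∀ x θ : ℝ,
        ((pd (domBd T) 0 α ![t, x, θ] + c * pd (domBd T) 1 α ![t, x, θ] : ℝ) : ℂ)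
          + 2 * hilbert (bilin (ker r c) (constR r c) (slice α₂ t x) (slice α t x)) θ
          = (rightSide T r c k F U ![t, x, θ] : ℂ) := by
  -- U is a reference over its own lower levels, so the choice is not vacuous; the chosen V may be
  -- another one.
  obtain ⟨V, β₂, β, hV, hright⟩ := exists_rightSide_eq (F := F) (U := U) (V := U) (k := k)
    ⟨fun _ _ => rfl, hU k (by omega) le_rfl, hα₂, hα, h₂, h⟩
  have hreg : ∀ j ≤ k, RegProfile T (U j) := by
    intro j hj
    by_cases h : j < 2
    · rw [h0 j h]; exact regProfile_zero
    · exact fun i => (hU j (by omega) hj).isReg_eval hT i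
  have h0' : ∀ j < 2, V j = 0 := fun j hj => (hV.eq j (by omega)).symm.trans (h0 j hj)
  have hVk : RegProfile T (V k) := fun i => hV.mem.isReg_eval hT i
  have hVreg : ∀ j ≤ k, RegProfile T (V j) := by
    intro j hj
    rcases Nat.lt_or_eq_of_le hj with h | h
    · rw [← hV.eq j h]; exact hreg j hj
    · rw [h]; exact hVk
  have e2 : U 2 = V 2 := hV.eq 2 (by omega)
  have m2 := h₂.rayleighModes_two hR hT h0 (hU 2 le_rfl (by omega)) hα₂
  have m2' : RayleighModes T r c (U 2) β₂ := by
    rw [e2]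
    exact hV.has_two.rayleighModes_two hR hT h0' (by rw [← e2]; exact hU 2 le_rfl (by omega))
      hV.amp_two
  have md := h.rayleighModes_diff hR hT h0 h0' hk hV.eq (fun _ => rfl) (hU k (by omega) le_rfl)
    hV.mem hα hV.amp hV.has
  rw [hR.solvable_iff hT h0 hreg]
  refine forall₂_congr fun t ht => forall_congr' fun x => ?_
  -- V and U have the same second profile, so β₂ and α₂ have the same oscillating coefficients, and
  -- both have mean zero.
  have hfc : ∀ n, fc n (slice β₂ t x) = fc n (slice α₂ t x) := by
    intro n
    by_cases hn : n = 0
    · rw [hn, hV.amp_two.2 t ht x, hα₂.2 t ht x]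
    · exact m2'.fc_eq hR m2 ht x hn
  obtain ⟨C, -, hC⟩ := hR.exists_norm_residual_le (F := 0) hT h0' (by omega) hVreg ht x
  have hsum : Summable (refCoef T r c k V β₂ β t x) :=
    (hR.summable_ampCoef hT 2 hV.amp_two.1.smoothPerOn hV.amp.1.smoothPerOn ht x).sub
      (hR.summable_div_symbolR hC)
  have hzero : refCoef T r c k V β₂ β t x 0 = 0 := by
    rw [refCoef, if_pos rfl, sub_zero]
    exact hV.amp.ampCoef_zero hT 2 β₂ ht x
  have key := hR.amplitude_equation_iff hT 2 hα₂ hα ht x hsum hzero (refCoef_neg t x)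
  simp only [Complex.ofReal_ofNat, ← hright] at key
  rw [← key]
  refine forall₂_congr fun n hn => ?_
  have hs := hR.symbolR_ne_zero hn
  have hsub := residual_sub (F := F) (F' := 0) hR hT h0 h0' hk hV.eq hreg hVk m2 md ht x hn
  rw [hR.ampCoef_sub hT 2 hα₂.1.smoothPerOn hα.1.smoothPerOn hV.amp.1.smoothPerOn ht x] at hsub
  have hdiv := mul_div_cancel₀ (residual T r c 0 V k t x n) hs
  rw [refCoef, if_neg hn, ampCoef_congr_left hfc]
  constructor
  · intro hz
    refine mul_left_cancel₀ hs ?_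
    linear_combination hz - hsub + hdiv
  · intro hz
    linear_combination symbolR r c n * hz + hsub - hdiv

end

end RayleighWave

end

open RayleighWave

theorem proposition8p1 (r c : ℝ) (hr : 1 < r) (hc₀ : 0 < c) (hc₁ : c < 1)
    (hRayleigh : 2 - c ^ 2 = 2 * qR r c) :
    ∃ (c₀ : ℝ) (b : ℝ → ℝ → ℝ → ℂ),
      c₀ ≠ 0 ∧
      -- `b` is symmetric and homogeneous of degree two
      (∀ n₁ n₂ n₃, b n₁ n₂ n₃ = b n₂ n₁ n₃ ∧ b n₁ n₂ n₃ = b n₁ n₃ n₂) ∧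
      (∀ s > 0, ∀ n₁ n₂ n₃, b (s * n₁) (s * n₂) (s * n₃) = (s : ℂ) ^ 2 * b n₁ n₂ n₃) ∧
      -- the series that define `𝓑` on smooth periodic functions converge absolutely
      (∀ u v : ℝ → ℂ, ContDiff ℝ ∞ u → ContDiff ℝ ∞ v →
        Function.Periodic u (2 * Real.pi) → Function.Periodic v (2 * Real.pi) →
        (∀ n : ℤ, Summable (bilinTerm b u v n)) ∧ Summable (bilinCoeff b c₀ u v)) ∧
      ∀ T : ℝ, 0 < T →
        -- the equation for the leading amplitude
        (∃ G₂ : (Fin 2 → (Fin 3 → ℝ) → ℝ) → (Fin 3 → ℝ) → ℝ,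
          ∀ (F : Fin 2 → (Fin 3 → ℝ) → ℝ) (U : ℕ → Profile) (α₂ : (Fin 3 → ℝ) → ℝ),
            (∀ i, InBd T (F i)) → (∀ j < 2, U j = 0) → InS T (U 2) → IsAmplitude T α₂ →
            HasAmplitude T r c F U 2 α₂ →
            (Solvable T r c F U 2 ↔
              ∀ t ∈ Set.Icc 0 T, ∀ x θ : ℝ,
                ((pd (domBd T) 0 α₂ ![t, x, θ] + c * pd (domBd T) 1 α₂ ![t, x, θ] : ℝ) : ℂ)
                  + hilbert (bilin b c₀ (slice α₂ t x) (slice α₂ t x)) θ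
                  = (G₂ F ![t, x, θ] : ℂ))) ∧
        -- the equations for the higher amplitudes
        (∀ k : ℕ, 3 ≤ k →
          ∃ G : (Fin 2 → (Fin 3 → ℝ) → ℝ) → (ℕ → Profile) → (Fin 3 → ℝ) → ℝ,
            (∀ F F' U U', (∀ j < k, U j = U' j) → (k = 3 → F = F') → G F U = G F' U') ∧
            ∀ (F : Fin 2 → (Fin 3 → ℝ) → ℝ) (U : ℕ → Profile) (α₂ α : (Fin 3 → ℝ) → ℝ),
              (∀ i, InBd T (F i)) → (∀ j < 2, U j = 0) →
              (∀ j, 2 ≤ j → j ≤ k → InS T (U j)) → IsAmplitude T α₂ → IsAmplitude T α →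
              HasAmplitude T r c F U 2 α₂ → HasAmplitude T r c F U k α →
              (Solvable T r c F U k ↔
                ∀ t ∈ Set.Icc 0 T, ∀ x θ : ℝ,
                  ((pd (domBd T) 0 α ![t, x, θ] + c * pd (domBd T) 1 α ![t, x, θ] : ℝ) : ℂ)
                    + 2 * hilbert (bilin b c₀ (slice α₂ t x) (slice α t x)) θ
                    = (G F U ![t, x, θ] : ℂ))) := by
  have hR : IsRayleigh r c := ⟨hr, hc₀, hc₁, hRayleigh⟩
  -- The constant is c_0 = cM/π and the kernel is the cubic energy of three Rayleigh modes. G₂ is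
  -- the Fourier series of the paired forcing divided by the symbol.
  refine ⟨constR r c, ker r c, hR.constR_ne_zero,
    fun n₁ n₂ n₃ => ⟨ker_swap_left n₁ n₂ n₃, ker_swap_right n₁ n₂ n₃⟩,
    fun s hs n₁ n₂ n₃ => ker_smul hs n₁ n₂ n₃,
    fun u v hu hv hu' hv' => hR.summable_bilin (constR r c) ⟨hu, hu'⟩ ⟨hv, hv'⟩,
    fun T hT => ⟨⟨fun F p => fourierRe (forcingCoef r c F (p 0) (p 1)) (p 2), ?_⟩, ?_⟩⟩
  · intro F U α₂ hF h0 hU hα h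
    exact hR.solvable_two_iff hT hF h0 hU hα h
  · intro k hk
    refine ⟨rightSide T r c k, fun F F' U U' hUU hF => rightSide_congr hUU hF, ?_⟩
    intro F U α₂ α _ h0 hU hα₂ hα h₂ h
    exact hR.solvable_iff_rightSide hT hk h0 hU hα₂ hα h₂ h
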